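/- Let $N$ be a lattice of rank $r\ge 2$, $M=\mathrm{Hom}(N,\mathbb Z)$, $N_{\mathbb R}=N\otimes\mathbb R$. Let $E$ be a finite set with $|E|\ge 3$ and let $\Delta=(n_e)_{e\in E}$ be a family of vectors of $N$ with $\sum_e n_e=0$. Let $\omega\in\Lambda^2M$ be a $2$-form with $\iota_{n_e}\omega\neq 0$ for every $e\in E$, and fix $e_0\in E$. A parametrized rational tropical curve of degree $\Delta$ is a pair $(\Gamma,h)$: $\Gamma$ is a finite metric tree whose vertices all have valency at least $3$, with bounded edges of positive finite length and with unbounded ends labelled by $E$; $h:\Gamma\to N_{\mathbb R}$ is affine with slope in $N$ on each edge, has slope $n_e$ on the end $e$, and at each vertex the outgoing slopes sum to $0$. Curves are considered up to isometries that respect the labels and commute with $h$; their set is $\mathcal M_0(\Delta,N_{\mathbb R})$. A combinatorial type is a labelled tree up to isomorphism, and the curves of a given type form a cone. For a curve let $\mu_\omega(e)=\omega(n_e,p)$, where $p$ is any point of $h(e)$, and $\mathrm{mom}(\Gamma,h)=(\mu_\omega(e))_e\in\mathfrak M=\{\mu\in\mathbb R^E:\sum_e\mu_e=0\}$; let $h(e_0)$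 also denote the image of the end $e_0$ in $N_{\mathbb R}/\langle n_{e_0}\rangle$, which is a point. Let $\delta\in N$ with $\omega(n_{e_0},\delta)\neq 0$, let $\mu\in\mathfrak M$, and let $D$ be an affine line of slope $\delta$ in $N_{\mathbb R}/\langle n_{e_0}\rangle$. A solution for $(\mu,D)$ is a curve in $\mathcal M_0(\Delta,N_{\mathbb R})$ with $\mathrm{mom}(\Gamma,h)=\mu$ and $h(e_0)\in D$. Consider the composed evaluation map $\mathrm{ev}^{\omega,e_0}(\Gamma,h)=\bigl(h(e_0)\bmod\delta,\ (\mu_\omega(e))_{e\ne e_0}\bigr)$ with values in $N_{\mathbb R}/\langle n_{e_0},\delta\rangle\times\prod_{e\neq e_0}\mathbb R$. The pair $(\mu,D)$ is called generic if every solution is trivalent (every vertex has valency $3$) and $\mathrm{ev}^{\omega,e_0}$ is injective on the cone of its combinatorial type. For a trivalent vertex $V$ with outgoing slopes $a_V,b_V,c_V$, let $\pi_V=a_V\wedge b_V=b_V\wedge c_V=c_V\wedge a_V\in\Lambda^2N$, defined up to sign. Let $K_\omega\subset\Lambda^2N$ be the subgroup generated by the $\pi_V$ with $\omega(\pi_V)=0$,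 for all trivalent vertices $V$ that occur in rational tropical curves of degree $\Delta$. The refined multiplicity of a trivalent curve is $$B_\Gamma^{K_\omega}=\prod_{V}(q^{\pi_V}-q^{-\pi_V})\in\mathbb Z[\Lambda^2N/K_\omega],$$ where the sign of $\pi_V$ is chosen such that $\omega(\pi_V)>0$; if $\omega(\pi_V)=0$ for some $V$, then $B_\Gamma^{K_\omega}=0$. **Theorem.** (1) For every $\delta\in N$ with $\omega(n_{e_0},\delta)\ne0$ there are finitely many proper linear subspaces of $\mathfrak M\times N_{\mathbb R}/\langle n_{e_0}\rangle$ such that, for every $(\mu,p)$ outside their union, $(\mu,D)$ is generic, where $D$ is the line of slope $\delta$ through $p$. (2) For every generic $(\mu,D)$ there are finitely many solutions, so that $$\mathcal B_\Delta(\mu,D)=\sum_{\substack{\mathrm{mom}(\Gamma,h)=\mu\\ h(e_0)\in D}}B_\Gamma^{K_\omega}\in\mathbb Z[\Lambda^2N/K_\omega]$$ is defined. (3) $\mathcal B_\Delta(\mu,D)$ does not depend on the choice of the generic pair $(\mu,D)$, nor on the slope $\delta$ of $D$: there is a unique element $\mathcal B_\Delta^{\omega,e_0}\in\mathbb Z[\Lambda^2N/K_\omega]$,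 determined by $\Delta$, $\omega$ and $e_0$, such that $\mathcal B_\Delta(\mu,D)=\mathcal B_\Delta^{\omega,e_0}$ for all $\delta\in N$ with $\omega(n_{e_0},\delta)\neq0$ and all generic $(\mu,D)$ with $D$ of slope $\delta$. -/

import Mathlib

open scoped TensorProduct

noncomputable section

/-- The underlying graph of a rational tropical curve with unbounded ends labelled by `E`: a finite
tree, with every unbounded end attached to a vertex and with every vertex of valency at least `3`.
(The `1`-valent vertices at infinity of the compactified graph are not vertices here; each of them
is recorded as an unbounded end.) -/
structure RatTree (E : Type*) [Fintype E] where
  V : Type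
  fintypeV : Fintype V
  graph : SimpleGraph V
  isTree : graph.IsTree
  /-- the vertex to which an unbounded end is attached -/
  root : E → V
  three_le_valence : ∀ v : V,
    3 ≤ Nat.card ({w : V // graph.Adj v w} ⊕ {e : E // root e = v})

attribute [instance] RatTree.fintypeV

namespace RatTree

variable {E : Type*} [Fintype E]

/-- The edges adjacent to the vertex `v`: the bounded ones (given by the other extremity), and the
unbounded ends. -/
def Star (T : RatTree E) (v : T.V) : Type _ :=
  {w : T.V // T.graph.Adj v w} ⊕ {e : E // T.root e = v}

instance (T : RatTree E) (v : T.V) : Fintype (T.Star v) :=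
  Fintype.ofFinite ({w : T.V // T.graph.Adj v w} ⊕ {e : E // T.root e = v})

/-- The valency of a vertex. -/
def valence (T : RatTree E) (v : T.V) : ℕ := Nat.card (T.Star v)

/-- Homeomorphisms of the underlying graphs that respect the labels of the unbounded ends. -/
def IsIso (T T' : RatTree E) (φ : T.V ≃ T'.V) : Prop :=
  (∀ v w, T'.graph.Adj (φ v) (φ w) ↔ T.graph.Adj v w) ∧ ∀ e, T'.root e = φ (T.root e)

theorem IsIso.refl (T : RatTree E) : IsIso T T (Equiv.refl _) :=
  ⟨fun _ _ => Iff.rfl, fun _ => rfl⟩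

theorem IsIso.symm {T T' : RatTree E} {φ : T.V ≃ T'.V} (h : IsIso T T' φ) :
    IsIso T' T φ.symm :=
  ⟨fun v w => by simpa using (h.1 (φ.symm v) (φ.symm w)).symm, fun e => by simp [h.2 e]⟩

theorem IsIso.trans {T T' T'' : RatTree E} {φ : T.V ≃ T'.V} {ψ : T'.V ≃ T''.V}
    (h : IsIso T T' φ) (h' : IsIso T' T'' ψ) : IsIso T T'' (φ.trans ψ) :=
  ⟨fun v w => by simp [h'.1, h.1], fun e => by simp [h.2 e, h'.2 e]⟩

/-- The bijection that an isomorphism induces between the edges adjacent to corresponding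
vertices. -/
def IsIso.starEquiv {T T' : RatTree E} {φ : T.V ≃ T'.V} (h : IsIso T T' φ) (v : T.V) :
    T.Star v ≃ T'.Star (φ v) :=
  Equiv.sumCongr (φ.subtypeEquiv fun w => (h.1 v w).symm)
    (Equiv.subtypeEquivRight fun e => by rw [h.2 e, φ.apply_eq_iff_eq])

theorem IsIso.valence_eq {T T' : RatTree E} {φ : T.V ≃ T'.V} (h : IsIso T T' φ) (v : T.V) :
    T'.valence (φ v) = T.valence v :=
  (Nat.card_congr (h.starEquiv v)).symm

end RatTree

/-- A parametrized rational tropical curve of degree `Δ : E → N` in `N_ℝ = ℝ ⊗ N`, with labelled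
unbounded ends. The map `h` is recorded by the images `pos v` of the vertices and by its slopes:
`h` maps the bounded edge from `v` to `w` affinely, with slope `slope v w ∈ N` when the edge is
oriented from `v` to `w`, and the unbounded end `e` to the half-line
`pos (root e) + ℝ_{≥ 0} Δ e`. Values of `length` and `slope` outside the edges are irrelevant. -/
structure TropicalCurve {E N : Type*} [Fintype E] [AddCommGroup N] (Δ : E → N)
    extends RatTree E where
  length : Sym2 V → ℝ
  length_pos : ∀ v w, graph.Adj v w → 0 < length s(v, w)
  pos : V → ℝ ⊗[ℤ] N
  slope : V → V → N
  pos_eq : ∀ v w, graph.Adj v w → pos w = pos v + length s(v, w) • ((1 : ℝ) ⊗ₜ[ℤ] slope v w)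
  /-- the balancing condition -/
  balanced : ∀ v, ∑ f : toRatTree.Star v,
    Sum.elim (fun w => slope v w.1) (fun e => Δ e.1) f = 0

namespace TropicalCurve

variable {E N : Type*} [Fintype E] [AddCommGroup N] {Δ : E → N}

/-- The outgoing slope at `v` of an edge adjacent to `v`. -/
def out (C : TropicalCurve Δ) (v : C.V) (f : C.Star v) : N :=
  Sum.elim (fun w => C.slope v w.1) (fun e => Δ e.1) f

/-- Isomorphism of parametrized tropical curves: an isometry of the metric graphs, respecting the
labels of the unbounded ends, such that `h = h' ∘ φ`. -/
def IsIso (C C' : TropicalCurve Δ) (φ : C.V ≃ C'.V) : Prop :=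
  RatTree.IsIso C.toRatTree C'.toRatTree φ ∧
  (∀ v w, C.graph.Adj v w → C'.length s(φ v, φ w) = C.length s(v, w)) ∧
  (∀ v, C'.pos (φ v) = C.pos v) ∧
  (∀ v w, C.graph.Adj v w → C'.slope (φ v) (φ w) = C.slope v w)

theorem IsIso.refl (C : TropicalCurve Δ) : IsIso C C (Equiv.refl _) :=
  ⟨RatTree.IsIso.refl _, fun _ _ _ => rfl, fun _ => rfl, fun _ _ _ => rfl⟩

theorem IsIso.symm {C C' : TropicalCurve Δ} {φ : C.V ≃ C'.V} (h : IsIso C C' φ) :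
    IsIso C' C φ.symm := by
  refine ⟨h.1.symm, fun v w hvw => ?_, fun v => ?_, fun v w hvw => ?_⟩
  · simpa using (h.2.1 _ _ ((h.1.symm.1 v w).2 hvw)).symm
  · simpa using (h.2.2.1 (φ.symm v)).symm
  · simpa using (h.2.2.2 _ _ ((h.1.symm.1 v w).2 hvw)).symm

theorem IsIso.trans {C C' C'' : TropicalCurve Δ} {φ : C.V ≃ C'.V} {ψ : C'.V ≃ C''.V}
    (h : IsIso C C' φ) (h' : IsIso C' C'' ψ) : IsIso C C'' (φ.trans ψ) := by
  refine ⟨h.1.trans h'.1, fun v w hvw => ?_, fun v => ?_, fun v w hvw => ?_⟩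
  · simpa using (h'.2.1 _ _ ((h.1.1 v w).2 hvw)).trans (h.2.1 v w hvw)
  · simpa using (h'.2.2.1 (φ v)).trans (h.2.2.1 v)
  · simpa using (h'.2.2.2 _ _ ((h.1.1 v w).2 hvw)).trans (h.2.2.2 v w hvw)

instance isoSetoid (Δ : E → N) : Setoid (TropicalCurve Δ) where
  r C C' := ∃ φ, IsIso C C' φ
  iseqv := ⟨fun C => ⟨_, IsIso.refl C⟩, fun ⟨_, h⟩ => ⟨_, h.symm⟩,
    fun ⟨_, h⟩ ⟨_, h'⟩ => ⟨_, h.trans h'⟩⟩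

theorem IsIso.out_eq {C C' : TropicalCurve Δ} {φ : C.V ≃ C'.V} (h : IsIso C C' φ) (v : C.V)
    (f : C.Star v) : C'.out (φ v) (h.1.starEquiv v f) = C.out v f := by
  rcases f with ⟨w, hw⟩ | ⟨e, he⟩
  · exact h.2.2.2 v w hw
  · rfl

end TropicalCurve

section Moduli

variable {E N : Type*} [Fintype E] [AddCommGroup N]

instance combSetoid (E : Type*) [Fintype E] : Setoid (RatTree E) where
  r T T' := ∃ φ, RatTree.IsIso T T' φ
  iseqv := ⟨fun T => ⟨_, RatTree.IsIso.refl T⟩, fun ⟨_, h⟩ => ⟨_, h.symm⟩,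
    fun ⟨_, h⟩ ⟨_, h'⟩ => ⟨_, h.trans h'⟩⟩

/-- Combinatorial types of rational tropical curves with unbounded ends labelled by `E`. -/
def CombType (E : Type*) [Fintype E] : Type _ := Quotient (combSetoid E)

/-- The moduli space `𝓜₀(Δ, N_ℝ)` of parametrized rational tropical curves of degree `Δ`. -/
def ModuliSpace (Δ : E → N) : Type _ := Quotient (TropicalCurve.isoSetoid Δ)

/-- The real extension `N_ℝ → ℝ` of an integral linear form `N → ℤ`. -/
def realExt (φ : N →ₗ[ℤ] ℤ) : ℝ ⊗[ℤ] N →ₗ[ℝ] ℝ :=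
  (TensorProduct.AlgebraTensorModule.rid ℤ ℝ ℝ).toLinearMap ∘ₗ φ.baseChange ℝ

/-- The space `N_ℝ / ⟨n⟩`. -/
abbrev NRmod (n : N) : Type _ := (ℝ ⊗[ℤ] N) ⧸ (Submodule.span ℝ {(1 : ℝ) ⊗ₜ[ℤ] n})

/-- The image in `N_ℝ / ⟨n⟩` of a lattice vector. -/
def slopeIn (n δ : N) : NRmod n := Submodule.Quotient.mk ((1 : ℝ) ⊗ₜ[ℤ] δ)

/-- The line of slope `δ` through `p` in `N_ℝ / ⟨n⟩`. -/
def lineThrough {n : N} (δ : N) (p : NRmod n) : AffineSubspace ℝ (NRmod n) :=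
  AffineSubspace.mk' p (Submodule.span ℝ {slopeIn n δ})

/-- The space `𝔐` of families of moments of total sum zero. -/
def momentSpace (E : Type*) [Fintype E] : Submodule ℝ (E → ℝ) where
  carrier := {μ | ∑ e, μ e = 0}
  add_mem' {a b} ha hb := by
    simp only [Set.mem_ofPred_eq] at ha hb
    simp [Finset.sum_add_distrib, ha, hb]
  zero_mem' := by simp
  smul_mem' c a ha := by
    simp only [Set.mem_ofPred_eq] at ha
    simp [← Finset.mul_sum, ha]

namespace ModuliSpace

variable {Δ : E → N}

/-- The combinatorial type of a curve. -/
def comb : ModuliSpace Δ → CombType E :=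
  Quotient.lift (fun C => (Quotient.mk (combSetoid E) C.toRatTree))
    fun _ _ ⟨φ, h⟩ => Quotient.sound ⟨φ, h.1⟩

/-- The (relatively open) cone of the moduli space given by a combinatorial type. -/
def cone (Δ : E → N) (c : CombType E) : Set (ModuliSpace Δ) := {Γ | Γ.comb = c}

/-- Every vertex is adjacent to precisely three edges; equivalently, the combinatorial type is
top-dimensional. -/
def IsTrivalent : ModuliSpace Δ → Prop :=
  Quotient.lift (fun C => ∀ v : C.V, C.valence v = 3) fun C C' ⟨φ, h⟩ => by
    refine propext ⟨fun H v => ?_, fun H v => ?_⟩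
    · have := h.1.valence_eq (φ.symm v)
      rw [Equiv.apply_symm_apply] at this
      rw [this, H]
    · rw [← h.1.valence_eq v, H]

/-- The moments `μ_ω(e) = ω(n_e, p)`, where `p` is a point of `h(e)`: here the image of the vertex
at which `e` is attached, the moment being the same for all points of `h(e)`. -/
def mom (ω : N →ₗ[ℤ] N →ₗ[ℤ] ℤ) : ModuliSpace Δ → E → ℝ :=
  Quotient.lift (fun C e => realExt (ω (Δ e)) (C.pos (C.root e))) fun C C' ⟨φ, h⟩ => by
    funext e
    simp only [h.1.2 e, h.2.2.1]

/-- The evaluation map at the unbounded end `e`: the image of `h(e)` in `N_ℝ / ⟨n_e⟩`. -/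
def ev (e : E) : ModuliSpace Δ → NRmod (Δ e) :=
  Quotient.lift (fun C => Submodule.Quotient.mk (C.pos (C.root e))) fun C C' ⟨φ, h⟩ => by
    simp only [h.1.2 e, h.2.2.1]

/-- The composed evaluation map of the `ω`-problem: the image of the unbounded end `e₀` in the
quotient of `N_ℝ / ⟨n_{e₀}⟩` by `⟨δ⟩`, and the moments of the other unbounded ends. -/
def composedEv (ω : N →ₗ[ℤ] N →ₗ[ℤ] ℤ) (e₀ : E) (δ : N) (Γ : ModuliSpace Δ) :
    (NRmod (Δ e₀) ⧸ Submodule.span ℝ {slopeIn (Δ e₀) δ}) × ({e : E // e ≠ e₀} → ℝ) :=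
  (Submodule.Quotient.mk (Γ.ev e₀), fun e => Γ.mom ω e.1)

end ModuliSpace

/-- The solutions of the `ω`-problem for the moments `μ` and the line `D`. -/
def omegaSolutions (Δ : E → N) (ω : N →ₗ[ℤ] N →ₗ[ℤ] ℤ) (e₀ : E) (μ : momentSpace E)
    (D : AffineSubspace ℝ (NRmod (Δ e₀))) : Set (ModuliSpace Δ) :=
  {Γ | Γ.mom ω = (μ : E → ℝ) ∧ Γ.ev e₀ ∈ D}

/-- Genericity of the constraints `(μ, D)`, with `D` the line of slope `δ` through `p`: they are
outside the images of the cones which are not top-dimensional, and of the cones on which the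
composed evaluation map is not injective. -/
def IsGenericConstraint (Δ : E → N) (ω : N →ₗ[ℤ] N →ₗ[ℤ] ℤ) (e₀ : E) (δ : N)
    (μ : momentSpace E) (p : NRmod (Δ e₀)) : Prop :=
  ∀ Γ ∈ omegaSolutions Δ ω e₀ μ (lineThrough δ p),
    Γ.IsTrivalent ∧ Set.InjOn (ModuliSpace.composedEv ω e₀ δ) (ModuliSpace.cone Δ Γ.comb)

end Moduli

section Multiplicity

variable {E N : Type*} [Fintype E] [AddCommGroup N]

/-- The bivector `a ∧ b ∈ Λ² N`. -/
def bivector (a b : N) : ⋀[ℤ]^2 N := exteriorPower.ιMulti ℤ 2 ![a, b]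

/-- The subgroup `K_ω` of `Λ² N` spanned by the bivectors `π_V` with `ω(π_V) = 0` of the trivalent
vertices `V` occurring in rational tropical curves of degree `Δ`. -/
def Kω (Δ : E → N) (ω : N →ₗ[ℤ] N →ₗ[ℤ] ℤ) : Submodule ℤ (⋀[ℤ]^2 N) :=
  Submodule.span ℤ {x | ∃ (C : TropicalCurve Δ) (v : C.V) (f g : C.Star v),
    C.valence v = 3 ∧ f ≠ g ∧ ω (C.out v f) (C.out v g) = 0 ∧
      x = bivector (C.out v f) (C.out v g)}

/-- The ring `ℤ[Λ² N / K_ω]`. -/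
abbrev RefinedRing (Δ : E → N) (ω : N →ₗ[ℤ] N →ₗ[ℤ] ℤ) : Type _ :=
  AddMonoidAlgebra ℤ ((⋀[ℤ]^2 N) ⧸ Kω Δ ω)

variable {Δ : E → N}

/-- The monomial `q ^ x` of `ℤ[Λ² N / K_ω]`. -/
def qpow (Δ : E → N) (ω : N →ₗ[ℤ] N →ₗ[ℤ] ℤ) (x : ⋀[ℤ]^2 N) : RefinedRing Δ ω :=
  AddMonoidAlgebra.single (Submodule.Quotient.mk x) 1

/-- The pair `(a, b)` consists of the outgoing slopes on two of the edges adjacent to `v`, ordered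
so that `ω(a, b) ≥ 0`. -/
def TropicalCurve.IsOrientedPair (ω : N →ₗ[ℤ] N →ₗ[ℤ] ℤ) (C : TropicalCurve Δ) (v : C.V)
    (ab : N × N) : Prop :=
  ∃ f g : C.Star v, f ≠ g ∧ ab = (C.out v f, C.out v g) ∧ 0 ≤ ω ab.1 ab.2

/-- The bivector `π_V` of a trivalent vertex, with the sign such that `ω(π_V) > 0` if
`ω(π_V) ≠ 0`. By balancing, the choice of the oriented pair then does not matter. If `ω(π_V) = 0`,
the sign is arbitrary. -/
def TropicalCurve.vertexBivector (ω : N →ₗ[ℤ] N →ₗ[ℤ] ℤ) (C : TropicalCurve Δ) (v : C.V) :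
    ⋀[ℤ]^2 N :=
  let ab := Classical.epsilon (C.IsOrientedPair ω v)
  bivector ab.1 ab.2

theorem TropicalCurve.IsIso.vertexBivector_eq (ω : N →ₗ[ℤ] N →ₗ[ℤ] ℤ) {C C' : TropicalCurve Δ}
    {φ : C.V ≃ C'.V} (h : TropicalCurve.IsIso C C' φ) (v : C.V) :
    C'.vertexBivector ω (φ v) = C.vertexBivector ω v := by
  have : C'.IsOrientedPair ω (φ v) = C.IsOrientedPair ω v := by
    funext ab
    refine propext ⟨?_, ?_⟩
    · rintro ⟨f, g, hfg, hab, h0⟩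
      obtain ⟨f, rfl⟩ := (h.1.starEquiv v).surjective f
      obtain ⟨g, rfl⟩ := (h.1.starEquiv v).surjective g
      rw [h.out_eq, h.out_eq] at hab
      exact ⟨f, g, fun H => hfg (by rw [H]), hab, h0⟩
    · rintro ⟨f, g, hfg, hab, h0⟩
      refine ⟨h.1.starEquiv v f, h.1.starEquiv v g, fun H => hfg ((h.1.starEquiv v).injective H),
        ?_, h0⟩
      rw [h.out_eq, h.out_eq]
      exact hab
  simp only [TropicalCurve.vertexBivector, this]

/-- The refined multiplicity `B_Γ^{K_ω} = ∏_V (q^{π_V} - q^{-π_V})` of a trivalent curve. If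
`ω(π_V) = 0` for some `V`, then `π_V ∈ K_ω` and the product is zero. -/
def ModuliSpace.refinedMult (ω : N →ₗ[ℤ] N →ₗ[ℤ] ℤ) : ModuliSpace Δ → RefinedRing Δ ω :=
  Quotient.lift
    (fun C => ∏ v : C.V, (qpow Δ ω (C.vertexBivector ω v) - qpow Δ ω (-C.vertexBivector ω v)))
    fun C C' ⟨φ, h⟩ => Fintype.prod_equiv φ _ _ fun v => by rw [h.vertexBivector_eq]

/-- The refined count of the solutions of the `ω`-problem for the moments `μ` and the line `D`. -/
def refinedCount (Δ : E → N) (ω : N →ₗ[ℤ] N →ₗ[ℤ] ℤ) (e₀ : E) (μ : momentSpace E)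
    (D : AffineSubspace ℝ (NRmod (Δ e₀))) : RefinedRing Δ ω :=
  ∑ᶠ Γ ∈ omegaSolutions Δ ω e₀ μ D, Γ.refinedMult ω

end Multiplicity

end

/-!
Label the ends other than `e₀` by a finite type `I`, and root every curve at the end `e₀`. A
vertex is then determined by the set of the ends beyond it, and a curve by the laminar family `H`
of these clusters (a *hierarchy* on `I`), by the lengths of its edges and by the position of the
root vertex (`exists_isIso_curveOf`, `coe_eq_of_isIso`). By balancing, the edge above the cluster
`B` has slope `n_B = ∑ i ∈ B, n_i`. The moment of `e₀` and the line `D` fix the position of the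
root vertex up to a translation along the end `e₀`. If the size of this translation is treated as
the length of the cluster `univ`, the remaining condition on the lengths is the linear system `ν_i
= ∑ B ∈ H with i ∈ B, l_B * ω (n_i, n_B)` (`Solves`, `mom_curveAt_eq_iff`), with `l_B > 0` for `B
≠ univ`.

A hierarchy has at most `|I| - 1` clusters, and this number is attained exactly by the trivalent
trees. So the system is either solvable only for `ν` in a proper subspace of the space of moments,
or the tree is trivalent and the solution is unique (`binary_of_forall_solves`). This gives the
genericity of the constraints outside finitely many proper subspaces. There are finitely many
hierarchies, and a generic constraint has at most one solution for each of them.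

For the invariance, put `t i j = q ^ (n_i ∧ n_j)`. The multiplicity of a trivalent curve is the
product over its clusters `A = B ⊔ C` of `bracket t B C = q ^ (n_B ∧ n_C) - q ^ (n_C ∧ n_B)`,
ordered such that `ω (n_B, n_C) > 0`. The passage to the quotient by `Kω` makes the bracket vanish
if `ω (n_B, n_C) = 0`, because any two disjoint clusters meet at a trivalent vertex of some curve.
In the algebra with basis `x_A`, for the subsets `A` of `I`, and with `x_B * x_C = t (B, C) x_{B ∪
C}` for disjoint `B` and `C`, take `1 + ∑ c_A x_A` and its Harder–Narasimhan factorization with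
respect to the stability `A ↦ ν(A)`. The coefficients `hn` of the semistable factors are explicit
alternating sums (`hnSum`), and jump by `bracket t B C * hn B * hn C` when `ν` crosses the wall
where `ν(B)` vanishes, with `A = B ⊔ C` (`hnSum_wallCrossing`). The coefficients `c_A` can be
chosen such that `hn` is `1` on singletons and vanishes on each larger `A` at the attractor
stability, which is near `-ω (·, n_A)`. Moving `ν` along the edge above `A`, that is, in the
direction `-ω (·, n_A)`, until it reaches the attractor chamber then expresses `hn` recursively as
a sum over trees: for `ν` outside finitely many subspaces, `hn` is the number of binary trees
which realize `ν` with all lengths positive, counted with multiplicity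
(`exists_hn_eq_sum_treeWeight`). In the present problem the length of `univ` is unrestricted. So
`ν` may be moved in the opposite direction `ω (·, n_I)` without changing the count, until it
reaches the chamber opposite to the attractor. Hence the count is the value of `hn` in this
chamber, whatever `ν` is (`exists_sum_treeWeight_eq`). The constraints that are generic in the
sense of the theorem but lie in one of the finitely many excluded subspaces are covered by a
perturbation: a degenerate tree that could change the count would give a solution which is not
trivalent.
-/

noncomputable section

open Finset

set_option linter.unusedSectionVars false

namespace FlowTree

/-! ### Harder–Narasimhan sums and wall-crossing -/

section

variable {I R : Type*} [DecidableEq I] [CommRing R]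

/-- The nonempty proper subsets of a finite set. -/
def proper (A : Finset I) : Finset (Finset I) := A.ssubsets.filter Finset.Nonempty

theorem mem_proper {A B : Finset I} : B ∈ proper A ↔ B ⊂ A ∧ B.Nonempty := by
  simp [proper]

theorem sdiff_mem_proper {A B : Finset I} (h : B ∈ proper A) : A \ B ∈ proper A := by
  rw [mem_proper] at h ⊢
  refine ⟨Finset.sdiff_ssubset h.1.1 h.2, Finset.sdiff_nonempty.2 h.1.2⟩

theorem proper_trans {A B D : Finset I} (h : B ∈ proper A) (h' : D ∈ proper B) :
    D ∈ proper A := by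
  rw [mem_proper] at *
  exact ⟨h'.1.trans h.1, h'.2⟩

theorem card_lt_of_mem_proper {A B : Finset I} (h : B ∈ proper A) : #B < #A :=
  Finset.card_lt_card (mem_proper.1 h).1

theorem sdiff_sdiff_of_mem_proper {A B : Finset I} (h : B ∈ proper A) : A \ (A \ B) = B :=
  Finset.sdiff_sdiff_eq_self (mem_proper.1 h).1.1

theorem union_sdiff_of_mem_proper {A B : Finset I} (h : B ∈ proper A) : B ∪ (A \ B) = A :=
  Finset.union_sdiff_of_subset (mem_proper.1 h).1.1

/-- The multiplicative extension of `t` to pairs of finite sets. -/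
def setPair (t : I → I → R) (A B : Finset I) : R := ∏ i ∈ A, ∏ j ∈ B, t i j

theorem setPair_union_left (t : I → I → R) {A A' : Finset I} (h : Disjoint A A')
    (B : Finset I) : setPair t (A ∪ A') B = setPair t A B * setPair t A' B :=
  Finset.prod_union h

theorem setPair_union_right (t : I → I → R) (A : Finset I) {B B' : Finset I}
    (h : Disjoint B B') : setPair t A (B ∪ B') = setPair t A B * setPair t A B' := by
  simp only [setPair, Finset.prod_union h, Finset.prod_mul_distrib]

/-- The structure constants of the commutator of the twisted algebra in which the product of the
basis elements `x_A` and `x_B`, for disjoint `A` and `B`, is `setPair t A B • x_{A ∪ B}`. -/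
def bracket (t : I → I → R) (A B : Finset I) : R := setPair t A B - setPair t B A

open Classical in
/-- The alternating sum, over the ordered set partitions `(A₁, …, A_k)` of `A` whose proper initial
unions `A₁ ∪ … ∪ A_i` all satisfy `P`, of the twisted products of the coefficients `c A_i`, written
as a recursion on the last part. It is the `x_A`-coefficient of the middle factor in the
Harder–Narasimhan factorization of `1 + ∑ c A • x_A` with respect to the stability given by `P`. -/
def hnSum (t : I → I → R) (c : Finset I → R) (P : Finset I → Prop) (A : Finset I) : R :=
  c A - ∑ D ∈ (proper A).attach,
    if P D.1 then hnSum t c P D.1 * setPair t D.1 (A \ D.1) * c (A \ D.1) else 0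
termination_by #A
decreasing_by exact card_lt_of_mem_proper D.2

open Classical in
theorem hnSum_eq (t : I → I → R) (c : Finset I → R) (P : Finset I → Prop) (A : Finset I) :
    hnSum t c P A = c A - ∑ D ∈ proper A,
      if P D then hnSum t c P D * setPair t D (A \ D) * c (A \ D) else 0 := by
  rw [hnSum, Finset.sum_attach (proper A)
    (fun D => if P D then hnSum t c P D * setPair t D (A \ D) * c (A \ D) else 0)]

theorem hnSum_congr (t : I → I → R) {c c' : Finset I → R} {P P' : Finset I → Prop}
    {A : Finset I} (hA : A.Nonempty) (hP : ∀ D ∈ proper A, (P D ↔ P' D))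
    (hc : ∀ D, D ⊆ A → D.Nonempty → c D = c' D) : hnSum t c P A = hnSum t c' P' A := by
  classical
  induction A using Finset.strongInduction with
  | H A ih =>
    rw [hnSum_eq, hnSum_eq, hc A subset_rfl hA]
    congr 1
    refine Finset.sum_congr rfl fun D hD => ?_
    have hD' := mem_proper.1 hD
    rw [ih D hD'.1 hD'.2 (fun X hX => hP X (proper_trans hD hX))
      (fun X hX => hc X (hX.trans hD'.1.1)), hc (A \ D) Finset.sdiff_subset
      (mem_proper.1 (sdiff_mem_proper hD)).2]
    exact if_congr (hP D hD) rfl rfl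

theorem hnSum_congr_pred (t : I → I → R) (c : Finset I → R) {P P' : Finset I → Prop}
    {A : Finset I} (hA : A.Nonempty) (hP : ∀ D ∈ proper A, (P D ↔ P' D)) :
    hnSum t c P A = hnSum t c P' A :=
  hnSum_congr t hA hP fun _ _ _ => rfl

theorem ssubsets_eq_insert {Y : Finset I} (hY : Y.Nonempty) :
    Y.ssubsets = insert ∅ (proper Y) := by
  ext D
  rw [Finset.mem_ssubsets, Finset.mem_insert, mem_proper]
  constructor
  · intro h
    rcases D.eq_empty_or_nonempty with h' | h'
    · exact Or.inl h'
    · exact Or.inr ⟨h, h'⟩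
  · rintro (rfl | h)
    · exact Finset.empty_ssubset.2 hY
    · exact h.1

/-- The effect on `hnSum` of adding a single set `B` to the predicate: the ordered partitions that
are gained are those with an initial union `B`, and they factor. -/
theorem hnSum_sub_of_insert (t : I → I → R) (c : Finset I → R) {P P' : Finset I → Prop}
    {B C : Finset I} (hB : B.Nonempty) (hBC : Disjoint B C) (hPB : ¬ P B) (hPB' : P' B)
    (hP : ∀ D ∈ proper (B ∪ C), D ≠ B → (P' D ↔ P D))
    (hsh : ∀ D ∈ proper C, (P (B ∪ D) ↔ P D)) {Y : Finset I} (hYC : Y ⊆ C) (hY : Y.Nonempty) :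
    hnSum t c P' (B ∪ Y) - hnSum t c P (B ∪ Y) =
      -(setPair t B Y * hnSum t c P B * hnSum t c P Y) := by
  classical
  induction Y using Finset.strongInduction with
  | H Y ih =>
    have hBY : Disjoint B Y := hBC.mono_right hYC
    have hprop : ∀ D ∈ proper (B ∪ Y), D ∈ proper (B ∪ C) := by
      intro D hD
      rw [mem_proper] at hD ⊢
      exact ⟨hD.1.trans_subset (Finset.union_subset_union_right hYC), hD.2⟩
    set g : Finset I → R := fun D =>
      (if P' D then hnSum t c P' D * setPair t D ((B ∪ Y) \ D) * c ((B ∪ Y) \ D) else 0) -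
      (if P D then hnSum t c P D * setPair t D ((B ∪ Y) \ D) * c ((B ∪ Y) \ D) else 0) with hg
    have h1 : hnSum t c P' (B ∪ Y) - hnSum t c P (B ∪ Y) = -∑ D ∈ proper (B ∪ Y), g D := by
      rw [hnSum_eq t c P', hnSum_eq t c P, hg, Finset.sum_sub_distrib]
      ring
    have hSB : hnSum t c P' B = hnSum t c P B := by
      refine hnSum_congr_pred t c hB fun D hD => hP D ?_ ?_
      · rw [mem_proper] at hD ⊢
        exact ⟨hD.1.trans_subset Finset.subset_union_left, hD.2⟩
      · exact (mem_proper.1 hD).1.ne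
    have hinj : Set.InjOn (fun D => B ∪ D) (Y.ssubsets : Set (Finset I)) := by
      intro D hD D' hD' h
      have hD := (Finset.mem_ssubsets.1 hD).1
      have hD' := (Finset.mem_ssubsets.1 hD').1
      have := congrArg (· \ B) h
      simpa [Finset.union_sdiff_cancel_left (hBY.mono_right hD),
        Finset.union_sdiff_cancel_left (hBY.mono_right hD')] using this
    have h2 : ∑ D ∈ proper (B ∪ Y), g D = ∑ D ∈ Y.ssubsets, g (B ∪ D) := by
      rw [← Finset.sum_image (f := g) hinj]
      symm
      refine Finset.sum_subset ?_ ?_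
      · intro X hX
        obtain ⟨D, hD, rfl⟩ := Finset.mem_image.1 hX
        rw [Finset.mem_ssubsets] at hD
        rw [mem_proper]
        refine ⟨⟨Finset.union_subset_union_right hD.1, fun h => hD.2 ?_⟩, hB.inl⟩
        intro y hy
        rcases Finset.mem_union.1 (h (Finset.mem_union_right B hy)) with h' | h'
        · exact absurd hy (Finset.disjoint_left.1 hBY h')
        · exact h'
      · intro D hD hD'
        have hBD : ¬ B ⊆ D := by
          intro hBD
          apply hD'
          rw [mem_proper] at hD
          refine Finset.mem_image.2 ⟨D \ B, ?_, Finset.union_sdiff_of_subset hBD⟩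
          rw [Finset.mem_ssubsets]
          refine ⟨?_, fun h => hD.1.2 ?_⟩
          · exact sdiff_le_iff.2 hD.1.1
          · exact Finset.union_subset hBD (h.trans Finset.sdiff_subset)
        have hDne : D ≠ B := fun h => hBD h.ge
        have e1 : hnSum t c P' D = hnSum t c P D := by
          refine hnSum_congr_pred t c (mem_proper.1 hD).2 fun X hX => hP X ?_ ?_
          · exact hprop X (proper_trans hD hX)
          · rintro rfl
            exact hBD (mem_proper.1 hX).1.1
        simp only [hg, e1, hP D (hprop D hD) hDne, sub_self]
    have h3 : g (B ∪ ∅) = hnSum t c P B * setPair t B Y * c Y := by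
      simp only [hg, Finset.union_empty, if_pos hPB', if_neg hPB, sub_zero, hSB,
        Finset.union_sdiff_cancel_left hBY]
    have h4 : ∀ D ∈ proper Y, g (B ∪ D) = -(setPair t B Y * hnSum t c P B) *
        (if P D then hnSum t c P D * setPair t D (Y \ D) * c (Y \ D) else 0) := by
      intro D hD
      have hD' := mem_proper.1 hD
      have hDC : D ∈ proper C := mem_proper.2 ⟨hD'.1.trans_subset hYC, hD'.2⟩
      have hdis : Disjoint B D := hBY.mono_right hD'.1.1
      have hBD : B ∪ D ∈ proper (B ∪ C) := by
        rw [mem_proper]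
        refine ⟨⟨Finset.union_subset_union_right (hD'.1.1.trans hYC), fun h => ?_⟩, hB.inl⟩
        refine (mem_proper.1 hDC).1.2 fun y hy => ?_
        rcases Finset.mem_union.1 (h (Finset.mem_union_right B hy)) with h' | h'
        · exact absurd hy (Finset.disjoint_left.1 hBC h')
        · exact h'
      have hne : B ∪ D ≠ B := by
        intro h
        obtain ⟨y, hy⟩ := hD'.2
        exact Finset.disjoint_left.1 hdis (h ▸ Finset.mem_union_right B hy) hy
      have hiff := hP _ hBD hne
      have hsd : (B ∪ Y) \ (B ∪ D) = Y \ D := by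
        ext y
        simp only [Finset.mem_sdiff, Finset.mem_union]
        constructor
        · rintro ⟨h | h, h'⟩
          · exact absurd (Or.inl h) h'
          · exact ⟨h, fun hh => h' (Or.inr hh)⟩
        · rintro ⟨h, h'⟩
          exact ⟨Or.inr h, fun hh => hh.elim
            (fun hB => Finset.disjoint_left.1 hBY hB h) h'⟩
      have hJ := ih D hD'.1 (hD'.1.1.trans hYC) hD'.2
      have hQ1 : setPair t (B ∪ D) (Y \ D) = setPair t B (Y \ D) * setPair t D (Y \ D) :=
        setPair_union_left t hdis _
      have hQ2 : setPair t B Y = setPair t B D * setPair t B (Y \ D) := by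
        rw [← setPair_union_right t B Finset.disjoint_sdiff, Finset.union_sdiff_of_subset hD'.1.1]
      by_cases hPD : P D
      · have h1 : P (B ∪ D) := (hsh D hDC).2 hPD
        have h2 : P' (B ∪ D) := hiff.2 h1
        simp only [hg, if_pos h1, if_pos h2, if_pos hPD, hsd]
        rw [hQ1, hQ2]
        linear_combination (setPair t B (Y \ D) * setPair t D (Y \ D) * c (Y \ D)) * hJ
      · have h1 : ¬ P (B ∪ D) := fun h => hPD ((hsh D hDC).1 h)
        have h2 : ¬ P' (B ∪ D) := fun h => h1 (hiff.1 h)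
        simp only [hg, if_neg h1, if_neg h2, if_neg hPD, sub_zero, mul_zero]
    rw [h1, h2, ssubsets_eq_insert hY, Finset.sum_insert (by simp [mem_proper]), h3,
      Finset.sum_congr rfl h4, ← Finset.mul_sum, hnSum_eq t c P Y]
    ring

/-- The wall-crossing formula: `B` enters the predicate and its complement leaves it. The predicate
`P₀` stands for the stability on the wall. -/
theorem hnSum_wallCrossing (t : I → I → R) (c : Finset I → R) {P P' P₀ : Finset I → Prop}
    {A B : Finset I} (hBA : B ∈ proper A) (hB : ¬ P B) (hC : P (A \ B)) (hB' : P' B)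
    (hC' : ¬ P' (A \ B))
    (hP : ∀ D ∈ proper A, D ≠ B → D ≠ A \ B → ((P D ↔ P₀ D) ∧ (P' D ↔ P₀ D)))
    (hsB : ∀ D ∈ proper (A \ B), (P₀ (B ∪ D) ↔ P₀ D))
    (hsC : ∀ D ∈ proper B, (P₀ ((A \ B) ∪ D) ↔ P₀ D)) :
    hnSum t c P A - hnSum t c P' A =
      bracket t B (A \ B) * hnSum t c P₀ B * hnSum t c P₀ (A \ B) := by
  classical
  set C := A \ B with hCdef
  have hCA : C ∈ proper A := sdiff_mem_proper hBA
  have hBn := (mem_proper.1 hBA).2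
  have hCn := (mem_proper.1 hCA).2
  have hdis : Disjoint B C := Finset.disjoint_sdiff
  have hU : B ∪ C = A := union_sdiff_of_mem_proper hBA
  have hne : B ≠ C := by
    intro h
    rw [← h, disjoint_self] at hdis
    exact hBn.ne_empty hdis
  -- between `P` and `P'`, both `B` and `C` satisfy the predicate
  set Pm : Finset I → Prop := fun D => D = B ∨ P D with hPm
  have hPm' : ∀ D ∈ proper A, D ≠ C → (Pm D ↔ P' D) := by
    intro D hD hDC
    by_cases hDB : D = B
    · subst hDB; exact ⟨fun _ => hB', fun _ => Or.inl rfl⟩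
    · have := hP D hD hDB hDC
      simp only [hPm, hDB, false_or]
      exact this.1.trans this.2.symm
  have hproperU : ∀ {X D : Finset I}, X ∈ proper A → D ∈ proper (A \ X) → X ∪ D ∈ proper A ∧
      X ∪ D ≠ X ∧ X ∪ D ≠ A \ X ∧ D ∈ proper A ∧ D ≠ X ∧ D ≠ A \ X := by
    intro X D hX hD
    have hXn := (mem_proper.1 hX).2
    have hd : Disjoint X D := Finset.disjoint_sdiff.mono_right (mem_proper.1 hD).1.1
    obtain ⟨x, hx⟩ := hXn
    obtain ⟨y, hy⟩ := (mem_proper.1 hD).2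
    refine ⟨?_, ?_, ?_, proper_trans (sdiff_mem_proper hX) hD, ?_, (mem_proper.1 hD).1.ne⟩
    · rw [mem_proper]
      refine ⟨⟨Finset.union_subset (mem_proper.1 hX).1.1
        ((mem_proper.1 hD).1.1.trans Finset.sdiff_subset), fun h => ?_⟩, ⟨x, by simp [hx]⟩⟩
      refine (mem_proper.1 hD).1.2 fun z hz => ?_
      rw [Finset.mem_sdiff] at hz
      exact (Finset.mem_union.1 (h hz.1)).resolve_left hz.2
    · intro h
      exact Finset.disjoint_left.1 hd (h ▸ Finset.mem_union_right X hy) hy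
    · intro h
      have : x ∈ A \ X := h ▸ Finset.mem_union_left D hx
      exact (Finset.mem_sdiff.1 this).2 hx
    · rintro rfl
      exact Finset.disjoint_left.1 hd hy hy
  have hCC : A \ C = B := sdiff_sdiff_of_mem_proper hBA
  have key1 := hnSum_sub_of_insert t c (P := P) (P' := Pm) (B := B) (C := C) hBn hdis hB
    (Or.inl rfl) (fun D _ hD => by simp [hPm, hD])
    (fun D hD => by
      obtain ⟨h1, h2, h3, h4, h5, h6⟩ := hproperU hBA hD
      rw [(hP _ h1 h2 h3).1, (hP _ h4 h5 h6).1]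
      exact hsB D hD) subset_rfl hCn
  have key2 := hnSum_sub_of_insert t c (P := P') (P' := Pm) (B := C) (C := B) hCn hdis.symm hC'
    (Or.inr hC) (fun D hD hDC => hPm' D (by rwa [Finset.union_comm, hU] at hD) hDC)
    (fun D hD => by
      obtain ⟨h1, h2, h3, h4, h5, h6⟩ := hproperU hCA (hCC.symm ▸ hD)
      rw [hCC] at h3 h6
      rw [(hP _ h1 h3 h2).2, (hP _ h4 h6 h5).2]
      exact hsC D hD) subset_rfl hBn
  rw [hU] at key1
  rw [Finset.union_comm, hU] at key2
  have hS : ∀ X ∈ proper A, (X = B ∨ X = C) → hnSum t c P X = hnSum t c P₀ X ∧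
      hnSum t c P' X = hnSum t c P₀ X := by
    intro X hX hXX
    have : ∀ D ∈ proper X, D ≠ B ∧ D ≠ C := by
      intro D hD
      have hD' := mem_proper.1 hD
      obtain ⟨y, hy⟩ := hD'.2
      have hyX := hD'.1.1 hy
      rcases hXX with rfl | rfl
      · exact ⟨hD'.1.ne, fun h => Finset.disjoint_left.1 hdis hyX (h ▸ hy)⟩
      · exact ⟨fun h => Finset.disjoint_left.1 hdis (h ▸ hy) hyX, hD'.1.ne⟩
    exact ⟨hnSum_congr_pred t c (mem_proper.1 hX).2 fun D hD =>
        (hP D (proper_trans hX hD) (this D hD).1 (this D hD).2).1,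
      hnSum_congr_pred t c (mem_proper.1 hX).2 fun D hD =>
        (hP D (proper_trans hX hD) (this D hD).1 (this D hD).2).2⟩
  rw [(hS B hBA (Or.inl rfl)).1, (hS C hCA (Or.inr rfl)).1] at key1
  rw [(hS B hBA (Or.inl rfl)).2, (hS C hCA (Or.inr rfl)).2] at key2
  rw [bracket]
  linear_combination key2 - key1

end

/-! ### Variation along a path of stabilities -/

section

variable {I R : Type*} [DecidableEq I] [CommRing R]

/-- The total mass of `θ` on a finite set. -/
def mass (θ : I → ℝ) (A : Finset I) : ℝ := ∑ i ∈ A, θ i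

theorem mass_add_smul (θ η : I → ℝ) (s : ℝ) (A : Finset I) :
    mass (θ + s • η) A = mass θ A + s * mass η A := by
  simp [mass, Finset.sum_add_distrib, Finset.mul_sum]

theorem mass_union (θ : I → ℝ) {A B : Finset I} (h : Disjoint A B) :
    mass θ (A ∪ B) = mass θ A + mass θ B := Finset.sum_union h

theorem mass_sdiff (θ : I → ℝ) {A B : Finset I} (h : B ⊆ A) :
    mass θ (A \ B) = mass θ A - mass θ B := by
  rw [eq_sub_iff_add_eq]
  exact Finset.sum_sdiff h

/-- `hnSum` for the stability given by the sign of `θ`. -/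
def hn (t : I → I → R) (c : Finset I → R) (θ : I → ℝ) (A : Finset I) : R :=
  hnSum t c (fun D => mass θ D < 0) A

theorem hn_congr (t : I → I → R) (c : Finset I → R) {θ θ' : I → ℝ} {A : Finset I}
    (hA : A.Nonempty) (h : ∀ D ∈ proper A, (mass θ D < 0 ↔ mass θ' D < 0)) :
    hn t c θ A = hn t c θ' A :=
  hnSum_congr_pred t c hA h

/-- An affine function keeps its sign until its zero. -/
theorem affine_neg_iff {a b s₀ s₁ : ℝ} (h₀ : a + s₀ * b ≠ 0) (h₁ : a + s₁ * b ≠ 0)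
    (h : ∀ s, s₀ < s → s < s₁ → a + s * b ≠ 0) {s : ℝ} (hs : s₀ ≤ s) (hs' : s ≤ s₁) :
    a + s₀ * b < 0 ↔ a + s * b < 0 := by
  have hne : ∀ s, s₀ ≤ s → s ≤ s₁ → a + s * b ≠ 0 := by
    intro s hs hs'
    rcases hs.eq_or_lt with rfl | hs
    · exact h₀
    rcases hs'.eq_or_lt with rfl | hs'
    · exact h₁
    exact h s hs hs'
  have hcont : Continuous fun s : ℝ => a + s * b := by fun_prop
  have hroot : ∀ u v, s₀ ≤ u → u ≤ v → v ≤ s₁ → 0 ∉ Set.uIcc (a + u * b) (a + v * b) := by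
    intro u v hu huv hv h0
    obtain ⟨r, hr, hr0⟩ := intermediate_value_uIcc hcont.continuousOn h0
    rw [Set.uIcc_of_le huv] at hr
    exact hne r (hu.trans hr.1) (hr.2.trans hv) hr0
  have := hroot s₀ s le_rfl hs hs'
  rw [Set.mem_uIcc] at this
  push Not at this
  have hsne := hne s hs hs'
  constructor
  · intro hlt
    exact this.1 hlt.le
  · intro hlt
    exact lt_of_not_ge fun hge => absurd (this.2 hlt.le) (not_lt.2 hge)

/-- The time at which the path `θ + s • η` crosses the wall of `B`. -/
def hitTime (θ η : I → ℝ) (B : Finset I) : ℝ := -mass θ B / mass η B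

theorem mass_hitTime (θ : I → ℝ) {η : I → ℝ} {B : Finset I} (h : mass η B ≠ 0) :
    mass (θ + hitTime θ η B • η) B = 0 := by
  rw [mass_add_smul, hitTime, div_mul_cancel₀ _ h, add_neg_cancel]

theorem eq_hitTime {θ η : I → ℝ} {B : Finset I} (h : mass η B ≠ 0) {s : ℝ}
    (hs : mass (θ + s • η) B = 0) : s = hitTime θ η B := by
  rw [mass_add_smul] at hs
  rw [hitTime, eq_div_iff h]
  linarith

open Classical in
/-- The sets that become unstable along the path `θ + s • η` between two times. -/
def crossings (θ η : I → ℝ) (A : Finset I) (s₀ s₁ : ℝ) : Finset (Finset I) :=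
  (proper A).filter fun B => mass η B < 0 ∧ s₀ < hitTime θ η B ∧ hitTime θ η B < s₁

theorem mem_crossings {θ η : I → ℝ} {A B : Finset I} {s₀ s₁ : ℝ} : B ∈ crossings θ η A s₀ s₁ ↔
    B ∈ proper A ∧ mass η B < 0 ∧ s₀ < hitTime θ η B ∧ hitTime θ η B < s₁ := by
  classical
  simp [crossings]

theorem mass_path_sdiff {A B : Finset I} {θ η : I → ℝ} (hθ : mass θ A = 0) (hη : mass η A = 0)
    (hB : B ∈ proper A) (s : ℝ) :
    mass (θ + s • η) (A \ B) = -mass (θ + s • η) B := by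
  rw [mass_sdiff _ (mem_proper.1 hB).1.1, mass_add_smul, mass_add_smul, hθ, hη]
  ring

theorem hitTime_mem_crossings {A D : Finset I} {θ η : I → ℝ} (hθ : mass θ A = 0)
    (hη : mass η A = 0) {s₀ s₁ s : ℝ} (h₀ : mass (θ + s₀ • η) D ≠ 0) (hD : D ∈ proper A)
    (hs₀ : s₀ < s) (hs₁ : s < s₁) (hs : mass (θ + s • η) D = 0) :
    ∃ B ∈ crossings θ η A s₀ s₁, hitTime θ η B = s ∧ (D = B ∨ D = A \ B) := by
  have hne : mass η D ≠ 0 := by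
    intro h
    rw [mass_add_smul, h] at hs h₀
    simp_all
  have hsd : mass η (A \ D) = - mass η D := by
    rw [mass_sdiff _ (mem_proper.1 hD).1.1, hη, zero_sub]
  rcases lt_or_gt_of_ne hne with h | h
  · refine ⟨D, ?_, (eq_hitTime hne hs).symm, Or.inl rfl⟩
    rw [mem_crossings, ← eq_hitTime hne hs]
    exact ⟨hD, h, hs₀, hs₁⟩
  · have h' : mass η (A \ D) < 0 := by linarith
    have hs' : mass (θ + s • η) (A \ D) = 0 := by rw [mass_path_sdiff hθ hη hD, hs, neg_zero]
    refine ⟨A \ D, ?_, (eq_hitTime h'.ne hs').symm, Or.inr (sdiff_sdiff_of_mem_proper hD).symm⟩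
    rw [mem_crossings, ← eq_hitTime h'.ne hs']
    exact ⟨sdiff_mem_proper hD, h', hs₀, hs₁⟩

/-- The variation of `hn` along a path that crosses one wall at a time. -/
theorem hn_sub_hn_of_path (t : I → I → R) (c : Finset I → R) {A : Finset I} (hA : A.Nonempty)
    {θ η : I → ℝ} (hθ : mass θ A = 0) (hη : mass η A = 0) {s₀ s₁ : ℝ} (h01 : s₀ < s₁)
    (h₀ : ∀ B ∈ proper A, mass (θ + s₀ • η) B ≠ 0) (h₁ : ∀ B ∈ proper A, mass (θ + s₁ • η) B ≠ 0)
    (hgen : ∀ s, s₀ < s → s < s₁ → ∀ B ∈ proper A, ∀ B' ∈ proper A,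
      mass (θ + s • η) B = 0 → mass (θ + s • η) B' = 0 → B' = B ∨ B' = A \ B) :
    hn t c (θ + s₀ • η) A - hn t c (θ + s₁ • η) A =
      ∑ B ∈ crossings θ η A s₀ s₁, bracket t B (A \ B) *
        hn t c (θ + hitTime θ η B • η) B * hn t c (θ + hitTime θ η B • η) (A \ B) := by
  classical
  induction hk : #(crossings θ η A s₀ s₁) generalizing s₀ with
  | zero =>
    rw [Finset.card_eq_zero] at hk
    rw [hk, Finset.sum_empty, sub_eq_zero]
    refine hn_congr t c hA fun D hD => ?_
    rw [mass_add_smul, mass_add_smul]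
    refine affine_neg_iff ?_ ?_ ?_ h01.le le_rfl
    · rw [← mass_add_smul]; exact h₀ D hD
    · rw [← mass_add_smul]; exact h₁ D hD
    · intro s hs hs' h
      rw [← mass_add_smul] at h
      obtain ⟨B, hB, -⟩ := hitTime_mem_crossings hθ hη (h₀ D hD) hD hs hs' h
      simp [hk] at hB
  | succ k ih =>
    have hKn : (crossings θ η A s₀ s₁).Nonempty := Finset.card_pos.1 (by omega)
    -- the first wall on the path, and a time before the next one
    obtain ⟨B, hBK, hmin⟩ := Finset.exists_min_image _ (hitTime θ η) hKn
    obtain ⟨hBA, hηB, hB0, hB1⟩ := mem_crossings.1 hBK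
    set τ := hitTime θ η B with hτ
    have hτB : mass (θ + τ • η) B = 0 := mass_hitTime θ hηB.ne
    have hother : ∀ B' ∈ (crossings θ η A s₀ s₁).erase B, τ < hitTime θ η B' := by
      intro B' hB'
      obtain ⟨hne, hB'K⟩ := Finset.mem_erase.1 hB'
      refine lt_of_le_of_ne (hmin B' hB'K) fun heq => ?_
      obtain ⟨hB'A, hηB', -, -⟩ := mem_crossings.1 hB'K
      have h0 : mass (θ + τ • η) B' = 0 := by
        rw [heq]; exact mass_hitTime θ hηB'.ne
      rcases hgen τ hB0 hB1 B hBA B' hB'A hτB h0 with h | h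
      · exact hne h
      · rw [h, mass_sdiff _ (mem_proper.1 hBA).1.1, hη] at hηB'
        linarith
    obtain ⟨s', hτs', hs'1, hs'o⟩ : ∃ s', τ < s' ∧ s' < s₁ ∧
        ∀ B' ∈ (crossings θ η A s₀ s₁).erase B, s' < hitTime θ η B' := by
      have h1 : ∀ᶠ s' in nhdsWithin τ (Set.Ioi τ), τ < s' := eventually_mem_nhdsWithin
      have h2 : ∀ᶠ s' in nhdsWithin τ (Set.Ioi τ), s' < s₁ :=
        nhdsWithin_le_nhds (eventually_lt_nhds hB1)
      have h3 : ∀ᶠ s' in nhdsWithin τ (Set.Ioi τ),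
          ∀ B' ∈ (crossings θ η A s₀ s₁).erase B, s' < hitTime θ η B' := by
        rw [Filter.eventually_all_finset]
        exact fun B' hB' => nhdsWithin_le_nhds (eventually_lt_nhds (hother B' hB'))
      exact (h1.and (h2.and h3)).exists
    have hs0s' : s₀ < s' := hB0.trans hτs'
    have hnv : ∀ s, s₀ < s → s ≤ s' → ∀ D ∈ proper A, mass (θ + s • η) D = 0 →
        s = τ ∧ (D = B ∨ D = A \ B) := by
      intro s hs hs2 D hD hsD
      obtain ⟨B', hB', hBt, hDB⟩ := hitTime_mem_crossings hθ hη (h₀ D hD) hD hs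
        (hs2.trans_lt hs'1) hsD
      have : B' = B := by
        by_contra hne
        have := hs'o B' (Finset.mem_erase.2 ⟨hne, hB'⟩)
        linarith
      subst this
      exact ⟨hBt.symm, hDB⟩
    have hs'nv : ∀ D ∈ proper A, mass (θ + s' • η) D ≠ 0 := fun D hD h =>
      hτs'.ne' (hnv s' hs0s' le_rfl D hD h).1
    have hCneg : ∀ s, mass (θ + s • η) (A \ B) = -mass (θ + s • η) B :=
      mass_path_sdiff hθ hη hBA
    have hBs : ∀ s, mass (θ + s • η) B = (s - τ) * mass η B := by
      intro s
      rw [mass_add_smul] at hτB ⊢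
      linarith
    have hwc : hn t c (θ + s₀ • η) A - hn t c (θ + s' • η) A = bracket t B (A \ B) *
        hn t c (θ + τ • η) B * hn t c (θ + τ • η) (A \ B) := by
      refine hnSum_wallCrossing t c hBA ?_ ?_ ?_ ?_ ?_ ?_ ?_
      · rw [hBs, not_lt]; nlinarith
      · rw [hCneg, hBs]; nlinarith
      · rw [hBs]; nlinarith
      · rw [hCneg, hBs]; nlinarith
      · intro D hD hDB hDC
        have h1 : mass θ D + s₀ * mass η D ≠ 0 := by rw [← mass_add_smul]; exact h₀ D hD
        have h2 : mass θ D + s' * mass η D ≠ 0 := by rw [← mass_add_smul]; exact hs'nv D hD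
        have h3 : ∀ s, s₀ < s → s < s' → mass θ D + s * mass η D ≠ 0 := by
          intro s hs hs2 h
          rw [← mass_add_smul] at h
          exact (hnv s hs hs2.le D hD h).2.elim hDB hDC
        have e1 := affine_neg_iff h1 h2 h3 hB0.le hτs'.le
        have e2 := affine_neg_iff h1 h2 h3 hs0s'.le le_rfl
        simp only [mass_add_smul]
        exact ⟨e1, e2.symm.trans e1⟩
      · intro D hD
        rw [mass_union _ (Finset.disjoint_sdiff.mono_right (mem_proper.1 hD).1.1), hτB, zero_add]
      · intro D hD
        rw [mass_union _ (Finset.sdiff_disjoint.mono_right (mem_proper.1 hD).1.1), hCneg, hτB,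
          neg_zero, zero_add]
    have hK : crossings θ η A s' s₁ = (crossings θ η A s₀ s₁).erase B := by
      ext D
      rw [Finset.mem_erase, mem_crossings, mem_crossings]
      constructor
      · rintro ⟨h1, h2, h3, h4⟩
        refine ⟨?_, h1, h2, hs0s'.trans h3, h4⟩
        rintro rfl
        exact lt_asymm h3 hτs'
      · rintro ⟨h0, h1, h2, h3, h4⟩
        exact ⟨h1, h2, hs'o D (Finset.mem_erase.2 ⟨h0, mem_crossings.2 ⟨h1, h2, h3, h4⟩⟩), h4⟩
    have := ih hs'1 hs'nv (fun s hs => hgen s (hs0s'.trans hs))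
      (by rw [hK, Finset.card_erase_of_mem hBK, hk]; rfl)
    rw [← Finset.add_sum_erase _ _ hBK, ← hK, ← this, ← hwc]
    ring

end

/-! ### Perturbation of stabilities, attractor stabilities -/

section

theorem exists_mem_forall_notMem {V : Type*} [AddCommGroup V] [Module ℝ V]
    {𝒮 : Set (Submodule ℝ V)} (h𝒮 : 𝒮.Finite) (Z : Submodule ℝ V) (h : ∀ W ∈ 𝒮, ¬ Z ≤ W) :
    ∃ η ∈ Z, ∀ W ∈ 𝒮, η ∉ W := by
  classical
  have := Subspace.biUnion_ne_univ_of_top_notMem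
    (s := (h𝒮.toFinset.image fun W => W.comap Z.subtype)) (by
      intro hmem
      obtain ⟨W, hW, hW'⟩ := Finset.mem_image.1 hmem
      exact h W (h𝒮.mem_toFinset.1 hW) (Submodule.comap_subtype_eq_top.1 hW'))
  obtain ⟨η, hη⟩ := (Set.ne_univ_iff_exists_notMem _).1 this
  refine ⟨η, η.2, fun W hW hηW => hη ?_⟩
  refine Set.mem_biUnion (Finset.mem_coe.2 (Finset.mem_image.2
    ⟨W, h𝒮.mem_toFinset.2 hW, rfl⟩)) ?_
  exact hηW

variable {I R : Type*} [DecidableEq I] [CommRing R]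

/-- The linear form `mass · A`. -/
def massₗ (A : Finset I) : (I → ℝ) →ₗ[ℝ] ℝ where
  toFun θ := mass θ A
  map_add' θ θ' := by simp [mass, Finset.sum_add_distrib]
  map_smul' s θ := by simp [mass, Finset.mul_sum]

@[simp] theorem massₗ_apply (A : Finset I) (θ : I → ℝ) : massₗ A θ = mass θ A := rfl

/-- The vectors supported on `A` with total mass zero. -/
def balancedOn (A : Finset I) : Submodule ℝ (I → ℝ) where
  carrier := {η | mass η A = 0 ∧ ∀ i ∉ A, η i = 0}
  add_mem' {a b} ha hb := by
    refine ⟨?_, fun i hi => by simp [ha.2 i hi, hb.2 i hi]⟩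
    have := (massₗ A).map_add a b
    simp only [massₗ_apply] at this
    rw [this, ha.1, hb.1, add_zero]
  zero_mem' := ⟨by simp [mass], fun _ _ => rfl⟩
  smul_mem' s a ha := by
    refine ⟨?_, fun i hi => by simp [ha.2 i hi]⟩
    have := (massₗ A).map_smul s a
    simp only [massₗ_apply] at this
    rw [this, ha.1, smul_zero]

theorem mass_single_sub_single (i j : I) (B : Finset I) :
    mass (Pi.single i 1 - Pi.single j 1) B =
      (if i ∈ B then 1 else 0) - (if j ∈ B then 1 else 0) := by
  simp [mass, Finset.sum_sub_distrib, Finset.sum_pi_single']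

theorem single_sub_single_mem_balancedOn {i j : I} {A : Finset I} (hi : i ∈ A) (hj : j ∈ A) :
    (Pi.single i 1 - Pi.single j 1 : I → ℝ) ∈ balancedOn A := by
  refine ⟨by rw [mass_single_sub_single, if_pos hi, if_pos hj, sub_self], fun k hk => ?_⟩
  have h1 : k ≠ i := fun h => hk (h ▸ hi)
  have h2 : k ≠ j := fun h => hk (h ▸ hj)
  simp [h1, h2]

theorem exists_mass_ne_zero {A B : Finset I} (hB : B ∈ proper A) :
    ∃ η ∈ balancedOn A, mass η B ≠ 0 := by
  obtain ⟨hBA, i, hi⟩ := mem_proper.1 hB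
  obtain ⟨j, hjA, hjB⟩ := Finset.exists_of_ssubset hBA
  refine ⟨_, single_sub_single_mem_balancedOn (hBA.1 hi) hjA, ?_⟩
  rw [mass_single_sub_single, if_pos hi, if_neg hjB]
  norm_num

theorem exists_mass_eq_zero_mass_ne_zero {A B B' : Finset I} (hB : B ∈ proper A)
    (hB' : B' ∈ proper A) (h1 : B' ≠ B) (h2 : B' ≠ A \ B) :
    ∃ η ∈ balancedOn A, mass η B = 0 ∧ mass η B' ≠ 0 := by
  have hBA := (mem_proper.1 hB).1.1
  have hB'A := (mem_proper.1 hB').1.1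
  -- `B'` separates two elements of `B` or two elements of `A \ B`
  obtain ⟨i, j, hi, hj, hiB', hjB', hij⟩ : ∃ i j, i ∈ A ∧ j ∈ A ∧ i ∈ B' ∧ j ∉ B' ∧
      (i ∈ B ↔ j ∈ B) := by
    by_contra hcon
    push Not at hcon
    obtain ⟨i, hi⟩ := (mem_proper.1 hB').2
    obtain ⟨j, hjA, hj⟩ := Finset.exists_of_ssubset (mem_proper.1 hB').1
    have hcon' : ∀ i j, i ∈ A → j ∈ A → i ∈ B' → j ∉ B' → (i ∈ B ↔ j ∉ B) := by
      intro i j hi hj hi' hj'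
      have := hcon i j hi hj hi' hj'
      tauto
    by_cases hiB : i ∈ B
    · apply h1
      have hjB : j ∉ B := (hcon' i j (hB'A hi) hjA hi hj).1 hiB
      ext k
      constructor
      · intro hk
        exact (hcon' k j (hB'A hk) hjA hk hj).2 hjB
      · intro hk
        by_contra hk'
        exact (hcon' i k (hB'A hi) (hBA hk) hi hk').1 hiB hk
    · apply h2
      have hjB : j ∈ B := by
        by_contra h
        exact hiB ((hcon' i j (hB'A hi) hjA hi hj).2 h)
      ext k
      rw [Finset.mem_sdiff]
      constructor
      · intro hk
        exact ⟨hB'A hk, fun h => (hcon' k j (hB'A hk) hjA hk hj).1 h hjB⟩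
      · rintro ⟨hk, hkB⟩
        by_contra hk'
        exact hiB ((hcon' i k (hB'A hi) hk hi hk').2 hkB)
  refine ⟨_, single_sub_single_mem_balancedOn hi hj, ?_, ?_⟩
  · rw [mass_single_sub_single]
    simp [hij]
  · rw [mass_single_sub_single, if_pos hiB', if_neg hjB']
    norm_num

open Topology

theorem eventually_add_mul_ne_zero {p r : ℝ} (h : p ≠ 0 ∨ r ≠ 0) :
    ∀ᶠ ε in 𝓝[>] (0 : ℝ), p + ε * r ≠ 0 := by
  by_cases hp : p = 0
  · subst hp
    have hr := h.resolve_left (fun h => h rfl)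
    filter_upwards [self_mem_nhdsWithin] with ε hε
    simp [hr, (Set.mem_Ioi.1 hε).ne']
  · have : Filter.Tendsto (fun ε : ℝ => p + ε * r) (𝓝[>] 0) (𝓝 p) := by
      refine tendsto_nhdsWithin_of_tendsto_nhds ?_
      have : Continuous fun ε : ℝ => p + ε * r := by fun_prop
      simpa using this.tendsto 0
    exact this.eventually_ne hp

theorem eventually_add_mul_pos {a : ℝ} (ha : 0 < a) (b : ℝ) :
    ∀ᶠ ε in 𝓝[>] (0 : ℝ), 0 < a + ε * b := by
  have : Filter.Tendsto (fun ε : ℝ => a + ε * b) (𝓝[>] 0) (𝓝 a) := by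
    refine tendsto_nhdsWithin_of_tendsto_nhds ?_
    have : Continuous fun ε : ℝ => a + ε * b := by fun_prop
    simpa using this.tendsto 0
  exact this.eventually_const_lt ha

theorem eventually_add_mul_neg {a : ℝ} (ha : a < 0) (b : ℝ) :
    ∀ᶠ ε in 𝓝[>] (0 : ℝ), a + ε * b < 0 := by
  filter_upwards [eventually_add_mul_pos (neg_pos.2 ha) (-b)] with ε h
  linarith

theorem eventually_sign {a : ℝ} (ha : a ≠ 0) (b : ℝ) :
    ∀ᶠ ε in 𝓝[>] (0 : ℝ), a + ε * b ≠ 0 ∧ (a + ε * b < 0 ↔ a < 0) := by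
  rcases lt_or_gt_of_ne ha with h | h
  · filter_upwards [eventually_add_mul_neg h b] with ε hε
    exact ⟨hε.ne, iff_of_true hε h⟩
  · filter_upwards [eventually_add_mul_pos h b] with ε hε
    exact ⟨hε.ne', iff_of_false (lt_asymm hε) (lt_asymm h)⟩

/-- The direction `i ↦ w i A` of the motion of the moments along an edge that carries `A`. -/
def flow (w : I → I → ℝ) (A : Finset I) : I → ℝ := fun i => ∑ j ∈ A, w i j

theorem mass_flow_swap {w : I → I → ℝ} (hw : ∀ i j, w i j = -w j i) (A B : Finset I) :
    mass (flow w A) B = -mass (flow w B) A := by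
  simp only [mass, flow, ← Finset.sum_neg_distrib]
  rw [Finset.sum_comm]
  exact Finset.sum_congr rfl fun i _ => Finset.sum_congr rfl fun j _ => hw j i

theorem mass_flow_self {w : I → I → ℝ} (hw : ∀ i j, w i j = -w j i) (A : Finset I) :
    mass (flow w A) A = 0 := by
  have := mass_flow_swap hw A A
  linarith

theorem mass_flow_sdiff {w : I → I → ℝ} (hw : ∀ i j, w i j = -w j i) {A B : Finset I}
    (h : B ⊆ A) : mass (flow w (A \ B)) B = mass (flow w A) B := by
  rw [mass_flow_swap hw, mass_sdiff _ h, mass_flow_self hw, sub_zero, ← mass_flow_swap hw]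

/-- Two stabilities that are separated only by walls with vanishing bracket have the same
`hn`. -/
theorem hn_eq_of_sign_iff (t : I → I → R) (c : Finset I → R) {w : I → I → ℝ}
    (hw : ∀ i j, w i j = -w j i)
    (hdeg : ∀ B C : Finset I, B.Nonempty → C.Nonempty → Disjoint B C → mass (flow w C) B = 0 →
      bracket t B C = 0)
    {A : Finset I} (hA : A.Nonempty) {θ θ' : I → ℝ} (hθ : mass θ A = 0) (hθ' : mass θ' A = 0)
    (h : ∀ D ∈ proper A, mass θ D ≠ 0) (h' : ∀ D ∈ proper A, mass θ' D ≠ 0)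
    (hs : ∀ D ∈ proper A, mass (flow w A) D ≠ 0 → (mass θ D < 0 ↔ mass θ' D < 0)) :
    hn t c θ A = hn t c θ' A := by
  classical
  -- a perturbation of `θ'` such that the segment from `θ` crosses the walls one at a time
  let det : Finset I → Finset I → (I → ℝ) →ₗ[ℝ] ℝ := fun B B' =>
    mass θ B • massₗ B' - mass θ B' • massₗ B
  obtain ⟨η, hηA, hη⟩ := exists_mem_forall_notMem
    (𝒮 := (fun p : Finset I × Finset I => LinearMap.ker (det p.1 p.2)) ''
      {p | p.1 ∈ proper A ∧ p.2 ∈ proper A ∧ p.2 ≠ p.1 ∧ p.2 ≠ A \ p.1})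
    (Set.Finite.image _ (((proper A ×ˢ proper A).finite_toSet).subset (by
      rintro p ⟨h1, h2, -⟩
      exact Finset.mem_coe.2 (Finset.mem_product.2 ⟨h1, h2⟩)))) (balancedOn A) (by
      rintro _ ⟨⟨B, B'⟩, ⟨hB, hB', h1, h2⟩, rfl⟩ hle
      obtain ⟨η, hη, hη1, hη2⟩ := exists_mass_eq_zero_mass_ne_zero hB hB' h1 h2
      have := hle hη
      simp [det, hη1, hη2, h B hB] at this)
  have hη' : ∀ B ∈ proper A, ∀ B' ∈ proper A, B' ≠ B → B' ≠ A \ B →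
      mass θ B * mass η B' - mass θ B' * mass η B ≠ 0 := by
    intro B hB B' hB' h1 h2 h0
    exact hη _ ⟨(B, B'), ⟨hB, hB', h1, h2⟩, rfl⟩ (by simpa [det] using h0)
  have ev1 : ∀ᶠ ε in 𝓝[>] (0 : ℝ), ∀ D ∈ proper A,
      mass θ' D + ε * mass η D ≠ 0 ∧ (mass θ' D + ε * mass η D < 0 ↔ mass θ' D < 0) := by
    rw [Filter.eventually_all_finset]
    exact fun D hD => eventually_sign (h' D hD) _
  have ev2 : ∀ᶠ ε in 𝓝[>] (0 : ℝ), ∀ B ∈ proper A, ∀ B' ∈ proper A, B' ≠ B → B' ≠ A \ B →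
      (mass θ B * mass θ' B' - mass θ B' * mass θ' B) +
        ε * (mass θ B * mass η B' - mass θ B' * mass η B) ≠ 0 := by
    rw [Filter.eventually_all_finset]
    intro B hB
    rw [Filter.eventually_all_finset]
    intro B' hB'
    by_cases hc : B' ≠ B ∧ B' ≠ A \ B
    · filter_upwards [eventually_add_mul_ne_zero (Or.inr (hη' B hB B' hB' hc.1 hc.2))] with ε hε
      exact fun _ _ => hε
    · exact Filter.Eventually.of_forall fun ε h1 h2 => absurd ⟨h1, h2⟩ hc
  obtain ⟨ε, hε1, hε2⟩ := (ev1.and ev2).exists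
  set θ'' := θ' + ε • η with hθ''
  have hm : ∀ D, mass θ'' D = mass θ' D + ε * mass η D := fun D => mass_add_smul _ _ _ _
  have e1 : hn t c θ'' A = hn t c θ' A :=
    hn_congr t c hA fun D hD => by rw [hm]; exact (hε1 D hD).2
  rw [← e1]
  have hζ : ∀ D, mass (θ'' - θ) D = mass θ'' D - mass θ D := fun D => by
    simpa using (massₗ D).map_sub θ'' θ
  have hA'' : mass θ'' A = 0 := by rw [hm, hθ', hηA.1]; ring
  have hpath := hn_sub_hn_of_path t c hA (θ := θ) (η := θ'' - θ) (s₀ := 0) (s₁ := 1) hθ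
    (by rw [hζ, hA'', hθ, sub_zero]) one_pos
    (by intro D hD; rw [zero_smul, add_zero]; exact h D hD)
    (by intro D hD; rw [one_smul, add_sub_cancel, hm]; exact (hε1 D hD).1)
    (by
      intro s hs0 hs1 B hB B' hB' h1 h2
      by_contra hcon
      push Not at hcon
      refine hε2 B hB B' hB' hcon.1 hcon.2 ?_
      rw [mass_add_smul, hζ, hm] at h1 h2
      -- `(1 - s, s)` is a nonzero solution of a linear system with this determinant
      have : s * ((mass θ B * mass θ' B' - mass θ B' * mass θ' B) +
        ε * (mass θ B * mass η B' - mass θ B' * mass η B)) = 0 := by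
        linear_combination mass θ B * h2 - mass θ B' * h1
      exact (mul_eq_zero.1 this).resolve_left hs0.ne')
  rw [zero_smul, add_zero, one_smul, add_sub_cancel] at hpath
  rw [← sub_eq_zero, hpath]
  refine Finset.sum_eq_zero fun B hB => ?_
  obtain ⟨hBA, hB1, hB2, hB3⟩ := mem_crossings.1 hB
  have hB' := mem_proper.1 hBA
  have hflow : mass (flow w A) B = 0 := by
    by_contra hne
    have hsg := hs B hBA hne
    rw [← (hε1 B hBA).2, ← hm] at hsg
    rw [hitTime] at hB2 hB3
    rw [lt_div_iff_of_neg hB1] at hB2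
    rw [div_lt_iff_of_neg hB1] at hB3
    rw [hζ] at hB2 hB3
    have : mass θ'' B < 0 := by linarith
    have := hsg.2 this
    linarith
  rw [hdeg B (A \ B) hB'.2 (mem_proper.1 (sdiff_mem_proper hBA)).2 Finset.disjoint_sdiff
    (by rw [mass_flow_sdiff hw hB'.1.1, hflow])]
  ring

/-- A stability on `A` close to `-flow w A` that lies on no wall. -/
theorem exists_attractor (w : I → I → ℝ) (A : Finset I) (hw : ∀ i j, w i j = -w j i) :
    ∃ θ : I → ℝ, mass θ A = 0 ∧ (∀ D ∈ proper A, mass θ D ≠ 0) ∧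
      ∀ D ∈ proper A, mass (flow w A) D ≠ 0 → (mass θ D < 0 ↔ 0 < mass (flow w A) D) := by
  obtain ⟨η, hηA, hη⟩ := exists_mem_forall_notMem
    (𝒮 := (fun B : Finset I => LinearMap.ker (massₗ B)) '' (proper A))
    (Set.Finite.image _ (Finset.finite_toSet _)) (balancedOn A) (by
      rintro _ ⟨B, hB, rfl⟩ hle
      obtain ⟨η, hη, hη1⟩ := exists_mass_ne_zero hB
      exact hη1 (hle hη))
  have hη' : ∀ D ∈ proper A, mass η D ≠ 0 := fun D hD h0 => hη _ ⟨D, hD, rfl⟩ h0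
  have ev1 : ∀ᶠ ε in 𝓝[>] (0 : ℝ), ∀ D ∈ proper A, -mass (flow w A) D + ε * mass η D ≠ 0 := by
    rw [Filter.eventually_all_finset]
    exact fun D hD => eventually_add_mul_ne_zero (Or.inr (hη' D hD))
  have ev2 : ∀ᶠ ε in 𝓝[>] (0 : ℝ), ∀ D ∈ proper A, mass (flow w A) D ≠ 0 →
      (-mass (flow w A) D + ε * mass η D < 0 ↔ 0 < mass (flow w A) D) := by
    rw [Filter.eventually_all_finset]
    intro D hD
    by_cases h0 : mass (flow w A) D = 0
    · exact Filter.Eventually.of_forall fun _ h => absurd h0 h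
    · filter_upwards [eventually_sign (neg_ne_zero.2 h0) (mass η D)] with ε hε _
      rw [hε.2, neg_lt_zero]
  obtain ⟨ε, h1, h2⟩ := (ev1.and ev2).exists
  have hm : ∀ D, mass (-flow w A + ε • η) D = -mass (flow w A) D + ε * mass η D := fun D => by
    rw [mass_add_smul]
    congr 1
    simpa using (massₗ D).map_neg (flow w A)
  refine ⟨-flow w A + ε • η, ?_, ?_, ?_⟩
  · rw [hm, mass_flow_self hw, hηA.1]; ring
  · intro D hD; rw [hm]; exact h1 D hD
  · intro D hD; rw [hm]; exact h2 D hD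

open Classical in
/-- Coefficients that are `1` on singletons, and for which `hnSum` with respect to the predicate
`P A` vanishes on each larger set `A`. -/
def initialCoeff (t : I → I → R) (P : Finset I → Finset I → Prop) (A : Finset I) : R :=
  if #A ≤ 1 then 1 else
    ∑ D ∈ (proper A).attach, if P A D.1 then
      hnSum t (fun X => if _h : X ⊂ A then initialCoeff t P X else 0) (P A) D.1 *
        setPair t D.1 (A \ D.1) * initialCoeff t P (A \ D.1) else 0
termination_by #A
decreasing_by
  · exact Finset.card_lt_card (by assumption)
  · exact card_lt_of_mem_proper (sdiff_mem_proper D.2)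

theorem initialCoeff_of_card_le_one (t : I → I → R) (P : Finset I → Finset I → Prop)
    {A : Finset I} (hA : #A ≤ 1) : initialCoeff t P A = 1 := by
  rw [initialCoeff, if_pos hA]

theorem hnSum_initialCoeff (t : I → I → R) (P : Finset I → Finset I → Prop) {A : Finset I}
    (hA : 2 ≤ #A) : hnSum t (initialCoeff t P) (P A) A = 0 := by
  classical
  rw [hnSum_eq, initialCoeff, if_neg (by omega), Finset.sum_attach (proper A) (fun D =>
    if P A D then hnSum t (fun X => if _h : X ⊂ A then initialCoeff t P X else 0) (P A) D *
        setPair t D (A \ D) * initialCoeff t P (A \ D) else 0), sub_eq_zero]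
  refine Finset.sum_congr rfl fun D hD => ?_
  have hD' := mem_proper.1 hD
  rw [hnSum_congr t hD'.2 (fun _ _ => Iff.rfl) (c' := initialCoeff t P)
    (fun X hX _ => by rw [dif_pos (hX.trans_ssubset hD'.1)])]

end

/-! ### Hierarchies of clusters -/

section

open Topology

variable {I R : Type*} [DecidableEq I] [CommRing R]

/-- The nodes of a hierarchy `H` of clusters: the clusters and the singletons. -/
def IsNode (H : Finset (Finset I)) (X : Finset I) : Prop := X ∈ H ∨ #X = 1

/-- A hierarchy on `A`: a laminar family of subsets of `A` with at least two elements, which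
contains `A` if `A` has at least two elements. Hierarchies encode the rooted trees with leaves
labelled by `A` whose vertices all have at least two children; the clusters are the vertices. -/
structure IsHierarchy (H : Finset (Finset I)) (A : Finset I) : Prop where
  subset : ∀ X ∈ H, X ⊆ A
  two_le_card : ∀ X ∈ H, 2 ≤ #X
  top_mem : 2 ≤ #A → A ∈ H
  laminar : ∀ X ∈ H, ∀ Y ∈ H, X ⊆ Y ∨ Y ⊆ X ∨ Disjoint X Y

theorem IsNode.nonempty {H : Finset (Finset I)} {A X : Finset I} (hH : IsHierarchy H A)
    (h : IsNode H X) : X.Nonempty := by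
  rw [← Finset.card_pos]
  rcases h with h | h
  · have := hH.two_le_card X h; omega
  · omega

theorem IsHierarchy.node_laminar {H : Finset (Finset I)} {A X Y : Finset I} (hH : IsHierarchy H A)
    (hX : IsNode H X) (hY : IsNode H Y) : X ⊆ Y ∨ Y ⊆ X ∨ Disjoint X Y := by
  have single : ∀ {X Y : Finset I}, #X = 1 → X ⊆ Y ∨ Disjoint X Y := by
    intro X Y h
    obtain ⟨x, rfl⟩ := Finset.card_eq_one.1 h
    by_cases hx : x ∈ Y
    · exact Or.inl (Finset.singleton_subset_iff.2 hx)
    · exact Or.inr (Finset.disjoint_singleton_left.2 hx)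
  rcases hX with hX | hX
  · rcases hY with hY | hY
    · exact hH.laminar X hX Y hY
    · rcases single (Y := X) hY with h | h
      · exact Or.inr (Or.inl h)
      · exact Or.inr (Or.inr h.symm)
  · rcases single (Y := Y) hX with h | h
    · exact Or.inl h
    · exact Or.inr (Or.inr h)

theorem IsHierarchy.isNode_top {H : Finset (Finset I)} {A : Finset I} (hH : IsHierarchy H A)
    (hA : A.Nonempty) : IsNode H A := by
  have := Finset.card_pos.2 hA
  by_cases h : #A = 1
  · exact Or.inr h
  · exact Or.inl (hH.top_mem (by omega))

theorem IsHierarchy.eq_of_split_subset {H : Finset (Finset I)} {A X B B' : Finset I}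
    (hH : IsHierarchy H A) (hB : B ∈ proper X) (hB' : B' ∈ proper X) (hn : IsNode H B)
    (hn' : IsNode H (X \ B')) (h : B' ⊆ B) : B' = B := by
  by_contra hne
  obtain ⟨y, hy⟩ := (mem_proper.1 hB').2
  obtain ⟨z, hz⟩ := (mem_proper.1 (sdiff_mem_proper hB)).2
  obtain ⟨u, hu, hu'⟩ := Finset.exists_of_ssubset (h.ssubset_of_ne hne)
  rw [Finset.mem_sdiff] at hz
  have hzB' : z ∈ X \ B' := Finset.mem_sdiff.2 ⟨hz.1, fun h' => hz.2 (h h')⟩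
  rcases hH.node_laminar hn' hn with h' | h' | h'
  · exact hz.2 (h' hzB')
  · exact (Finset.mem_sdiff.1 (h' (h hy))).2 hy
  · exact Finset.disjoint_left.1 h' (Finset.mem_sdiff.2 ⟨(mem_proper.1 hB).1.1 hu, hu'⟩) hu

/-- A vertex of a hierarchy splits in at most one way into two nodes. -/
theorem IsHierarchy.split_eq_or {H : Finset (Finset I)} {A X B B' : Finset I}
    (hH : IsHierarchy H A) (hB : B ∈ proper X) (hB' : B' ∈ proper X) (hn : IsNode H B)
    (hn2 : IsNode H (X \ B)) (hn' : IsNode H B') (hn2' : IsNode H (X \ B')) :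
    B' = B ∨ B' = X \ B := by
  rcases hH.node_laminar hn' hn with h | h | h
  · exact Or.inl (hH.eq_of_split_subset hB hB' hn hn2' h)
  · exact Or.inl (hH.eq_of_split_subset hB' hB hn' hn2 h).symm
  · refine Or.inr (hH.eq_of_split_subset (sdiff_mem_proper hB) hB' hn2 hn2' ?_)
    exact fun x hx => Finset.mem_sdiff.2 ⟨(mem_proper.1 hB').1.1 hx,
      Finset.disjoint_left.1 h hx⟩

/-- The cluster `X` of `H` splits into the two nodes `B` and `X \ B`, ordered so that
`w (B, X \ B) > 0`. -/
def IsSplit (w : I → I → ℝ) (H : Finset (Finset I)) (X B : Finset I) : Prop :=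
  B ∈ proper X ∧ IsNode H B ∧ IsNode H (X \ B) ∧ 0 < mass (flow w (X \ B)) B

theorem IsSplit.unique {w : I → I → ℝ} (hw : ∀ i j, w i j = -w j i) {H : Finset (Finset I)}
    {A X B B' : Finset I} (hH : IsHierarchy H A) (h : IsSplit w H X B) (h' : IsSplit w H X B') :
    B' = B := by
  rcases hH.split_eq_or h.1 h'.1 h.2.1 h.2.2.1 h'.2.1 h'.2.2.1 with e | e
  · exact e
  · have h1 := h'.2.2.2
    have h2 := h.2.2.2
    rw [e, sdiff_sdiff_of_mem_proper h.1, mass_flow_swap hw] at h1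
    linarith

open Classical in
/-- The hierarchies on `A` all of whose clusters split into two nodes with nonzero pairing. -/
def binaryHierarchies (w : I → I → ℝ) (A : Finset I) : Finset (Finset (Finset I)) :=
  A.powerset.powerset.filter fun H => IsHierarchy H A ∧ ∀ X ∈ H, ∃ B, IsSplit w H X B

theorem mem_binaryHierarchies {w : I → I → ℝ} {A : Finset I} {H : Finset (Finset I)} :
    H ∈ binaryHierarchies w A ↔ IsHierarchy H A ∧ ∀ X ∈ H, ∃ B, IsSplit w H X B := by
  simp only [binaryHierarchies, Finset.mem_filter, Finset.mem_powerset, and_iff_right_iff_imp]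
  intro h X hX
  exact Finset.mem_powerset.2 (h.1.subset X hX)

open Classical in
/-- The product over the clusters of the brackets of their two children. -/
def treeWeight (t : I → I → R) (w : I → I → ℝ) (H : Finset (Finset I)) : R :=
  ∏ X ∈ H, ∑ B ∈ (proper X).filter (IsSplit w H X), bracket t B (X \ B)

/-- The hierarchy with root `A` obtained by joining hierarchies on `B` and on `A \ B`. -/
def joinHierarchies (A : Finset I) (H₁ H₂ : Finset (Finset I)) : Finset (Finset I) :=
  insert A (H₁ ∪ H₂)

theorem joinHierarchies_comm (A : Finset I) (H₁ H₂ : Finset (Finset I)) :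
    joinHierarchies A H₁ H₂ = joinHierarchies A H₂ H₁ := by
  rw [joinHierarchies, joinHierarchies, Finset.union_comm]

section Join

variable {w : I → I → ℝ} {A B C : Finset I} {H₁ H₂ : Finset (Finset I)}

theorem isNode_join_iff (hB : B ∈ proper A) (h₂ : IsHierarchy H₂ (A \ B)) {D : Finset I}
    (hD : D ⊆ B) (hDn : D.Nonempty) :
    IsNode (joinHierarchies A H₁ H₂) D ↔ IsNode H₁ D := by
  simp only [IsNode, joinHierarchies, Finset.mem_insert, Finset.mem_union]
  constructor
  · rintro ((rfl | h | h) | h)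
    · exact absurd hD (mem_proper.1 hB).1.2
    · exact Or.inl h
    · obtain ⟨x, hx⟩ := hDn
      exact absurd (hD hx) (Finset.mem_sdiff.1 (h₂.subset D h hx)).2
    · exact Or.inr h
  · rintro (h | h)
    · exact Or.inl (Or.inr (Or.inl h))
    · exact Or.inr h

theorem isSplit_join_iff (hB : B ∈ proper A) (h₂ : IsHierarchy H₂ (A \ B)) {X D : Finset I}
    (hX : X ⊆ B) : IsSplit w (joinHierarchies A H₁ H₂) X D ↔ IsSplit w H₁ X D := by
  unfold IsSplit
  refine and_congr_right fun hD => ?_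
  rw [isNode_join_iff hB h₂ ((mem_proper.1 hD).1.1.trans hX) (mem_proper.1 hD).2,
    isNode_join_iff hB h₂ (Finset.sdiff_subset.trans hX)
      (mem_proper.1 (sdiff_mem_proper hD)).2]

theorem isSplit_join_top (hB : B ∈ proper A) (h₁ : IsHierarchy H₁ B)
    (h₂ : IsHierarchy H₂ (A \ B)) (hw : 0 < mass (flow w (A \ B)) B) :
    IsSplit w (joinHierarchies A H₁ H₂) A B := by
  refine ⟨hB, ?_, ?_, hw⟩
  · rw [isNode_join_iff hB h₂ subset_rfl (mem_proper.1 hB).2]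
    exact h₁.isNode_top (mem_proper.1 hB).2
  · rw [joinHierarchies_comm, isNode_join_iff (sdiff_mem_proper hB)
      (by rwa [sdiff_sdiff_of_mem_proper hB]) subset_rfl (mem_proper.1 (sdiff_mem_proper hB)).2]
    exact h₂.isNode_top (mem_proper.1 (sdiff_mem_proper hB)).2

theorem isHierarchy_join (hB : B ∈ proper A) (h₁ : IsHierarchy H₁ B)
    (h₂ : IsHierarchy H₂ (A \ B)) : IsHierarchy (joinHierarchies A H₁ H₂) A := by
  have hsub : ∀ X ∈ H₁ ∪ H₂, X ⊆ A := by
    intro X hX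
    rcases Finset.mem_union.1 hX with h | h
    · exact (h₁.subset X h).trans (mem_proper.1 hB).1.1
    · exact (h₂.subset X h).trans Finset.sdiff_subset
  have hdis : ∀ X ∈ H₁, ∀ Y ∈ H₂, Disjoint X Y := fun X hX Y hY =>
    Finset.disjoint_sdiff.mono (h₁.subset X hX) (h₂.subset Y hY)
  refine ⟨?_, ?_, fun _ => Finset.mem_insert_self _ _, ?_⟩
  · intro X hX
    rcases Finset.mem_insert.1 hX with rfl | h
    · exact subset_rfl
    · exact hsub X h
  · intro X hX
    rcases Finset.mem_insert.1 hX with rfl | h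
    · have h1 := card_lt_of_mem_proper hB
      have h2 := Finset.card_pos.2 (mem_proper.1 hB).2
      omega
    · rcases Finset.mem_union.1 h with h | h
      · exact h₁.two_le_card X h
      · exact h₂.two_le_card X h
  · intro X hX Y hY
    rcases Finset.mem_insert.1 hX with rfl | hX'
    · rcases Finset.mem_insert.1 hY with rfl | hY'
      · exact Or.inl subset_rfl
      · exact Or.inr (Or.inl (hsub Y hY'))
    rcases Finset.mem_insert.1 hY with rfl | hY'
    · exact Or.inl (hsub X hX')
    rcases Finset.mem_union.1 hX' with hX | hX <;> rcases Finset.mem_union.1 hY' with hY | hY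
    · exact h₁.laminar X hX Y hY
    · exact Or.inr (Or.inr (hdis X hX Y hY))
    · exact Or.inr (Or.inr (hdis Y hY X hX).symm)
    · exact h₂.laminar X hX Y hY

theorem join_mem_binaryHierarchies (hB : B ∈ proper A) (h₁ : H₁ ∈ binaryHierarchies w B)
    (h₂ : H₂ ∈ binaryHierarchies w (A \ B)) (hw : 0 < mass (flow w (A \ B)) B) :
    joinHierarchies A H₁ H₂ ∈ binaryHierarchies w A := by
  rw [mem_binaryHierarchies] at *
  refine ⟨isHierarchy_join hB h₁.1 h₂.1, fun X hX => ?_⟩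
  rcases Finset.mem_insert.1 hX with rfl | hX
  · exact ⟨B, isSplit_join_top hB h₁.1 h₂.1 hw⟩
  rcases Finset.mem_union.1 hX with hX | hX
  · obtain ⟨D, hD⟩ := h₁.2 X hX
    exact ⟨D, (isSplit_join_iff hB h₂.1 (h₁.1.subset X hX)).2 hD⟩
  · obtain ⟨D, hD⟩ := h₂.2 X hX
    refine ⟨D, ?_⟩
    rw [joinHierarchies_comm]
    exact (isSplit_join_iff (sdiff_mem_proper hB) (by rw [sdiff_sdiff_of_mem_proper hB]; exact h₁.1)
      (h₂.1.subset X hX)).2 hD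

theorem filter_join (hB : B ∈ proper A) (h₁ : IsHierarchy H₁ B) (h₂ : IsHierarchy H₂ (A \ B)) :
    (joinHierarchies A H₁ H₂).filter (· ⊆ B) = H₁ := by
  ext X
  simp only [joinHierarchies, Finset.mem_filter, Finset.mem_insert, Finset.mem_union]
  constructor
  · rintro ⟨rfl | h | h, hX⟩
    · exact absurd hX (mem_proper.1 hB).1.2
    · exact h
    · obtain ⟨x, hx⟩ := IsNode.nonempty h₂ (Or.inl h)
      exact absurd (hX hx) (Finset.mem_sdiff.1 (h₂.subset X h hx)).2
  · exact fun h => ⟨Or.inr (Or.inl h), h₁.subset X h⟩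

theorem restrict_mem_binaryHierarchies {H : Finset (Finset I)} (hH : H ∈ binaryHierarchies w A)
    (hB : IsNode H B) : H.filter (· ⊆ B) ∈ binaryHierarchies w B := by
  rw [mem_binaryHierarchies] at *
  refine ⟨⟨fun X hX => (Finset.mem_filter.1 hX).2,
    fun X hX => hH.1.two_le_card X (Finset.mem_filter.1 hX).1, fun h => ?_,
    fun X hX Y hY => hH.1.laminar X (Finset.mem_filter.1 hX).1 Y (Finset.mem_filter.1 hY).1⟩,
    fun X hX => ?_⟩
  · rcases hB with hB | hB
    · exact Finset.mem_filter.2 ⟨hB, subset_rfl⟩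
    · omega
  · obtain ⟨hXH, hXB⟩ := Finset.mem_filter.1 hX
    obtain ⟨D, h1, h2, h3, h4⟩ := hH.2 X hXH
    refine ⟨D, h1, ?_, ?_, h4⟩
    · exact h2.imp (fun h => Finset.mem_filter.2 ⟨h, (mem_proper.1 h1).1.1.trans hXB⟩) id
    · exact h3.imp (fun h => Finset.mem_filter.2 ⟨h, Finset.sdiff_subset.trans hXB⟩) id

theorem IsHierarchy.subset_or_subset_sdiff {H : Finset (Finset I)} {X : Finset I}
    (hH : IsHierarchy H A) (hBA : B ∈ proper A) (hB : IsNode H B) (hC : IsNode H (A \ B))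
    (hX : X ∈ H) (hXA : X ≠ A) : X ⊆ B ∨ X ⊆ A \ B := by
  have hXA' := hH.subset X hX
  have aux : Disjoint X B → X ⊆ A \ B := fun h x hx =>
    Finset.mem_sdiff.2 ⟨hXA' hx, Finset.disjoint_left.1 h hx⟩
  rcases hH.node_laminar (Or.inl hX) hB with h | h | h
  · exact Or.inl h
  · rcases hH.node_laminar (Or.inl hX) hC with h' | h' | h'
    · exact Or.inr h'
    · refine absurd (subset_antisymm hXA' ?_) hXA
      rw [← union_sdiff_of_mem_proper hBA]
      exact Finset.union_subset h h'
    · refine Or.inl fun x hx => ?_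
      by_contra hxB
      exact Finset.disjoint_left.1 h' hx (Finset.mem_sdiff.2 ⟨hXA' hx, hxB⟩)
  · exact Or.inr (aux h)

theorem join_restrict {H : Finset (Finset I)} (hH : IsHierarchy H A) (hBA : B ∈ proper A)
    (hB : IsNode H B) (hC : IsNode H (A \ B)) (hA : A ∈ H) :
    joinHierarchies A (H.filter (· ⊆ B)) (H.filter (· ⊆ A \ B)) = H := by
  ext X
  simp only [joinHierarchies, Finset.mem_insert, Finset.mem_union, Finset.mem_filter]
  constructor
  · rintro (rfl | h | h)
    · exact hA
    · exact h.1
    · exact h.1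
  · intro hX
    by_cases hXA : X = A
    · exact Or.inl hXA
    · rcases hH.subset_or_subset_sdiff hBA hB hC hX hXA with h | h
      · exact Or.inr (Or.inl ⟨hX, h⟩)
      · exact Or.inr (Or.inr ⟨hX, h⟩)

open Classical in
/-- The proper subsets `B` of `A` that can be the first child of `A` in a binary hierarchy. -/
def positiveSplits (w : I → I → ℝ) (A : Finset I) : Finset (Finset I) :=
  (proper A).filter fun B => 0 < mass (flow w (A \ B)) B

theorem mem_positiveSplits : B ∈ positiveSplits w A ↔
    B ∈ proper A ∧ 0 < mass (flow w (A \ B)) B := by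
  classical
  simp [positiveSplits]

theorem sum_binaryHierarchies {M : Type*} [AddCommMonoid M] (hw : ∀ i j, w i j = -w j i)
    (hA : 2 ≤ #A) (f : Finset (Finset I) → M) :
    ∑ H ∈ binaryHierarchies w A, f H = ∑ B ∈ positiveSplits w A,
      ∑ p ∈ binaryHierarchies w B ×ˢ binaryHierarchies w (A \ B),
        f (joinHierarchies A p.1 p.2) := by
  classical
  rw [Finset.sum_sigma']
  symm
  refine Finset.sum_nbij (fun p => joinHierarchies A p.2.1 p.2.2) ?_ ?_ ?_ (fun _ _ => rfl)
  · rintro ⟨B, H₁, H₂⟩ hp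
    simp only [Finset.mem_sigma, Finset.mem_product, mem_positiveSplits] at hp
    exact join_mem_binaryHierarchies hp.1.1 hp.2.1 hp.2.2 hp.1.2
  · rintro ⟨B, H₁, H₂⟩ hp ⟨B', H₁', H₂'⟩ hp' heq
    simp only [Finset.coe_sigma, Set.mem_sigma_iff, Finset.mem_coe, Finset.mem_product,
      mem_positiveSplits, mem_binaryHierarchies] at hp hp'
    simp only at heq
    have hJ := isHierarchy_join hp.1.1 hp.2.1.1 hp.2.2.1
    have hs := isSplit_join_top hp.1.1 hp.2.1.1 hp.2.2.1 hp.1.2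
    have hs' := isSplit_join_top hp'.1.1 hp'.2.1.1 hp'.2.2.1 hp'.1.2
    rw [← heq] at hs'
    obtain rfl := hs'.unique hw hJ hs
    have e1 := filter_join hp.1.1 hp.2.1.1 hp.2.2.1
    have e1' := filter_join hp'.1.1 hp'.2.1.1 hp'.2.2.1
    have hBB := sdiff_sdiff_of_mem_proper hp.1.1
    have e2 := filter_join (sdiff_mem_proper hp.1.1) hp.2.2.1 (hBB.symm ▸ hp.2.1.1)
    have e2' := filter_join (sdiff_mem_proper hp.1.1) hp'.2.2.1 (hBB.symm ▸ hp'.2.1.1)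
    rw [joinHierarchies_comm] at e2 e2'
    rw [← heq] at e1' e2'
    obtain rfl := e1.symm.trans e1'
    obtain rfl := e2.symm.trans e2'
    rfl
  · intro H hH
    have hH' := mem_binaryHierarchies.1 (Finset.mem_coe.1 hH)
    have hAH := hH'.1.top_mem hA
    obtain ⟨B, h1, h2, h3, h4⟩ := hH'.2 A hAH
    refine ⟨⟨B, H.filter (· ⊆ B), H.filter (· ⊆ A \ B)⟩, ?_, join_restrict hH'.1 h1 h2 h3 hAH⟩
    simp only [Finset.coe_sigma, Set.mem_sigma_iff, Finset.mem_coe, Finset.mem_product,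
      mem_positiveSplits]
    exact ⟨⟨h1, h4⟩, restrict_mem_binaryHierarchies hH h2,
      restrict_mem_binaryHierarchies hH h3⟩

theorem disjoint_of_hierarchies (h₁ : IsHierarchy H₁ B)
    (h₂ : IsHierarchy H₂ (A \ B)) : Disjoint H₁ H₂ := by
  rw [Finset.disjoint_left]
  intro X h1 h2
  obtain ⟨x, hx⟩ := IsNode.nonempty h₁ (Or.inl h1)
  exact (Finset.mem_sdiff.1 (h₂.subset X h2 hx)).2 (h₁.subset X h1 hx)

theorem top_notMem_union (hB : B ∈ proper A) (h₁ : IsHierarchy H₁ B)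
    (h₂ : IsHierarchy H₂ (A \ B)) : A ∉ H₁ ∪ H₂ := by
  intro h
  rcases Finset.mem_union.1 h with h | h
  · exact (mem_proper.1 hB).1.2 (h₁.subset A h)
  · exact (mem_proper.1 (sdiff_mem_proper hB)).1.2 (h₂.subset A h)

theorem treeWeight_join (hw : ∀ i j, w i j = -w j i) (t : I → I → R) (hB : B ∈ proper A)
    (h₁ : IsHierarchy H₁ B) (h₂ : IsHierarchy H₂ (A \ B)) (hpos : 0 < mass (flow w (A \ B)) B) :
    treeWeight t w (joinHierarchies A H₁ H₂) =
      bracket t B (A \ B) * treeWeight t w H₁ * treeWeight t w H₂ := by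
  classical
  have hs := isSplit_join_top hB h₁ h₂ hpos
  have hJ := isHierarchy_join hB h₁ h₂
  have hf : (proper A).filter (IsSplit w (joinHierarchies A H₁ H₂) A) = {B} := by
    ext D
    rw [Finset.mem_filter, Finset.mem_singleton]
    constructor
    · exact fun h => hs.unique hw hJ h.2
    · rintro rfl; exact ⟨hB, hs⟩
  have hprod : treeWeight t w (joinHierarchies A H₁ H₂) = ∏ X ∈ insert A (H₁ ∪ H₂),
      ∑ D ∈ (proper X).filter (IsSplit w (joinHierarchies A H₁ H₂) X), bracket t D (X \ D) := rfl
  rw [hprod, Finset.prod_insert (top_notMem_union hB h₁ h₂),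
    Finset.prod_union (disjoint_of_hierarchies h₁ h₂), hf, Finset.sum_singleton, ← mul_assoc]
  congr 1
  · congr 1
    refine Finset.prod_congr rfl fun X hX => ?_
    refine Finset.sum_congr (Finset.filter_congr fun D _ => ?_) fun _ _ => rfl
    exact isSplit_join_iff hB h₂ (h₁.subset X hX)
  · refine Finset.prod_congr rfl fun X hX => ?_
    refine Finset.sum_congr (Finset.filter_congr fun D _ => ?_) fun _ _ => rfl
    rw [joinHierarchies_comm]
    exact isSplit_join_iff (sdiff_mem_proper hB) (by rwa [sdiff_sdiff_of_mem_proper hB])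
      (h₂.subset X hX)

end Join

end

/-! ### The flow tree formula -/

section

open Topology

variable {I R : Type*} [DecidableEq I] [CommRing R]

open Classical in
/-- The lengths `l` of the edges of the hierarchy `H` on `A` (the edge above the cluster `X` has
length `l X`) realize the moments `ν`. -/
def Solves (w : I → I → ℝ) (A : Finset I) (H : Finset (Finset I)) (l : Finset I → ℝ)
    (ν : I → ℝ) : Prop :=
  ∀ i ∈ A, ν i = ∑ X ∈ H, if i ∈ X then l X * flow w X i else 0

theorem Solves.add_smul {w : I → I → ℝ} {A : Finset I} {H : Finset (Finset I)}
    {l l' : Finset I → ℝ} {ν ν' : I → ℝ} (h : Solves w A H l ν) (h' : Solves w A H l' ν')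
    (s : ℝ) : Solves w A H (l + s • l') (ν + s • ν') := by
  intro i hi
  simp only [Pi.add_apply, Pi.smul_apply, smul_eq_mul, h i hi, h' i hi, Finset.mul_sum]
  rw [← Finset.sum_add_distrib]
  refine Finset.sum_congr rfl fun X _ => ?_
  split_ifs <;> ring

theorem solves_congr {w : I → I → ℝ} {A : Finset I} {H : Finset (Finset I)}
    {l l' : Finset I → ℝ} {ν ν' : I → ℝ} (hl : ∀ X ∈ H, l X = l' X) (hν : ∀ i ∈ A, ν i = ν' i) :
    Solves w A H l ν ↔ Solves w A H l' ν' := by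
  refine forall₂_congr fun i hi => ?_
  rw [hν i hi, Finset.sum_congr rfl fun X hX => by rw [hl X hX]]

theorem Solves.mass_eq_zero {w : I → I → ℝ} (hw : ∀ i j, w i j = -w j i) {A : Finset I}
    {H : Finset (Finset I)} (hH : IsHierarchy H A) {l : Finset I → ℝ} {ν : I → ℝ}
    (h : Solves w A H l ν) : mass ν A = 0 := by
  rw [mass, Finset.sum_congr rfl h, Finset.sum_comm]
  refine Finset.sum_eq_zero fun X hX => ?_
  rw [← Finset.sum_filter, Finset.filter_mem_eq_inter, Finset.inter_eq_right.2 (hH.subset X hX),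
    ← Finset.mul_sum]
  change l X * mass (flow w X) X = 0
  rw [mass_flow_self hw, mul_zero]

theorem solves_flow_top {w : I → I → ℝ} {A : Finset I} {H : Finset (Finset I)} (hA : A ∈ H) :
    Solves w A H (Pi.single A 1) (flow w A) := by
  intro i hi
  rw [Finset.sum_eq_single A]
  · simp [hi]
  · intro X _ hXA
    simp [hXA]
  · exact fun h => absurd hA h

/-- The moments at the other end of an edge that carries `A`, at which `B` becomes balanced. -/
def moveTo (w : I → I → ℝ) (A B : Finset I) (ν : I → ℝ) : I → ℝ :=
  ν + hitTime ν (-flow w A) B • (-flow w A)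

theorem mass_neg_flow (w : I → I → ℝ) (A B : Finset I) :
    mass (-flow w A) B = -mass (flow w A) B := by
  simpa using (massₗ B).map_neg (flow w A)

theorem mass_moveTo {w : I → I → ℝ} {A B : Finset I} (h : mass (flow w A) B ≠ 0) (ν : I → ℝ) :
    mass (moveTo w A B ν) B = 0 :=
  mass_hitTime ν (by rw [mass_neg_flow]; exact neg_ne_zero.2 h)

theorem mass_moveTo_sdiff {w : I → I → ℝ} (hw : ∀ i j, w i j = -w j i) {A B : Finset I}
    (hB : B ∈ proper A) (h : mass (flow w A) B ≠ 0) {ν : I → ℝ} (hν : mass ν A = 0) :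
    mass (moveTo w A B ν) (A \ B) = 0 := by
  rw [moveTo, mass_path_sdiff hν (by rw [mass_neg_flow, mass_flow_self hw, neg_zero]) hB,
    ← moveTo, mass_moveTo h, neg_zero]

section Join

variable {w : I → I → ℝ} {A B : Finset I} {H₁ H₂ : Finset (Finset I)}

theorem sum_join_of_mem (hB : B ∈ proper A) (h₁ : IsHierarchy H₁ B)
    (h₂ : IsHierarchy H₂ (A \ B)) (l : Finset I → ℝ) {i : I} (hi : i ∈ B) :
    (∑ X ∈ joinHierarchies A H₁ H₂, if i ∈ X then l X * flow w X i else 0) =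
      l A * flow w A i + ∑ X ∈ H₁, if i ∈ X then l X * flow w X i else 0 := by
  rw [joinHierarchies, Finset.sum_insert (top_notMem_union hB h₁ h₂),
    if_pos ((mem_proper.1 hB).1.1 hi), Finset.sum_union (disjoint_of_hierarchies h₁ h₂)]
  rw [Finset.sum_eq_zero (s := H₂), add_zero]
  intro X hX
  rw [if_neg fun hiX => (Finset.mem_sdiff.1 (h₂.subset X hX hiX)).2 hi]

/-- Lengths on a joined hierarchy realize `ν` iff the length of the root edge is the time at which
the two children become balanced, and the remaining lengths realize the moments at this time. -/
theorem solves_join_iff (hw : ∀ i j, w i j = -w j i) (hB : B ∈ proper A)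
    (h₁ : IsHierarchy H₁ B) (h₂ : IsHierarchy H₂ (A \ B)) (hne : mass (flow w A) B ≠ 0)
    {l : Finset I → ℝ} {ν : I → ℝ} :
    Solves w A (joinHierarchies A H₁ H₂) l ν ↔ l A = hitTime ν (-flow w A) B ∧
      Solves w B H₁ l (moveTo w A B ν) ∧ Solves w (A \ B) H₂ l (moveTo w A B ν) := by
  have hBB := sdiff_sdiff_of_mem_proper hB
  have hgen : Solves w A (joinHierarchies A H₁ H₂) l ν ↔
      Solves w B H₁ l (ν + l A • (-flow w A)) ∧
      Solves w (A \ B) H₂ l (ν + l A • (-flow w A)) := by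
    constructor
    · intro h
      refine ⟨fun i hi => ?_, fun i hi => ?_⟩
      · have := h i ((mem_proper.1 hB).1.1 hi)
        rw [sum_join_of_mem hB h₁ h₂ l hi] at this
        simp only [Pi.add_apply, Pi.smul_apply, Pi.neg_apply, smul_eq_mul]
        linarith
      · have := h i (Finset.sdiff_subset hi)
        rw [joinHierarchies_comm, sum_join_of_mem (sdiff_mem_proper hB) h₂ (by rwa [hBB]) l hi]
          at this
        simp only [Pi.add_apply, Pi.smul_apply, Pi.neg_apply, smul_eq_mul]
        linarith
    · rintro ⟨h1, h2⟩ i hi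
      by_cases hiB : i ∈ B
      · have := h1 i hiB
        rw [sum_join_of_mem hB h₁ h₂ l hiB]
        simp only [Pi.add_apply, Pi.smul_apply, Pi.neg_apply, smul_eq_mul] at this
        linarith
      · have hiC := Finset.mem_sdiff.2 ⟨hi, hiB⟩
        have := h2 i hiC
        rw [joinHierarchies_comm, sum_join_of_mem (sdiff_mem_proper hB) h₂ (by rwa [hBB]) l hiC]
        simp only [Pi.add_apply, Pi.smul_apply, Pi.neg_apply, smul_eq_mul] at this
        linarith
  have hne' : mass (-flow w A) B ≠ 0 := by rw [mass_neg_flow]; exact neg_ne_zero.2 hne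
  constructor
  · intro h
    have h' := hgen.1 h
    have hl := eq_hitTime hne' (h'.1.mass_eq_zero hw h₁)
    rw [hl] at h'
    exact ⟨hl, h'⟩
  · rintro ⟨hl, h'⟩
    rw [hgen, hl]
    exact h'

theorem mass_flow_pos_of_mem_positiveSplits (hw : ∀ i j, w i j = -w j i)
    (h : B ∈ positiveSplits w A) :
    0 < mass (flow w A) B := by
  obtain ⟨h1, h2⟩ := mem_positiveSplits.1 h
  rwa [mass_flow_sdiff hw (mem_proper.1 h1).1.1] at h2

/-- The moments `ν` are realized by positive lengths. -/
def Realizes (w : I → I → ℝ) (A : Finset I) (H : Finset (Finset I)) (ν : I → ℝ) : Prop :=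
  ∃ l, Solves w A H l ν ∧ ∀ X ∈ H, 0 < l X

theorem exists_splice (hB : B ∈ proper A) (h₁ : IsHierarchy H₁ B) (h₂ : IsHierarchy H₂ (A \ B))
    (τ : ℝ) (l₁ l₂ : Finset I → ℝ) : ∃ l : Finset I → ℝ,
      l A = τ ∧ (∀ X ∈ H₁, l X = l₁ X) ∧ ∀ X ∈ H₂, l X = l₂ X := by
  classical
  refine ⟨fun X => if X = A then τ else if X ∈ H₁ then l₁ X else l₂ X, if_pos rfl, ?_, ?_⟩
  · intro X hX
    have : X ≠ A := fun h => top_notMem_union hB h₁ h₂ (h ▸ Finset.mem_union_left _ hX)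
    simp [this, hX]
  · intro X hX
    have : X ≠ A := fun h => top_notMem_union hB h₁ h₂ (h ▸ Finset.mem_union_right _ hX)
    have h' : X ∉ H₁ := Finset.disjoint_right.1 (disjoint_of_hierarchies h₁ h₂) hX
    simp [this, h']

theorem realizes_join_iff (hw : ∀ i j, w i j = -w j i) (hB : B ∈ proper A)
    (h₁ : IsHierarchy H₁ B) (h₂ : IsHierarchy H₂ (A \ B)) (hne : mass (flow w A) B ≠ 0)
    {ν : I → ℝ} :
    Realizes w A (joinHierarchies A H₁ H₂) ν ↔ 0 < hitTime ν (-flow w A) B ∧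
      Realizes w B H₁ (moveTo w A B ν) ∧ Realizes w (A \ B) H₂ (moveTo w A B ν) := by
  constructor
  · rintro ⟨l, hl, hpos⟩
    obtain ⟨h0, h1, h2⟩ := (solves_join_iff hw hB h₁ h₂ hne).1 hl
    refine ⟨h0 ▸ hpos A (Finset.mem_insert_self _ _), ⟨l, h1, fun X hX => hpos X ?_⟩,
      ⟨l, h2, fun X hX => hpos X ?_⟩⟩
    · exact Finset.mem_insert_of_mem (Finset.mem_union_left _ hX)
    · exact Finset.mem_insert_of_mem (Finset.mem_union_right _ hX)
  · rintro ⟨h0, ⟨l₁, hl1, hp1⟩, l₂, hl2, hp2⟩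
    obtain ⟨l, hlA, hll1, hll2⟩ := exists_splice hB h₁ h₂ (hitTime ν (-flow w A) B) l₁ l₂
    refine ⟨l, (solves_join_iff hw hB h₁ h₂ hne).2 ⟨hlA,
      (solves_congr hll1 fun _ _ => rfl).2 hl1, (solves_congr hll2 fun _ _ => rfl).2 hl2⟩, ?_⟩
    intro X hX
    rcases Finset.mem_insert.1 hX with rfl | hX
    · rwa [hlA]
    rcases Finset.mem_union.1 hX with hX | hX
    · rw [hll1 X hX]; exact hp1 X hX
    · rw [hll2 X hX]; exact hp2 X hX

end Join

theorem IsHierarchy.eq_empty {H : Finset (Finset I)} {A : Finset I} (hH : IsHierarchy H A)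
    (hA : #A < 2) : H = ∅ := by
  refine Finset.eq_empty_of_forall_notMem fun X hX => ?_
  have h1 := hH.two_le_card X hX
  have h2 := Finset.card_le_card (hH.subset X hX)
  omega

theorem exists_split_join {w : I → I → ℝ} {A : Finset I} {H : Finset (Finset I)} (hA : 2 ≤ #A)
    (hH : H ∈ binaryHierarchies w A) : ∃ B ∈ positiveSplits w A, ∃ H₁ ∈ binaryHierarchies w B,
      ∃ H₂ ∈ binaryHierarchies w (A \ B), H = joinHierarchies A H₁ H₂ := by
  have hH' := mem_binaryHierarchies.1 hH
  have hAH := hH'.1.top_mem hA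
  obtain ⟨B, h1, h2, h3, h4⟩ := hH'.2 A hAH
  exact ⟨B, mem_positiveSplits.2 ⟨h1, h4⟩, _, restrict_mem_binaryHierarchies hH h2, _,
    restrict_mem_binaryHierarchies hH h3, (join_restrict hH'.1 h1 h2 h3 hAH).symm⟩

/-- On a binary hierarchy, balanced moments determine the lengths. -/
theorem existsUnique_solves {w : I → I → ℝ} (hw : ∀ i j, w i j = -w j i) {A : Finset I}
    (hA : A.Nonempty) {H : Finset (Finset I)} (hH : H ∈ binaryHierarchies w A) {ν : I → ℝ}
    (hν : mass ν A = 0) :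
    (∃ l, Solves w A H l ν) ∧
      ∀ l l', Solves w A H l ν → Solves w A H l' ν → ∀ X ∈ H, l X = l' X := by
  induction A using Finset.strongInduction generalizing H ν with
  | H A ih =>
    by_cases hA2 : 2 ≤ #A
    · obtain ⟨B, hB, H₁, hH₁, H₂, hH₂, rfl⟩ := exists_split_join hA2 hH
      have hpos := mass_flow_pos_of_mem_positiveSplits hw hB
      have hBA := (mem_positiveSplits.1 hB).1
      have hCA := sdiff_mem_proper hBA
      have h₁ := (mem_binaryHierarchies.1 hH₁).1
      have h₂ := (mem_binaryHierarchies.1 hH₂).1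
      obtain ⟨⟨l₁, hl₁⟩, hu₁⟩ := ih B (mem_proper.1 hBA).1 (mem_proper.1 hBA).2 hH₁
        (mass_moveTo hpos.ne' ν)
      obtain ⟨⟨l₂, hl₂⟩, hu₂⟩ := ih (A \ B) (mem_proper.1 hCA).1 (mem_proper.1 hCA).2 hH₂
        (mass_moveTo_sdiff hw hBA hpos.ne' hν)
      constructor
      · obtain ⟨l, hlA, hll1, hll2⟩ := exists_splice hBA h₁ h₂ (hitTime ν (-flow w A) B) l₁ l₂
        exact ⟨l, (solves_join_iff hw hBA h₁ h₂ hpos.ne').2 ⟨hlA,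
          (solves_congr hll1 fun _ _ => rfl).2 hl₁, (solves_congr hll2 fun _ _ => rfl).2 hl₂⟩⟩
      · intro l l' hl hl' X hX
        obtain ⟨a0, a1, a2⟩ := (solves_join_iff hw hBA h₁ h₂ hpos.ne').1 hl
        obtain ⟨b0, b1, b2⟩ := (solves_join_iff hw hBA h₁ h₂ hpos.ne').1 hl'
        rcases Finset.mem_insert.1 hX with rfl | hX
        · rw [a0, b0]
        rcases Finset.mem_union.1 hX with hX | hX
        · exact hu₁ l l' a1 b1 X hX
        · exact hu₂ l l' a2 b2 X hX
    · have hcard : #A = 1 := by have := Finset.card_pos.2 hA; omega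
      obtain rfl := (mem_binaryHierarchies.1 hH).1.eq_empty (by omega)
      obtain ⟨a, rfl⟩ := Finset.card_eq_one.1 hcard
      refine ⟨⟨0, fun i hi => ?_⟩, fun _ _ _ _ X hX => by simp at hX⟩
      rw [Finset.mem_singleton.1 hi, Finset.sum_empty]
      simpa [mass] using hν

/-- `moveTo` as a linear map. -/
def moveToₗ (w : I → I → ℝ) (A B : Finset I) : (I → ℝ) →ₗ[ℝ] (I → ℝ) :=
  LinearMap.id - ((mass (flow w A) B)⁻¹ • massₗ B).smulRight (flow w A)

theorem moveToₗ_apply (w : I → I → ℝ) (A B : Finset I) (ν : I → ℝ) :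
    moveToₗ w A B ν = moveTo w A B ν := by
  ext i
  simp [moveToₗ, moveTo, hitTime, mass_neg_flow, div_eq_inv_mul]
  ring

theorem moveTo_of_mass_eq_zero (w : I → I → ℝ) (A B : Finset I) {ν : I → ℝ} (h : mass ν B = 0) :
    moveTo w A B ν = ν := by
  simp [moveTo, hitTime, h]

theorem eventually_sub_mul_sign (a : ℝ) {b : ℝ} (hb : b ≠ 0) :
    ∀ᶠ T in Filter.atTop, a - T * b ≠ 0 ∧ (a - T * b < 0 ↔ 0 < b) := by
  filter_upwards [Filter.eventually_gt_atTop (a / b)] with T hT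
  rcases lt_or_gt_of_ne hb with h | h
  · rw [div_lt_iff_of_neg h] at hT
    exact ⟨(sub_pos.2 hT).ne', iff_of_false (by linarith) (by linarith)⟩
  · rw [div_lt_iff₀ h] at hT
    exact ⟨(sub_neg.2 hT).ne, iff_of_true (by linarith) h⟩

theorem eventually_add_smul_notMem_atTop {V : Type*} [AddCommGroup V] [Module ℝ V]
    (W : Submodule ℝ V) {ν : V} (hν : ν ∉ W) (η : V) :
    ∀ᶠ T in Filter.atTop, ν + (T : ℝ) • η ∉ W := by
  by_cases h : ∃ T₀ : ℝ, ν + T₀ • η ∈ W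
  · obtain ⟨T₀, h₀⟩ := h
    filter_upwards [Filter.eventually_gt_atTop T₀] with T hT hmem
    have h1 : (T - T₀) • η ∈ W := by
      have := W.sub_mem hmem h₀
      rwa [add_sub_add_left_eq_sub, ← sub_smul] at this
    have h2 := (W.smul_mem_iff (sub_ne_zero.2 hT.ne')).1 h1
    exact hν ((W.add_mem_iff_left (W.smul_mem T₀ h2)).1 h₀)
  · exact Filter.Eventually.of_forall fun T hT => h ⟨T, hT⟩

theorem eventually_add_smul_notMem {V : Type*} [AddCommGroup V] [Module ℝ V]
    (W : Submodule ℝ V) (ν : V) {η : V} (hη : η ∉ W) :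
    ∀ᶠ ε in 𝓝[>] (0 : ℝ), ν + ε • η ∉ W := by
  by_cases h : ∃ T₀ : ℝ, 0 < T₀ ∧ ν + T₀ • η ∈ W
  · obtain ⟨T₀, hpos, h₀⟩ := h
    filter_upwards [nhdsWithin_le_nhds (eventually_lt_nhds hpos)] with T hT hmem
    have h1 : (T - T₀) • η ∈ W := by
      have := W.sub_mem hmem h₀
      rwa [add_sub_add_left_eq_sub, ← sub_smul] at this
    exact hη ((W.smul_mem_iff (sub_ne_zero.2 hT.ne)).1 h1)
  · filter_upwards [self_mem_nhdsWithin] with T hT hmem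
    exact h ⟨T, hT, hmem⟩

/-- The attractor stability of `A`, chosen close to `-flow w A`. -/
def attractor {w : I → I → ℝ} (hw : ∀ i j, w i j = -w j i) (A : Finset I) : I → ℝ :=
  (exists_attractor w A hw).choose

/-- The coefficients whose `hn` vanishes at the attractor stabilities. -/
def attractorCoeff (t : I → I → R) {w : I → I → ℝ} (hw : ∀ i j, w i j = -w j i) :
    Finset I → R :=
  initialCoeff t fun A D => mass (attractor hw A) D < 0

open Classical in
/-- The flow tree formula: for moments outside finitely many hyperplanes, `hn` counts the binary
trees that realize the moments. Along the flow towards the attractor stability, where `hn`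
vanishes, `hn` changes only when a pair of complementary subsets becomes balanced. -/
theorem exists_hn_eq_sum_treeWeight (t : I → I → R) {w : I → I → ℝ} (hw : ∀ i j, w i j = -w j i)
    (hdeg : ∀ B C : Finset I, B.Nonempty → C.Nonempty → Disjoint B C → mass (flow w C) B = 0 →
      bracket t B C = 0) {A : Finset I} (hA : A.Nonempty) :
    ∃ 𝒮 : Set (Submodule ℝ (I → ℝ)), 𝒮.Finite ∧ (∀ W ∈ 𝒮, ¬ balancedOn A ≤ W) ∧
      ∀ ν : I → ℝ, mass ν A = 0 → (∀ W ∈ 𝒮, ν ∉ W) → (∀ D ∈ proper A, mass ν D ≠ 0) ∧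
        hn t (attractorCoeff t hw) ν A =
          ∑ H ∈ binaryHierarchies w A, if Realizes w A H ν then treeWeight t w H else 0 := by
  induction A using Finset.strongInduction with
  | H A ih =>
  by_cases hA2 : 2 ≤ #A
  swap
  · have hcard : #A = 1 := by have := Finset.card_pos.2 hA; omega
    have hprop : proper A = ∅ := by
      refine Finset.eq_empty_of_forall_notMem fun D hD => ?_
      have h1 := card_lt_of_mem_proper hD
      have h2 := Finset.card_pos.2 (mem_proper.1 hD).2
      omega
    refine ⟨∅, Set.finite_empty, by simp, fun ν hν _ => ⟨by simp [hprop], ?_⟩⟩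
    have hbin : binaryHierarchies w A = {∅} := by
      ext H
      rw [Finset.mem_singleton, mem_binaryHierarchies]
      constructor
      · exact fun h => h.1.eq_empty (by omega)
      · rintro rfl
        exact ⟨⟨by simp, by simp, fun h => by omega, by simp⟩, by simp⟩
    have hreal : Realizes w A ∅ ν := by
      refine ⟨0, fun i hi => ?_, by simp⟩
      obtain ⟨a, rfl⟩ := Finset.card_eq_one.1 hcard
      rw [Finset.mem_singleton.1 hi, Finset.sum_empty]
      simpa [mass] using hν
    rw [hbin, Finset.sum_singleton, if_pos hreal, treeWeight, Finset.prod_empty, hn, hnSum_eq,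
      hprop, Finset.sum_empty, sub_zero, attractorCoeff,
      initialCoeff_of_card_le_one t _ hcard.le]
  have ih' : ∀ B, ∃ 𝒮 : Set (Submodule ℝ (I → ℝ)), B ∈ proper A → 𝒮.Finite ∧
      (∀ W ∈ 𝒮, ¬ balancedOn B ≤ W) ∧
      ∀ ν : I → ℝ, mass ν B = 0 → (∀ W ∈ 𝒮, ν ∉ W) → (∀ D ∈ proper B, mass ν D ≠ 0) ∧
        hn t (attractorCoeff t hw) ν B =
          ∑ H ∈ binaryHierarchies w B, if Realizes w B H ν then treeWeight t w H else 0 := by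
    intro B
    by_cases hB : B ∈ proper A
    · obtain ⟨𝒮, h𝒮⟩ := ih B (mem_proper.1 hB).1 (mem_proper.1 hB).2
      exact ⟨𝒮, fun _ => h𝒮⟩
    · exact ⟨∅, fun h => absurd h hB⟩
  choose 𝒮 h𝒮 using ih'
  set P : Finset (Finset I × Finset I) := (proper A ×ˢ proper A).filter fun p =>
    p.2 ≠ p.1 ∧ p.2 ≠ A \ p.1 with hP
  -- excluded are the walls, the moments that flow into the intersection of two walls, and those
  -- that flow into excluded moments of a child of `A`
  set 𝒯 : Set (Submodule ℝ (I → ℝ)) :=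
    ((fun B : Finset I => LinearMap.ker (massₗ B)) '' (proper A)) ∪
    ((fun p : Finset I × Finset I => LinearMap.ker (massₗ p.2 ∘ₗ moveToₗ w A p.1)) '' P) ∪
    (⋃ B ∈ proper A, (fun W => W.comap (moveToₗ w A B)) '' (𝒮 B ∪ 𝒮 (A \ B))) with h𝒯
  refine ⟨𝒯, ?_, ?_, ?_⟩
  · refine ((Set.Finite.image _ (Finset.finite_toSet _)).union
      (Set.Finite.image _ (Finset.finite_toSet _))).union ?_
    refine Set.Finite.biUnion (Finset.finite_toSet _) fun B hB => Set.Finite.image _ ?_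
    exact (h𝒮 B hB).1.union (h𝒮 _ (sdiff_mem_proper hB)).1
  · rintro W ((⟨B, hB, rfl⟩ | ⟨⟨B, B'⟩, hp, rfl⟩) | hW) hle
    · obtain ⟨η, hη, h0⟩ := exists_mass_ne_zero (Finset.mem_coe.1 hB)
      exact h0 (hle hη)
    · obtain ⟨hp1, hp2, hp3⟩ := Finset.mem_filter.1 (Finset.mem_coe.1 hp)
      obtain ⟨h1, h2⟩ := Finset.mem_product.1 hp1
      obtain ⟨η, hη, h3, h4⟩ := exists_mass_eq_zero_mass_ne_zero h1 h2 hp2 hp3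
      have := hle hη
      rw [LinearMap.mem_ker, LinearMap.comp_apply, moveToₗ_apply, moveTo_of_mass_eq_zero _ _ _ h3]
        at this
      exact h4 this
    · simp only [Set.mem_iUnion] at hW
      obtain ⟨B, hB, W, hW, rfl⟩ := hW
      have hsub : ∀ D, D ⊆ A → balancedOn D ≤ balancedOn A := by
        rintro D hD η ⟨h1, h2⟩
        refine ⟨?_, fun i hi => h2 i fun h => hi (hD h)⟩
        rw [← h1, mass, mass]
        exact (Finset.sum_subset hD fun i _ hi => h2 i hi).symm
      have hfix : ∀ D, (D = B ∨ D = A \ B) → ∀ η ∈ balancedOn D, moveToₗ w A B η = η := by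
        intro D hD η hη
        rw [moveToₗ_apply]
        refine moveTo_of_mass_eq_zero _ _ _ ?_
        rcases hD with rfl | rfl
        · exact hη.1
        · exact Finset.sum_eq_zero fun i hi => hη.2 i fun h => (Finset.mem_sdiff.1 h).2 hi
      rcases hW with hW | hW
      · refine (h𝒮 B hB).2.1 W hW fun η hη => ?_
        have := hle (hsub B (mem_proper.1 hB).1.1 hη)
        rwa [Submodule.mem_comap, hfix B (Or.inl rfl) η hη] at this
      · refine (h𝒮 _ (sdiff_mem_proper hB)).2.1 W hW fun η hη => ?_
        have := hle (hsub _ Finset.sdiff_subset hη)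
        rwa [Submodule.mem_comap, hfix _ (Or.inr rfl) η hη] at this
  · intro ν hν hνW
    have hnv : ∀ D ∈ proper A, mass ν D ≠ 0 := fun D hD h0 =>
      hνW _ (Or.inl (Or.inl ⟨D, hD, rfl⟩)) h0
    refine ⟨hnv, ?_⟩
    have hmove : ∀ B ∈ proper A, ∀ B' ∈ proper A, B' ≠ B → B' ≠ A \ B →
        mass (moveTo w A B ν) B' ≠ 0 := by
      intro B hB B' hB' h1 h2 h0
      refine hνW _ (Or.inl (Or.inr ⟨(B, B'), ?_, rfl⟩)) ?_
      · exact Finset.mem_coe.2 (Finset.mem_filter.2 ⟨Finset.mem_product.2 ⟨hB, hB'⟩, h1, h2⟩)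
      · rw [LinearMap.mem_ker, LinearMap.comp_apply, moveToₗ_apply]
        exact h0
    have hηA : mass (-flow w A) A = 0 := by rw [mass_neg_flow, mass_flow_self hw, neg_zero]
    have hpm : ∀ T D, mass (ν + T • -flow w A) D = mass ν D - T * mass (flow w A) D := by
      intro T D
      rw [mass_add_smul, mass_neg_flow]
      ring
    -- a time after all crossings
    obtain ⟨T, hT0, hT1, hT2⟩ : ∃ T : ℝ, 0 < T ∧
        (∀ B ∈ proper A, hitTime ν (-flow w A) B < T) ∧
        ∀ D ∈ proper A, mass (flow w A) D ≠ 0 → mass ν D - T * mass (flow w A) D ≠ 0 ∧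
          (mass ν D - T * mass (flow w A) D < 0 ↔ 0 < mass (flow w A) D) := by
      have e1 : ∀ᶠ T : ℝ in Filter.atTop, ∀ B ∈ proper A, hitTime ν (-flow w A) B < T := by
        rw [Filter.eventually_all_finset]
        exact fun B _ => Filter.eventually_gt_atTop _
      have e2 : ∀ᶠ T : ℝ in Filter.atTop, ∀ D ∈ proper A, mass (flow w A) D ≠ 0 →
          mass ν D - T * mass (flow w A) D ≠ 0 ∧
          (mass ν D - T * mass (flow w A) D < 0 ↔ 0 < mass (flow w A) D) := by
        rw [Filter.eventually_all_finset]
        intro D _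
        by_cases h : mass (flow w A) D = 0
        · exact Filter.Eventually.of_forall fun _ h' => absurd h h'
        · filter_upwards [eventually_sub_mul_sign (mass ν D) h] with T hT _
          exact hT
      exact ((Filter.eventually_gt_atTop 0).and (e1.and e2)).exists
    have hnvT : ∀ D ∈ proper A, mass (ν + T • -flow w A) D ≠ 0 := by
      intro D hD
      rw [hpm]
      by_cases h : mass (flow w A) D = 0
      · rw [h, mul_zero, sub_zero]
        exact hnv D hD
      · exact (hT2 D hD h).1
    have hpath := hn_sub_hn_of_path t (attractorCoeff t hw) hA (θ := ν) (η := -flow w A)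
      (s₀ := 0) (s₁ := T) hν hηA hT0 (by simpa using hnv) hnvT (by
        intro s _ _ B hB B' hB' h1 h2
        by_contra hcon
        push Not at hcon
        have hne : mass (-flow w A) B ≠ 0 := by
          intro h0
          rw [mass_add_smul, h0, mul_zero, add_zero] at h1
          exact hnv B hB h1
        rw [eq_hitTime hne h1] at h2
        exact hmove B hB B' hB' hcon.1 hcon.2 h2)
    -- the flow ends in the chamber of the attractor stability
    have hatt := (exists_attractor w A hw).choose_spec
    have hend : hn t (attractorCoeff t hw) (ν + T • -flow w A) A = 0 := by
      rw [hn_eq_of_sign_iff t (attractorCoeff t hw) hw hdeg hA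
        (θ' := attractor hw A) (by rw [hpm, hν, mass_flow_self hw]; ring) hatt.1 hnvT hatt.2.1]
      · exact hnSum_initialCoeff t (fun A D => mass (attractor hw A) D < 0) hA2
      · intro D hD hne
        rw [hpm, (hT2 D hD hne).2]
        exact (hatt.2.2 D hD hne).symm
    rw [zero_smul, add_zero, hend, sub_zero] at hpath
    have hcr : crossings ν (-flow w A) A 0 T = (positiveSplits w A).filter
        fun B => 0 < hitTime ν (-flow w A) B := by
      ext B
      rw [mem_crossings, Finset.mem_filter, mem_positiveSplits]
      constructor
      · rintro ⟨h1, h2, h3, -⟩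
        refine ⟨⟨h1, ?_⟩, h3⟩
        rw [mass_flow_sdiff hw (mem_proper.1 h1).1.1]
        rw [mass_neg_flow] at h2
        linarith
      · rintro ⟨⟨h1, h2⟩, h3⟩
        rw [mass_flow_sdiff hw (mem_proper.1 h1).1.1] at h2
        refine ⟨h1, ?_, h3, hT1 B h1⟩
        rw [mass_neg_flow]
        linarith
    rw [hpath, hcr, sum_binaryHierarchies hw hA2, Finset.sum_filter]
    refine Finset.sum_congr rfl fun B hB => ?_
    have hBA := (mem_positiveSplits.1 hB).1
    have hCA := sdiff_mem_proper hBA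
    have hpos := mass_flow_pos_of_mem_positiveSplits hw hB
    have hB1 := ((h𝒮 B hBA).2.2 (moveTo w A B ν) (mass_moveTo hpos.ne' ν) (by
      intro W hW hmem
      refine hνW (W.comap (moveToₗ w A B)) (Or.inr ?_) ?_
      · simp only [Set.mem_iUnion]
        exact ⟨B, hBA, W, Or.inl hW, rfl⟩
      · rw [Submodule.mem_comap, moveToₗ_apply]
        exact hmem)).2
    have hC1 := ((h𝒮 _ hCA).2.2 (moveTo w A B ν) (mass_moveTo_sdiff hw hBA hpos.ne' hν) (by
      intro W hW hmem
      refine hνW (W.comap (moveToₗ w A B)) (Or.inr ?_) ?_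
      · simp only [Set.mem_iUnion]
        exact ⟨B, hBA, W, Or.inr hW, rfl⟩
      · rw [Submodule.mem_comap, moveToₗ_apply]
        exact hmem)).2
    rw [Finset.sum_product]
    have hterm : ∀ H₁ ∈ binaryHierarchies w B, ∀ H₂ ∈ binaryHierarchies w (A \ B),
        (if Realizes w A (joinHierarchies A H₁ H₂) ν then
          treeWeight t w (joinHierarchies A H₁ H₂) else 0) =
        if 0 < hitTime ν (-flow w A) B then bracket t B (A \ B) *
          (if Realizes w B H₁ (moveTo w A B ν) then treeWeight t w H₁ else 0) *
          (if Realizes w (A \ B) H₂ (moveTo w A B ν) then treeWeight t w H₂ else 0) else 0 := by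
      intro H₁ hH₁ H₂ hH₂
      have h₁ := (mem_binaryHierarchies.1 hH₁).1
      have h₂ := (mem_binaryHierarchies.1 hH₂).1
      rw [treeWeight_join hw t hBA h₁ h₂ (mem_positiveSplits.1 hB).2]
      simp only [realizes_join_iff hw hBA h₁ h₂ hpos.ne']
      by_cases h0 : 0 < hitTime ν (-flow w A) B <;>
        by_cases h1 : Realizes w B H₁ (moveTo w A B ν) <;>
        by_cases h2 : Realizes w (A \ B) H₂ (moveTo w A B ν) <;> simp [h0, h1, h2]
    rw [Finset.sum_congr rfl fun H₁ hH₁ => Finset.sum_congr rfl fun H₂ hH₂ =>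
      hterm H₁ hH₁ H₂ hH₂]
    by_cases h0 : 0 < hitTime ν (-flow w A) B
    · simp only [h0, if_true]
      simp only [← Finset.mul_sum, ← Finset.sum_mul]
      rw [← hB1, ← hC1]
      rfl
    · simp [h0]

end

/-! ### Independence of the moments -/

section

open Topology

variable {I R : Type*} [DecidableEq I] [CommRing R]

/-- The moments `ν` are realized by lengths that are positive except possibly for that of the
unbounded root edge. -/
def RootRealizes (w : I → I → ℝ) (A : Finset I) (H : Finset (Finset I)) (ν : I → ℝ) : Prop :=
  ∃ l, Solves w A H l ν ∧ ∀ X ∈ H, X ≠ A → 0 < l X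

open Classical in
/-- The weighted number of binary trees with an unbounded root edge that realize the moments does
not depend on the moments, as long as no degenerate tree realizes them: after a perturbation and a
translation of the origin far up the root edge, `exists_hn_eq_sum_treeWeight` expresses it as the
`hn` of the stability opposite to the attractor. -/
theorem exists_sum_treeWeight_eq (t : I → I → R) {w : I → I → ℝ} (hw : ∀ i j, w i j = -w j i)
    (hdeg : ∀ B C : Finset I, B.Nonempty → C.Nonempty → Disjoint B C → mass (flow w C) B = 0 →
      bracket t B C = 0) {A : Finset I} (hA : 2 ≤ #A) :
    ∃ G : R, ∀ ν : I → ℝ, mass ν A = 0 →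
      (∀ H ∈ binaryHierarchies w A, ∀ l, Solves w A H l ν → (∀ X ∈ H, X ≠ A → 0 ≤ l X) →
        ∀ X ∈ H, X ≠ A → 0 < l X) →
      ∑ H ∈ binaryHierarchies w A, (if RootRealizes w A H ν then treeWeight t w H else 0) = G := by
  have hAn : A.Nonempty := Finset.card_pos.1 (by omega)
  obtain ⟨𝒮, hfin, hprop, hflow⟩ := exists_hn_eq_sum_treeWeight t hw hdeg hAn
  have hatt := (exists_attractor w A hw).choose_spec
  have hneg : ∀ D, mass (-attractor hw A) D = -mass (attractor hw A) D := fun D => by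
    simpa using (massₗ D).map_neg (attractor hw A)
  have hAH : ∀ H ∈ binaryHierarchies w A, A ∈ H := fun H hH =>
    (mem_binaryHierarchies.1 hH).1.top_mem hA
  -- moments outside the exceptional subspaces
  have key : ∀ ν : I → ℝ, mass ν A = 0 → (∀ W ∈ 𝒮, ν ∉ W) →
      ∑ H ∈ binaryHierarchies w A, (if RootRealizes w A H ν then treeWeight t w H else 0) =
        hn t (attractorCoeff t hw) (-attractor hw A) A := by
    intro ν hν hν𝒮
    have hex : ∀ H, ∃ l, H ∈ binaryHierarchies w A → Solves w A H l ν := by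
      intro H
      by_cases hH : H ∈ binaryHierarchies w A
      · obtain ⟨l, hl⟩ := (existsUnique_solves hw hAn hH hν).1
        exact ⟨l, fun _ => hl⟩
      · exact ⟨0, fun h => absurd h hH⟩
    choose l hl using hex
    -- far up the root edge, its length is positive and the stability is opposite to the attractor
    have e1 : ∀ᶠ T : ℝ in Filter.atTop, ∀ W ∈ 𝒮, ν + T • flow w A ∉ W := by
      rw [Filter.eventually_all_finite hfin]
      exact fun W hW => eventually_add_smul_notMem_atTop W (hν𝒮 W hW) _
    have e2 : ∀ᶠ T : ℝ in Filter.atTop, ∀ H ∈ binaryHierarchies w A, 0 < l H A + T := by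
      rw [Filter.eventually_all_finset]
      intro H _
      filter_upwards [Filter.eventually_gt_atTop (-l H A)] with T hT
      linarith
    have e3 : ∀ᶠ T : ℝ in Filter.atTop, ∀ D ∈ proper A, mass (flow w A) D ≠ 0 →
        (mass ν D + T * mass (flow w A) D < 0 ↔ mass (flow w A) D < 0) := by
      rw [Filter.eventually_all_finset]
      intro D _
      by_cases h : mass (flow w A) D = 0
      · exact Filter.Eventually.of_forall fun _ h' => absurd h h'
      · filter_upwards [eventually_sub_mul_sign (mass ν D) (neg_ne_zero.2 h)] with T hT _
        simpa only [mul_neg, sub_neg_eq_add, neg_pos] using hT.2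
    obtain ⟨T, h1, h2, h3⟩ := (e1.and (e2.and e3)).exists
    have hmT : ∀ D, mass (ν + T • flow w A) D = mass ν D + T * mass (flow w A) D :=
      fun D => mass_add_smul _ _ _ _
    have hνT : mass (ν + T • flow w A) A = 0 := by rw [hmT, hν, mass_flow_self hw]; ring
    obtain ⟨hnv, hsum⟩ := hflow _ hνT h1
    rw [← hn_eq_of_sign_iff t (attractorCoeff t hw) hw hdeg hAn (θ := ν + T • flow w A) hνT
      (by rw [hneg]; exact neg_eq_zero.2 hatt.1) hnv
      (by intro D hD; rw [hneg]; exact neg_ne_zero.2 (hatt.2.1 D hD)), hsum]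
    · refine Finset.sum_congr rfl fun H hH => if_congr ?_ rfl rfl
      have hs := (hl H hH).add_smul (solves_flow_top (hAH H hH)) T
      have hu := (existsUnique_solves hw hAn hH hν).2
      have hu' := (existsUnique_solves hw hAn hH hνT).2
      constructor
      · rintro ⟨l', hl', hpos⟩
        refine ⟨_, hs, fun X hX => ?_⟩
        by_cases hXA : X = A
        · subst hXA
          simpa using h2 H hH
        · have := hpos X hX hXA
          rw [hu _ _ hl' (hl H hH) X hX] at this
          simpa [hXA] using this
      · rintro ⟨l', hl', hpos⟩
        refine ⟨_, hl H hH, fun X hX hXA => ?_⟩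
        have := hpos X hX
        rw [hu' _ _ hl' hs X hX] at this
        simpa [hXA] using this
    · intro D hD hne
      have h5 := hatt.2.2 D hD hne
      have h6 := hatt.2.1 D hD
      rw [hmT, h3 D hD hne, hneg, neg_lt_zero]
      change mass (attractor hw A) D < 0 ↔ _ at h5
      change mass (attractor hw A) D ≠ 0 at h6
      constructor
      · intro h
        by_contra h'
        exact lt_asymm h (h5.1 (lt_of_le_of_ne (not_lt.1 h') h6))
      · intro h
        by_contra h'
        exact lt_asymm h (h5.2 (lt_of_le_of_ne (not_lt.1 h') hne.symm))
  refine ⟨hn t (attractorCoeff t hw) (-attractor hw A) A, fun ν hν hgen => ?_⟩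
  -- a perturbation that leaves the exceptional subspaces realizes the same trees
  obtain ⟨η, hηA, hη⟩ := exists_mem_forall_notMem hfin (balancedOn A) hprop
  have hex : ∀ H, ∃ l k, H ∈ binaryHierarchies w A → Solves w A H l ν ∧ Solves w A H k η := by
    intro H
    by_cases hH : H ∈ binaryHierarchies w A
    · obtain ⟨l, hl⟩ := (existsUnique_solves hw hAn hH hν).1
      obtain ⟨k, hk⟩ := (existsUnique_solves hw hAn hH hηA.1).1
      exact ⟨l, k, fun _ => ⟨hl, hk⟩⟩
    · exact ⟨0, 0, fun h => absurd h hH⟩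
  choose l k hlk using hex
  have e1 : ∀ᶠ ε in 𝓝[>] (0 : ℝ), ∀ W ∈ 𝒮, ν + ε • η ∉ W := by
    rw [Filter.eventually_all_finite hfin]
    exact fun W hW => eventually_add_smul_notMem W ν (hη W hW)
  have e2 : ∀ᶠ ε in 𝓝[>] (0 : ℝ), ∀ H ∈ binaryHierarchies w A, ∀ X ∈ H,
      (0 < l H X → 0 < l H X + ε * k H X) ∧ (l H X < 0 → l H X + ε * k H X < 0) := by
    rw [Filter.eventually_all_finset]
    intro H _
    rw [Filter.eventually_all_finset]
    intro X _
    refine Filter.Eventually.and ?_ ?_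
    · by_cases h : 0 < l H X
      · filter_upwards [eventually_add_mul_pos h (k H X)] with ε hε _ using hε
      · exact Filter.Eventually.of_forall fun _ h' => absurd h' h
    · by_cases h : l H X < 0
      · filter_upwards [eventually_add_mul_neg h (k H X)] with ε hε _ using hε
      · exact Filter.Eventually.of_forall fun _ h' => absurd h' h
  obtain ⟨ε, h1, h2⟩ := (e1.and e2).exists
  have hνε : mass (ν + ε • η) A = 0 := by rw [mass_add_smul, hν, hηA.1]; ring
  rw [← key _ hνε h1]
  refine Finset.sum_congr rfl fun H hH => if_congr ?_ rfl rfl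
  obtain ⟨hl, hk⟩ := hlk H hH
  have hs := hl.add_smul hk ε
  have hu := (existsUnique_solves hw hAn hH hν).2
  have hu' := (existsUnique_solves hw hAn hH hνε).2
  constructor
  · rintro ⟨l', hl', hpos⟩
    refine ⟨_, hs, fun X hX hXA => ?_⟩
    have := hpos X hX hXA
    rw [hu _ _ hl' hl X hX] at this
    exact (h2 H hH X hX).1 this
  · rintro ⟨l', hl', hpos⟩
    refine ⟨_, hl, hgen H hH _ hl fun X hX hXA => ?_⟩
    have := hpos X hX hXA
    rw [hu' _ _ hl' hs X hX] at this
    by_contra hlt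
    exact lt_asymm this ((h2 H hH X hX).2 (not_le.1 hlt))

end

/-! ### Parents and children in a hierarchy -/

section

section Children

variable {I : Type*} [DecidableEq I] [Fintype I]

theorem IsHierarchy.exists_least {H : Finset (Finset I)} (hI : 2 ≤ Fintype.card I)
    (hH : IsHierarchy H univ) {X : Finset I} (hX : X.Nonempty) (hX' : X ≠ univ) :
    ∃ M ∈ H, X ⊂ M ∧ ∀ Y ∈ H, X ⊂ Y → M ⊆ Y := by
  classical
  have huniv : univ ∈ H := hH.top_mem (by rwa [Finset.card_univ])
  obtain ⟨M, hM, hmin⟩ := Finset.exists_min_image (H.filter (X ⊂ ·)) Finset.card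
    ⟨univ, Finset.mem_filter.2 ⟨huniv, Finset.ssubset_univ_iff.2 hX'⟩⟩
  obtain ⟨hMH, hXM⟩ := Finset.mem_filter.1 hM
  refine ⟨M, hMH, hXM, fun Y hY hXY => ?_⟩
  obtain ⟨x, hx⟩ := hX
  rcases hH.laminar M hMH Y hY with h | h | h
  · exact h
  · exact (Finset.eq_of_subset_of_card_le h (hmin Y (Finset.mem_filter.2 ⟨hY, hXY⟩))).ge
  · exact absurd (hXY.1 hx) (Finset.disjoint_left.1 h (hXM.1 hx))

open Classical in
/-- The parent of a node `X`: the smallest cluster of `H` that strictly contains `X`. By convention,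
`univ` is its own parent. -/
def up (H : Finset (Finset I)) (X : Finset I) : Finset I :=
  if h : ∃ M ∈ H, X ⊂ M ∧ ∀ Y ∈ H, X ⊂ Y → M ⊆ Y then h.choose else univ

theorem up_spec {H : Finset (Finset I)} (hI : 2 ≤ Fintype.card I)
    (hH : IsHierarchy H univ) {X : Finset I} (hX : X.Nonempty) (hX' : X ≠ univ) :
    up H X ∈ H ∧ X ⊂ up H X ∧ ∀ Y ∈ H, X ⊂ Y → up H X ⊆ Y := by
  have h := hH.exists_least hI hX hX'
  rw [up, dif_pos h]
  exact h.choose_spec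

theorem up_eq {H : Finset (Finset I)} {X M : Finset I} (hM : M ∈ H) (hXM : X ⊂ M)
    (h : ∀ Y ∈ H, X ⊂ Y → M ⊆ Y) : up H X = M := by
  have hex : ∃ M ∈ H, X ⊂ M ∧ ∀ Y ∈ H, X ⊂ Y → M ⊆ Y := ⟨M, hM, hXM, h⟩
  rw [up, dif_pos hex]
  obtain ⟨h1, h2, h3⟩ := hex.choose_spec
  exact subset_antisymm (h3 M hM hXM) (h _ h1 h2)

theorem singleton_ne_univ (hI : 2 ≤ Fintype.card I) (i : I) : ({i} : Finset I) ≠ univ := by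
  intro h
  have := congrArg Finset.card h
  rw [Finset.card_singleton, Finset.card_univ] at this
  omega

/-- The nodes of a hierarchy. -/
def nodes (H : Finset (Finset I)) : Finset (Finset I) := H ∪ univ.image singleton

theorem mem_nodes {H : Finset (Finset I)} {X : Finset I} : X ∈ nodes H ↔ IsNode H X := by
  simp only [nodes, IsNode, Finset.mem_union, Finset.mem_image, Finset.mem_univ, true_and,
    Finset.card_eq_one, eq_comm]

/-- The children of a cluster. -/
def children (H : Finset (Finset I)) (A : Finset I) : Finset (Finset I) :=
  (nodes H).filter fun X => X ≠ univ ∧ up H X = A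

theorem mem_children {H : Finset (Finset I)} {A X : Finset I} :
    X ∈ children H A ↔ IsNode H X ∧ X ≠ univ ∧ up H X = A := by
  rw [children, Finset.mem_filter, mem_nodes]

variable {H : Finset (Finset I)} {A B X Y : Finset I}

theorem ssubset_of_mem_children (hI : 2 ≤ Fintype.card I) (hH : IsHierarchy H univ)
    (hX : X ∈ children H A) : X ⊂ A := by
  obtain ⟨h1, h2, rfl⟩ := mem_children.1 hX
  exact (up_spec hI hH (h1.nonempty hH) h2).2.1

theorem pairwiseDisjoint_children (hI : 2 ≤ Fintype.card I) (hH : IsHierarchy H univ)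
    (A : Finset I) : (children H A : Set (Finset I)).PairwiseDisjoint id := by
  have aux : ∀ X ∈ children H A, ∀ Y ∈ children H A, X ≠ Y → ¬ X ⊆ Y := by
    intro X hX Y hY hne hXY
    have hXY := hXY.ssubset_of_ne hne
    obtain ⟨h1, h2, h3⟩ := mem_children.1 hX
    have hXn := h1.nonempty hH
    have hYH : Y ∈ H := by
      rcases (mem_children.1 hY).1 with h | h
      · exact h
      · have e1 := Finset.card_lt_card hXY
        have e2 := Finset.card_pos.2 hXn
        omega
    have := (up_spec hI hH hXn h2).2.2 Y hYH hXY
    rw [h3] at this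
    exact (ssubset_of_mem_children hI hH hY).2 this
  intro X hX Y hY hne
  rcases hH.node_laminar (mem_children.1 hX).1 (mem_children.1 hY).1 with h | h | h
  · exact absurd h (aux X hX Y hY hne)
  · exact absurd h (aux Y hY X hX hne.symm)
  · exact h

theorem exists_mem_children (hI : 2 ≤ Fintype.card I) (hH : IsHierarchy H univ) (hA : A ∈ H)
    {i : I} (hi : i ∈ A) : ∃ X ∈ children H A, i ∈ X := by
  classical
  have hcard := hH.two_le_card A hA
  have hsing : ({i} : Finset I) ⊂ A := by
    refine (Finset.singleton_subset_iff.2 hi).ssubset_of_ne fun h => ?_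
    rw [← h, Finset.card_singleton] at hcard
    omega
  obtain ⟨X, hX, hmax⟩ := Finset.exists_max_image
    ((nodes H).filter fun X => i ∈ X ∧ X ⊂ A) Finset.card
    ⟨{i}, Finset.mem_filter.2 ⟨mem_nodes.2 (Or.inr (Finset.card_singleton i)),
      Finset.mem_singleton_self i, hsing⟩⟩
  obtain ⟨hXn, hiX, hXA⟩ := Finset.mem_filter.1 hX
  have hXu : X ≠ univ := fun h => hXA.2 (h ▸ Finset.subset_univ A)
  refine ⟨X, mem_children.2 ⟨mem_nodes.1 hXn, hXu, ?_⟩, hiX⟩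
  obtain ⟨h1, h2, h3⟩ := up_spec hI hH ⟨i, hiX⟩ hXu
  by_contra hne
  have h4 := (h3 A hA hXA).ssubset_of_ne hne
  have := hmax (up H X) (Finset.mem_filter.2 ⟨mem_nodes.2 (Or.inl h1), h2.1 hiX, h4⟩)
  have := Finset.card_lt_card h2
  omega

theorem biUnion_children (hI : 2 ≤ Fintype.card I) (hH : IsHierarchy H univ) (hA : A ∈ H) :
    (children H A).biUnion id = A := by
  ext i
  rw [Finset.mem_biUnion]
  constructor
  · rintro ⟨X, hX, hi⟩
    exact (ssubset_of_mem_children hI hH hX).1 hi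
  · exact exists_mem_children hI hH hA

theorem sum_children {M : Type*} [AddCommMonoid M] (hI : 2 ≤ Fintype.card I)
    (hH : IsHierarchy H univ) (hA : A ∈ H) (f : I → M) :
    ∑ X ∈ children H A, ∑ i ∈ X, f i = ∑ i ∈ A, f i := by
  conv_rhs => rw [← biUnion_children hI hH hA]
  rw [Finset.sum_biUnion (pairwiseDisjoint_children hI hH A)]
  rfl

theorem two_le_card_children (hI : 2 ≤ Fintype.card I) (hH : IsHierarchy H univ) (hA : A ∈ H) :
    2 ≤ #(children H A) := by
  by_contra hlt
  have hcard := hH.two_le_card A hA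
  have hU := biUnion_children hI hH hA
  have : #(children H A) = 0 ∨ #(children H A) = 1 := by omega
  rcases this with h | h
  · rw [Finset.card_eq_zero.1 h] at hU
    rw [← hU] at hcard
    simp at hcard
  · obtain ⟨X, hX⟩ := Finset.card_eq_one.1 h
    rw [hX, Finset.singleton_biUnion] at hU
    exact (ssubset_of_mem_children hI hH (hX ▸ Finset.mem_singleton_self X)).ne hU

theorem up_eq_of_split (hH : IsHierarchy H univ) (hA : A ∈ H)
    (hBA : B ∈ proper A) (hC : IsNode H (A \ B)) : up H B = A := by
  refine up_eq hA (mem_proper.1 hBA).1 fun Y hY hBY => ?_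
  obtain ⟨b, hb⟩ := (mem_proper.1 hBA).2
  obtain ⟨c, hc⟩ := (mem_proper.1 (sdiff_mem_proper hBA)).2
  rcases hH.laminar A hA Y hY with h | h | h
  · exact h
  · rcases hH.node_laminar (Or.inl hY) hC with h' | h' | h'
    · exact absurd hb (Finset.mem_sdiff.1 (h' (hBY.1 hb))).2
    · rw [← union_sdiff_of_mem_proper hBA]
      exact Finset.union_subset hBY.1 h'
    · refine absurd (fun y hy => ?_) hBY.2
      by_contra hyB
      exact Finset.disjoint_left.1 h' hy (Finset.mem_sdiff.2 ⟨h hy, hyB⟩)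
  · exact absurd (hBY.1 hb) (Finset.disjoint_left.1 h ((mem_proper.1 hBA).1.1 hb))

theorem children_eq_of_split (hI : 2 ≤ Fintype.card I) (hH : IsHierarchy H univ) (hA : A ∈ H)
    (hBA : B ∈ proper A) (hB : IsNode H B) (hC : IsNode H (A \ B)) :
    children H A = {B, A \ B} := by
  have hCA := sdiff_mem_proper hBA
  have hBB := sdiff_sdiff_of_mem_proper hBA
  have hne : ∀ D ∈ proper A, D ≠ univ := fun D hD h =>
    (mem_proper.1 hD).1.2 (h ▸ Finset.subset_univ A)
  have h1 : B ∈ children H A := mem_children.2 ⟨hB, hne B hBA, up_eq_of_split hH hA hBA hC⟩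
  have h2 : A \ B ∈ children H A := mem_children.2 ⟨hC, hne _ hCA,
    up_eq_of_split hH hA hCA (by rwa [hBB])⟩
  ext X
  rw [Finset.mem_insert, Finset.mem_singleton]
  constructor
  · intro hX
    by_contra hcon
    push Not at hcon
    obtain ⟨x, hx⟩ := (mem_children.1 hX).1.nonempty hH
    have hxA := (ssubset_of_mem_children hI hH hX).1 hx
    by_cases hxB : x ∈ B
    · exact Finset.disjoint_left.1 (pairwiseDisjoint_children hI hH A hX h1 hcon.1) hx hxB
    · exact Finset.disjoint_left.1 (pairwiseDisjoint_children hI hH A hX h2 hcon.2) hx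
        (Finset.mem_sdiff.2 ⟨hxA, hxB⟩)
  · rintro (rfl | rfl)
    · exact h1
    · exact h2

theorem exists_split_of_card_children (hI : 2 ≤ Fintype.card I) (hH : IsHierarchy H univ)
    (hA : A ∈ H) (h : #(children H A) = 2) :
    ∃ B ∈ proper A, IsNode H B ∧ IsNode H (A \ B) := by
  obtain ⟨B, C, hne, hBC⟩ := Finset.card_eq_two.1 h
  have hB : B ∈ children H A := by simp [hBC]
  have hC : C ∈ children H A := by simp [hBC]
  have hdis : Disjoint B C := pairwiseDisjoint_children hI hH A hB hC hne
  have hU := biUnion_children hI hH hA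
  rw [hBC, Finset.biUnion_insert, Finset.singleton_biUnion] at hU
  have hU : B ∪ C = A := hU
  have hCeq : A \ B = C := by rw [← hU, Finset.union_sdiff_cancel_left hdis]
  refine ⟨B, mem_proper.2 ⟨ssubset_of_mem_children hI hH hB,
    (mem_children.1 hB).1.nonempty hH⟩, (mem_children.1 hB).1, ?_⟩
  rw [hCeq]
  exact (mem_children.1 hC).1

/-- Every node except the root is the child of exactly one cluster. -/
theorem sum_card_children (hI : 2 ≤ Fintype.card I) (hH : IsHierarchy H univ) :
    ∑ A ∈ H, #(children H A) + 1 = #H + Fintype.card I := by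
  have huniv : univ ∈ H := hH.top_mem (by rwa [Finset.card_univ])
  have h1 : #((nodes H).erase univ) = ∑ A ∈ H, #(children H A) := by
    rw [Finset.card_eq_sum_card_fiberwise (f := up H) (t := H)]
    · refine Finset.sum_congr rfl fun A _ => congrArg Finset.card ?_
      ext X
      simp only [Finset.mem_filter, Finset.mem_erase, mem_children, mem_nodes]
      tauto
    · intro X hX
      obtain ⟨hX1, hX2⟩ := Finset.mem_erase.1 (Finset.mem_coe.1 hX)
      exact (up_spec hI hH ((mem_nodes.1 hX2).nonempty hH) hX1).1
  have h2 : #(nodes H) = #H + Fintype.card I := by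
    rw [nodes, Finset.card_union_of_disjoint, Finset.card_image_of_injective _
      Finset.singleton_injective, Finset.card_univ]
    rw [Finset.disjoint_right]
    rintro X hX hXH
    obtain ⟨i, -, rfl⟩ := Finset.mem_image.1 hX
    have := hH.two_le_card _ hXH
    rw [Finset.card_singleton] at this
    omega
  rw [← h1, Finset.card_erase_add_one (mem_nodes.2 (Or.inl huniv)), h2]

theorem card_hierarchy_lt (hI : 2 ≤ Fintype.card I) (hH : IsHierarchy H univ) :
    #H + 1 ≤ Fintype.card I := by
  have h1 := sum_card_children hI hH
  have h2 : ∑ _A ∈ H, 2 ≤ ∑ A ∈ H, #(children H A) :=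
    Finset.sum_le_sum fun A hA => two_le_card_children hI hH hA
  rw [Finset.sum_const, smul_eq_mul] at h2
  omega

/-- A hierarchy has the maximal number of clusters iff each cluster has two children. -/
theorem card_hierarchy_eq_iff (hI : 2 ≤ Fintype.card I) (hH : IsHierarchy H univ) :
    #H + 1 = Fintype.card I ↔ ∀ A ∈ H, #(children H A) = 2 := by
  have h1 := sum_card_children hI hH
  constructor
  · intro h
    have h2 : ∑ _A ∈ H, 2 = ∑ A ∈ H, #(children H A) := by
      rw [Finset.sum_const, smul_eq_mul]
      omega
    have := (Finset.sum_eq_sum_iff_of_le fun A hA => two_le_card_children hI hH hA).1 h2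
    exact fun A hA => (this A hA).symm
  · intro h
    rw [Finset.sum_congr rfl h, Finset.sum_const, smul_eq_mul] at h1
    omega

end Children

end

/-! ### Rooted trees -/

section

/-- `par` maps each vertex of `G` different from `r` to the next vertex on the path to `r`, and `r`
to itself. The rank, which decreases along `par`, makes `G` a tree. -/
structure IsParentMap {V : Type*} (G : SimpleGraph V) (r : V) (par : V → V) (rk : V → ℕ) :
    Prop where
  adj_iff : ∀ v w, G.Adj v w ↔ (v ≠ r ∧ par v = w) ∨ (w ≠ r ∧ par w = v)
  rk_lt : ∀ v, v ≠ r → rk (par v) < rk v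
  par_root : par r = r

theorem exists_isParentMap {V : Type*} {G : SimpleGraph V} (hG : G.IsTree) (r : V) :
    ∃ par, IsParentMap G r par (G.dist r) := by
  classical
  have hex : ∀ v, ∃ w, (v ≠ r → G.Adj v w ∧ G.dist r w < G.dist r v) ∧ (v = r → w = r) := by
    intro v
    by_cases hv : v = r
    · exact ⟨v, fun h => absurd hv h, id⟩
    obtain ⟨p, hp⟩ := hG.connected.exists_walk_length_eq_dist v r
    cases p with
    | nil => exact absurd rfl hv
    | cons h q =>
      rename_i w
      refine ⟨w, fun _ => ⟨h, ?_⟩, fun h => absurd h hv⟩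
      rw [G.dist_comm, G.dist_comm (u := r), ← hp, SimpleGraph.Walk.length_cons]
      exact Nat.lt_succ_of_le (SimpleGraph.dist_le q)
  choose par hpar hparr using hex
  have huniq : ∀ v w w', G.Adj v w → G.Adj v w' → G.dist r w < G.dist r v →
      G.dist r w' < G.dist r v → w = w' := by
    have hpath : ∀ v w, G.Adj v w → G.dist r w < G.dist r v →
        ∃ (h : G.Adj v w) (q : G.Walk w r), (SimpleGraph.Walk.cons h q).IsPath := by
      intro v w h hlt
      obtain ⟨q, hq, hql⟩ := hG.connected.exists_path_of_dist w r
      refine ⟨h, q, hq.cons fun hv => ?_⟩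
      have h1 := SimpleGraph.dist_le (q.dropUntil v hv)
      have h2 := q.length_dropUntil_le_length hv
      rw [G.dist_comm (u := r), G.dist_comm (u := r)] at hlt
      omega
    intro v w w' h h' hlt hlt'
    obtain ⟨h, q, hq⟩ := hpath v w h hlt
    obtain ⟨h', q', hq'⟩ := hpath v w' h' hlt'
    have := (hG.existsUnique_path v r).unique hq hq'
    exact (SimpleGraph.Walk.cons.injEq .. ▸ this).1
  refine ⟨par, fun v w => ⟨fun h => ?_, ?_⟩, fun v hv => (hpar v hv).2,
    hparr r rfl⟩
  · have key : ∀ v w, G.Adj v w → G.dist r w < G.dist r v → v ≠ r ∧ par v = w := by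
      intro v w h hlt
      have hv : v ≠ r := by
        rintro rfl
        rw [G.dist_self] at hlt
        omega
      exact ⟨hv, huniq v _ _ (hpar v hv).1 h (hpar v hv).2 hlt⟩
    rcases lt_or_gt_of_ne (hG.dist_ne_of_adj r h) with hlt | hlt
    · exact Or.inr (key w v h.symm hlt)
    · exact Or.inl (key v w h hlt)
  · rintro (⟨hv, rfl⟩ | ⟨hw, rfl⟩)
    · exact (hpar v hv).1
    · exact (hpar w hw).1.symm

namespace IsParentMap

variable {V : Type*} {G : SimpleGraph V} {r : V} {par : V → V} {rk : V → ℕ}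

theorem adj_par (h : IsParentMap G r par rk) {v : V} (hv : v ≠ r) : G.Adj v (par v) :=
  (h.adj_iff _ _).2 (Or.inl ⟨hv, rfl⟩)

theorem isTree [Finite V] (h : IsParentMap G r par rk) : G.IsTree := by
  classical
  rw [SimpleGraph.isTree_iff_connected_and_card]
  have hreach : ∀ n v, rk v = n → G.Reachable v r := by
    intro n
    induction n using Nat.strong_induction_on with
    | _ n ih =>
      rintro v rfl
      by_cases hv : v = r
      · rw [hv]
      · exact (h.adj_par hv).reachable.trans (ih _ (h.rk_lt v hv) _ rfl)
  refine ⟨(SimpleGraph.connected_iff G).2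
    ⟨fun v w => (hreach _ v rfl).trans (hreach _ w rfl).symm, ⟨r⟩⟩, ?_⟩
  have hbij : Function.Bijective
      (fun v : {v : V // v ≠ r} => (⟨s(v.1, par v.1), h.adj_par v.2⟩ : G.edgeSet)) := by
    constructor
    · rintro ⟨v, hv⟩ ⟨w, hw⟩ heq
      have heq := congrArg Subtype.val heq
      simp only [Sym2.eq_iff] at heq
      rcases heq with ⟨h1, -⟩ | ⟨h1, h2⟩
      · exact Subtype.ext h1
      · have e1 := h.rk_lt v hv
        have e2 := h.rk_lt w hw
        rw [← h1] at e2
        rw [h2] at e1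
        omega
    · rintro ⟨e, he⟩
      induction e using Sym2.ind with
      | _ v w =>
        rcases (h.adj_iff v w).1 he with ⟨hv, rfl⟩ | ⟨hw, rfl⟩
        · exact ⟨⟨v, hv⟩, rfl⟩
        · exact ⟨⟨w, hw⟩, Subtype.ext Sym2.eq_swap⟩
  rw [← Nat.card_congr (Equiv.ofBijective _ hbij), ← Finite.card_option,
    Nat.card_congr (Equiv.optionSubtypeNe r)]

/-- The parent map is determined by the graph and the root. -/
theorem par_eq {par' : V → V} {rk' : V → ℕ} (h : IsParentMap G r par rk)
    (h' : IsParentMap G r par' rk') (v : V) : par v = par' v := by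
  by_cases hv : v = r
  · rw [hv, h.par_root, h'.par_root]
  induction hn : rk v using Nat.strong_induction_on generalizing v with
  | _ n ih =>
    subst hn
    rcases (h'.adj_iff _ _).1 (h.adj_par hv) with h1 | ⟨hw, h1⟩
    · exact h1.2.symm
    · have := ih _ (h.rk_lt v hv) _ hw rfl
      have e1 := h.rk_lt v hv
      have e2 := h.rk_lt _ hw
      rw [this, h1] at e2
      omega

end IsParentMap

/-- The neighbours of a vertex are its parent and its children. -/
theorem sum_adj {V : Type*} [Fintype V] [DecidableEq V] {G : SimpleGraph V}
    [DecidableRel G.Adj] {r : V} {par : V → V}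
    {rk : V → ℕ} (h : IsParentMap G r par rk) {M : Type*} [AddCommMonoid M] (v : V) (g : V → M) :
    ∑ w with G.Adj v w, g w = (if v = r then 0 else g (par v)) +
      ∑ w with w ≠ r ∧ par w = v, g w := by
  by_cases hv : v = r
  · rw [if_pos hv, zero_add]
    refine Finset.sum_congr (Finset.filter_congr fun w _ => ?_) fun _ _ => rfl
    rw [h.adj_iff]
    simp [hv]
  · rw [if_neg hv]
    have : (univ.filter fun w => G.Adj v w) =
        insert (par v) (univ.filter fun w => w ≠ r ∧ par w = v) := by
      ext w
      simp only [Finset.mem_filter, Finset.mem_univ, true_and, Finset.mem_insert, h.adj_iff]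
      constructor
      · rintro (⟨-, rfl⟩ | h')
        · exact Or.inl rfl
        · exact Or.inr h'
      · rintro (rfl | h')
        · exact Or.inl ⟨hv, rfl⟩
        · exact Or.inr h'
    rw [this, Finset.sum_insert]
    simp only [Finset.mem_filter, Finset.mem_univ, true_and]
    rintro ⟨hw, hpar⟩
    have e1 := h.rk_lt v hv
    have e2 := h.rk_lt _ hw
    rw [hpar] at e2
    omega

/-- The sum over the edges adjacent to a vertex, split into the edge towards the root, the edges
away from the root, and the unbounded ends. -/
theorem sum_star {E : Type*} [Fintype E] (T : RatTree E) [DecidableEq T.V] {r : T.V}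
    {par : T.V → T.V}
    {rk : T.V → ℕ} (h : IsParentMap T.graph r par rk) {M : Type*} [AddCommMonoid M]
    (v : T.V) (g : T.V → M) (k : E → M) :
    ∑ f : T.Star v, Sum.elim (fun w : {w // T.graph.Adj v w} => g w.1)
        (fun e : {e // T.root e = v} => k e.1) f =
      (if v = r then 0 else g (par v)) + ∑ w with w ≠ r ∧ par w = v, g w +
        ∑ e with T.root e = v, k e := by
  have : DecidableRel T.graph.Adj := Classical.decRel _
  have : Fintype {w : T.V // T.graph.Adj v w} := Fintype.ofFinite _
  have h1 : ∑ f : T.Star v, Sum.elim (fun w : {w // T.graph.Adj v w} => g w.1)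
        (fun e : {e // T.root e = v} => k e.1) f =
      (∑ w : {w // T.graph.Adj v w}, g w.1) + ∑ e : {e // T.root e = v}, k e.1 := by
    have huniv : (univ : Finset (T.Star v)) = (univ : Finset {w // T.graph.Adj v w}).disjSum
        (univ : Finset {e // T.root e = v}) := by
      refine Finset.ext fun f => iff_of_true (Finset.mem_univ f) ?_
      rcases f with f | f
      · exact Finset.inl_mem_disjSum.2 (Finset.mem_univ f)
      · exact Finset.inr_mem_disjSum.2 (Finset.mem_univ f)
    rw [huniv]
    exact Finset.sum_sumElim _ _ _ _
  rw [h1, Finset.sum_subtype (univ.filter fun e => T.root e = v) (p := fun e => T.root e = v)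
    (fun e => by simp) k, ← sum_adj h, Finset.sum_subtype (univ.filter fun w => T.graph.Adj v w)
    (p := fun w => T.graph.Adj v w) (fun w => by simp) g]

theorem card_star {V E : Type*} [Fintype V] [DecidableEq V] [Fintype E] {G : SimpleGraph V} {r : V}
    {par : V → V} {rk : V → ℕ} (h : IsParentMap G r par rk) (root : E → V) (v : V) :
    Nat.card ({w : V // G.Adj v w} ⊕ {e : E // root e = v}) =
      (if v = r then 0 else 1) + #{w | w ≠ r ∧ par w = v} + #{e | root e = v} := by
  have : DecidableRel G.Adj := Classical.decRel _
  have := sum_adj h v (fun _ => 1)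
  simp only [Finset.sum_const, smul_eq_mul, mul_one] at this
  rw [Nat.card_sum, Nat.card_eq_fintype_card, Nat.card_eq_fintype_card, Fintype.card_subtype,
    Fintype.card_subtype, this]

/-- Sums over the unbounded ends at a vertex, for a labelling of the ends by `Option I` in which
`none` is the end at the root. -/
theorem sum_ends {I V E M : Type*} [Fintype I] [DecidableEq V] [Fintype E]
    [AddCommMonoid M] (σ : Option I ≃ E)
    (root : E → V) {r : V} (hr : root (σ none) = r) (v : V) (k : E → M) :
    ∑ e with root e = v, k e = (if v = r then k (σ none) else 0) +
      ∑ i with root (σ (some i)) = v, k (σ (some i)) := by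
  rw [Finset.sum_filter, ← Equiv.sum_comp σ, Fintype.sum_option, Finset.sum_filter, hr]
  simp only [eq_comm]

end

/-! ### The curve of a hierarchy -/

section

section Curve

variable {I : Type} [DecidableEq I] [Fintype I] {E : Type*} [Fintype E]
  {H : Finset (Finset I)}

theorem univ_mem_of_isHierarchy (hI : 2 ≤ Fintype.card I) (hH : IsHierarchy H univ) : univ ∈ H :=
  hH.top_mem (by rwa [Finset.card_univ])

theorem up_univ (H : Finset (Finset I)) : up H univ = univ := by
  rw [up, dif_neg]
  rintro ⟨M, -, h, -⟩
  exact h.2 (Finset.subset_univ M)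

theorem up_mem (hI : 2 ≤ Fintype.card I) (hH : IsHierarchy H univ) {X : Finset I}
    (hX : X.Nonempty) : up H X ∈ H := by
  by_cases h : X = univ
  · rw [h, up_univ]
    exact univ_mem_of_isHierarchy hI hH
  · exact (up_spec hI hH hX h).1

theorem nonempty_of_mem (hH : IsHierarchy H univ) {A : Finset I} (hA : A ∈ H) : A.Nonempty :=
  IsNode.nonempty hH (Or.inl hA)

/-- The parent of a cluster, as a cluster. -/
def parent (hI : 2 ≤ Fintype.card I) (hH : IsHierarchy H univ) (A : {A // A ∈ H}) :
    {A // A ∈ H} := ⟨up H A.1, up_mem hI hH (nonempty_of_mem hH A.2)⟩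

/-- The cluster `univ`. -/
def rootCluster (hI : 2 ≤ Fintype.card I) (hH : IsHierarchy H univ) : {A // A ∈ H} :=
  ⟨univ, univ_mem_of_isHierarchy hI hH⟩

/-- The graph in which every cluster but `univ` is joined to its parent. -/
def clusterGraph (hI : 2 ≤ Fintype.card I) (hH : IsHierarchy H univ) :
    SimpleGraph {A // A ∈ H} where
  Adj A B := (A ≠ rootCluster hI hH ∧ parent hI hH A = B) ∨
    (B ≠ rootCluster hI hH ∧ parent hI hH B = A)
  symm := ⟨fun _ _ h => Or.symm h⟩
  loopless := ⟨fun A h => by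
    have h : A ≠ rootCluster hI hH ∧ parent hI hH A = A := by tauto
    have h1 : A.1 ≠ univ := fun h' => h.1 (Subtype.ext h')
    exact (up_spec hI hH (nonempty_of_mem hH A.2) h1).2.1.ne
      (congrArg Subtype.val h.2).symm⟩

theorem clusterGraph_adj {hI : 2 ≤ Fintype.card I} {hH : IsHierarchy H univ}
    {A B : {A // A ∈ H}} : (clusterGraph hI hH).Adj A B ↔
      (A ≠ rootCluster hI hH ∧ parent hI hH A = B) ∨
        (B ≠ rootCluster hI hH ∧ parent hI hH B = A) := Iff.rfl

theorem isParentMap_parent (hI : 2 ≤ Fintype.card I) (hH : IsHierarchy H univ) :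
    IsParentMap (clusterGraph hI hH) (rootCluster hI hH) (parent hI hH)
      (fun A => Fintype.card I - #A.1) where
  adj_iff _ _ := clusterGraph_adj
  rk_lt A hA := by
    have h1 : A.1 ≠ univ := fun h' => hA (Subtype.ext h')
    have h2 := Finset.card_lt_card (up_spec hI hH (nonempty_of_mem hH A.2) h1).2.1
    have h3 : #(parent hI hH A).1 ≤ Fintype.card I := Finset.card_le_univ _
    change #A.1 < #(parent hI hH A).1 at h2
    omega
  par_root := Subtype.ext (up_univ H)

/-- The cluster to which an unbounded end is attached. -/
def endCluster (σ : Option I ≃ E) (hI : 2 ≤ Fintype.card I) (hH : IsHierarchy H univ) (e : E) :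
    {A // A ∈ H} :=
  (σ.symm e).elim (rootCluster hI hH) fun i => ⟨up H {i}, up_mem hI hH ⟨i, by simp⟩⟩

theorem endCluster_none (σ : Option I ≃ E) (hI : 2 ≤ Fintype.card I)
    (hH : IsHierarchy H univ) : endCluster σ hI hH (σ none) = rootCluster hI hH := by
  simp [endCluster]

theorem endCluster_some (σ : Option I ≃ E) (hI : 2 ≤ Fintype.card I)
    (hH : IsHierarchy H univ) (i : I) : (endCluster σ hI hH (σ (some i))).1 = up H {i} := by
  simp [endCluster]

theorem endCluster_eq_iff (σ : Option I ≃ E) (hI : 2 ≤ Fintype.card I)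
    (hH : IsHierarchy H univ) (i : I) (A : {A // A ∈ H}) :
    endCluster σ hI hH (σ (some i)) = A ↔ up H {i} = A.1 := by
  rw [Subtype.ext_iff, endCluster_some]

theorem sum_children_eq {M : Type*} [AddCommMonoid M] (hI : 2 ≤ Fintype.card I)
    (hH : IsHierarchy H univ) (A : {A // A ∈ H}) (F : Finset I → M) :
    ∑ X ∈ children H A.1, F X =
      ∑ w with w ≠ rootCluster hI hH ∧ parent hI hH w = A, F w.1 +
        ∑ i with up H {i} = A.1, F {i} := by
  have h1 : children H A.1 = H.filter (fun X => X ≠ univ ∧ up H X = A.1) ∪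
      (univ.filter fun i => up H {i} = A.1).image singleton := by
    ext X
    simp only [children, nodes, Finset.mem_filter, Finset.mem_union, Finset.mem_image,
      Finset.mem_univ, true_and]
    constructor
    · rintro ⟨h | ⟨i, rfl⟩, h1, h2⟩
      · exact Or.inl ⟨h, h1, h2⟩
      · exact Or.inr ⟨i, h2, rfl⟩
    · rintro (⟨h, h1, h2⟩ | ⟨i, h2, rfl⟩)
      · exact ⟨Or.inl h, h1, h2⟩
      · exact ⟨Or.inr ⟨i, rfl⟩, singleton_ne_univ hI i, h2⟩
  rw [h1, Finset.sum_union, Finset.sum_image fun i _ j _ h => Finset.singleton_injective h]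
  · congr 1
    rw [Finset.sum_filter, Finset.sum_filter, ← Finset.sum_coe_sort H]
    refine Finset.sum_congr rfl fun w _ => if_congr ?_ rfl rfl
    rw [ne_eq, ne_eq, Subtype.ext_iff, Subtype.ext_iff]
    rfl
  · rw [Finset.disjoint_right]
    rintro X hX hXH
    obtain ⟨i, -, rfl⟩ := Finset.mem_image.1 hX
    have := hH.two_le_card _ (Finset.mem_filter.1 hXH).1
    rw [Finset.card_singleton] at this
    omega

theorem card_star_cluster (σ : Option I ≃ E) (hI : 2 ≤ Fintype.card I)
    (hH : IsHierarchy H univ) (A : {A // A ∈ H}) :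
    Nat.card ({B // (clusterGraph hI hH).Adj A B} ⊕ {e : E // endCluster σ hI hH e = A}) =
      #(children H A.1) + 1 := by
  classical
  rw [card_star (isParentMap_parent hI hH), Finset.card_eq_sum_ones (children H A.1),
    sum_children_eq hI hH, Finset.card_eq_sum_ones, Finset.card_eq_sum_ones,
    sum_ends σ _ (endCluster_none σ hI hH)]
  simp only [endCluster_eq_iff]
  by_cases hA : A = rootCluster hI hH
  · rw [if_pos hA, if_pos hA]; ring
  · rw [if_neg hA, if_neg hA]; ring

/-- The tree of a hierarchy on the ends other than `σ none`: its vertices are the clusters. -/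
abbrev treeOf (σ : Option I ≃ E) (hI : 2 ≤ Fintype.card I) (hH : IsHierarchy H univ) :
    RatTree E where
  V := {A // A ∈ H}
  fintypeV := inferInstance
  graph := clusterGraph hI hH
  isTree := (isParentMap_parent hI hH).isTree
  root := endCluster σ hI hH
  three_le_valence A := by
    rw [card_star_cluster]
    have := two_le_card_children hI hH A.2
    omega

theorem valence_treeOf (σ : Option I ≃ E) (hI : 2 ≤ Fintype.card I) (hH : IsHierarchy H univ)
    (A : {A // A ∈ H}) : (treeOf σ hI hH).valence A = #(children H A.1) + 1 :=
  card_star_cluster σ hI hH A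

variable {N : Type*} [AddCommGroup N]

/-- The slope of the edge above the cluster `X`, oriented away from the end `σ none`. -/
def clusterSlope (Δ : E → N) (σ : Option I ≃ E) (X : Finset I) : N := ∑ i ∈ X, Δ (σ (some i))

open Classical in
/-- The position of the cluster `A`, when the root is at `x` and the edges have lengths `l`. -/
def clusterPos (Δ : E → N) (σ : Option I ≃ E) (H : Finset (Finset I)) (l : Finset I → ℝ)
    (x : ℝ ⊗[ℤ] N) (A : Finset I) : ℝ ⊗[ℤ] N :=
  x + ∑ B ∈ H with B ≠ univ ∧ A ⊆ B, l B • ((1 : ℝ) ⊗ₜ[ℤ] clusterSlope Δ σ B)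

theorem clusterPos_univ (Δ : E → N) (σ : Option I ≃ E) (H : Finset (Finset I)) (l : Finset I → ℝ)
    (x : ℝ ⊗[ℤ] N) : clusterPos Δ σ H l x univ = x := by
  classical
  rw [clusterPos, Finset.sum_eq_zero, add_zero]
  intro B hB
  obtain ⟨-, h1, h2⟩ := Finset.mem_filter.1 hB
  exact absurd (Finset.univ_subset_iff.1 h2) h1

theorem clusterPos_up (Δ : E → N) (σ : Option I ≃ E) (hI : 2 ≤ Fintype.card I)
    (hH : IsHierarchy H univ) (l : Finset I → ℝ) (x : ℝ ⊗[ℤ] N) {A : Finset I} (hA : A ∈ H)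
    (hA' : A ≠ univ) : clusterPos Δ σ H l x A =
      clusterPos Δ σ H l x (up H A) + l A • ((1 : ℝ) ⊗ₜ[ℤ] clusterSlope Δ σ A) := by
  classical
  obtain ⟨h1, h2, h3⟩ := up_spec hI hH (nonempty_of_mem hH hA) hA'
  have : (H.filter fun B => B ≠ univ ∧ A ⊆ B) =
      insert A (H.filter fun B => B ≠ univ ∧ up H A ⊆ B) := by
    ext B
    simp only [Finset.mem_filter, Finset.mem_insert]
    constructor
    · rintro ⟨hB, hBu, hAB⟩
      by_cases hBA : B = A
      · exact Or.inl hBA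
      · exact Or.inr ⟨hB, hBu, h3 B hB (hAB.ssubset_of_ne (Ne.symm hBA))⟩
    · rintro (rfl | ⟨hB, hBu, hAB⟩)
      · exact ⟨hA, hA', subset_rfl⟩
      · exact ⟨hB, hBu, h2.1.trans hAB⟩
  rw [clusterPos, this, Finset.sum_insert, clusterPos]
  · abel
  · rw [Finset.mem_filter]
    exact fun h => h2.2 h.2.2

open Classical in
/-- The slopes of the curve of a hierarchy. -/
def edgeSlope (Δ : E → N) (σ : Option I ≃ E) (hI : 2 ≤ Fintype.card I) (hH : IsHierarchy H univ)
    (A B : {A // A ∈ H}) : N :=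
  if B ≠ rootCluster hI hH ∧ parent hI hH B = A then clusterSlope Δ σ B.1
  else -clusterSlope Δ σ A.1

theorem edgeSlope_of_parent_eq (Δ : E → N) (σ : Option I ≃ E) {hI : 2 ≤ Fintype.card I}
    {hH : IsHierarchy H univ} {A B : {A // A ∈ H}} (hB : B ≠ rootCluster hI hH)
    (h : parent hI hH B = A) : edgeSlope Δ σ hI hH A B = clusterSlope Δ σ B.1 :=
  if_pos ⟨hB, h⟩

theorem edgeSlope_parent (Δ : E → N) (σ : Option I ≃ E) {hI : 2 ≤ Fintype.card I}
    {hH : IsHierarchy H univ} {A : {A // A ∈ H}} (hA : A ≠ rootCluster hI hH) :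
    edgeSlope Δ σ hI hH A (parent hI hH A) = -clusterSlope Δ σ A.1 := by
  refine if_neg fun ⟨h1, h2⟩ => ?_
  have e1 := (isParentMap_parent hI hH).rk_lt A hA
  have e2 := (isParentMap_parent hI hH).rk_lt _ h1
  rw [h2] at e2
  omega

theorem inter_parent {hI : 2 ≤ Fintype.card I}
    {hH : IsHierarchy H univ} {A : {A // A ∈ H}} (hA : A ≠ rootCluster hI hH) :
    A.1 ∩ (parent hI hH A).1 = A.1 :=
  Finset.inter_eq_left.2
    (up_spec hI hH (nonempty_of_mem hH A.2) fun h' => hA (Subtype.ext h')).2.1.1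

theorem clusterSlope_univ {Δ : E → N} (σ : Option I ≃ E) (hΔ : ∑ e, Δ e = 0) :
    clusterSlope Δ σ univ = -Δ (σ none) := by
  rw [← Equiv.sum_comp σ, Fintype.sum_option] at hΔ
  exact eq_neg_of_add_eq_zero_right hΔ

theorem length_pos_of_adj {hI : 2 ≤ Fintype.card I} {hH : IsHierarchy H univ}
    {l : Finset I → ℝ} (hl : ∀ X ∈ H, X ≠ univ → 0 < l X) {A B : {A // A ∈ H}}
    (h : (clusterGraph hI hH).Adj A B) : 0 < l (A.1 ∩ B.1) := by
  have key : ∀ A : {A // A ∈ H}, A ≠ rootCluster hI hH → 0 < l (A.1 ∩ (parent hI hH A).1) := by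
    intro A hA
    rw [inter_parent hA]
    exact hl A.1 A.2 fun h' => hA (Subtype.ext h')
  rcases clusterGraph_adj.1 h with ⟨hA, rfl⟩ | ⟨hB, rfl⟩
  · exact key A hA
  · rw [Finset.inter_comm]
    exact key B hB

theorem clusterPos_of_adj (Δ : E → N) (σ : Option I ≃ E) {hI : 2 ≤ Fintype.card I}
    {hH : IsHierarchy H univ} (l : Finset I → ℝ) (x : ℝ ⊗[ℤ] N) {A B : {A // A ∈ H}}
    (h : (clusterGraph hI hH).Adj A B) : clusterPos Δ σ H l x B.1 = clusterPos Δ σ H l x A.1 +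
      l (A.1 ∩ B.1) • ((1 : ℝ) ⊗ₜ[ℤ] edgeSlope Δ σ hI hH A B) := by
  have key : ∀ A : {A // A ∈ H}, A ≠ rootCluster hI hH → clusterPos Δ σ H l x A.1 =
      clusterPos Δ σ H l x (parent hI hH A).1 + l (A.1 ∩ (parent hI hH A).1) •
        ((1 : ℝ) ⊗ₜ[ℤ] clusterSlope Δ σ A.1) := by
    intro A hA
    rw [inter_parent hA]
    exact clusterPos_up Δ σ hI hH l x A.2 fun h' => hA (Subtype.ext h')
  rcases clusterGraph_adj.1 h with ⟨hA, rfl⟩ | ⟨hB, rfl⟩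
  · rw [edgeSlope_parent Δ σ hA, key A hA, TensorProduct.tmul_neg, smul_neg]
    abel
  · rw [edgeSlope_of_parent_eq Δ σ hB rfl, key B hB, Finset.inter_comm]

theorem sum_star_edgeSlope {Δ : E → N} (hΔ : ∑ e, Δ e = 0) (σ : Option I ≃ E)
    (hI : 2 ≤ Fintype.card I) (hH : IsHierarchy H univ) (A : {A // A ∈ H}) :
    ∑ f : (treeOf σ hI hH).Star A,
      Sum.elim (fun w : {w // (clusterGraph hI hH).Adj A w} => edgeSlope Δ σ hI hH A w.1)
        (fun e : {e // endCluster σ hI hH e = A} => Δ e.1) f = 0 := by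
  classical
  refine (sum_star (treeOf σ hI hH) (isParentMap_parent hI hH) A (edgeSlope Δ σ hI hH A)
    Δ).trans ?_
  have h1 : ∑ w with w ≠ rootCluster hI hH ∧ parent hI hH w = A, edgeSlope Δ σ hI hH A w =
      ∑ w with w ≠ rootCluster hI hH ∧ parent hI hH w = A, clusterSlope Δ σ w.1 :=
    Finset.sum_congr rfl fun w hw => by
      obtain ⟨h1, h2⟩ := (Finset.mem_filter.1 hw).2
      exact edgeSlope_of_parent_eq Δ σ h1 h2
  have h2 : ∑ e with endCluster σ hI hH e = A, Δ e =
      (if A = rootCluster hI hH then Δ (σ none) else 0) +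
        ∑ i with up H {i} = A.1, clusterSlope Δ σ {i} := by
    rw [sum_ends σ _ (endCluster_none σ hI hH)]
    simp only [endCluster_eq_iff, clusterSlope, Finset.sum_singleton]
  have h3 : ∑ X ∈ children H A.1, clusterSlope Δ σ X = clusterSlope Δ σ A.1 :=
    sum_children hI hH A.2 fun i => Δ (σ (some i))
  rw [sum_children_eq hI hH] at h3
  change _ + ∑ w with w ≠ rootCluster hI hH ∧ parent hI hH w = A, edgeSlope Δ σ hI hH A w +
    ∑ e with endCluster σ hI hH e = A, Δ e = 0
  rw [h1, h2]
  by_cases hA : A = rootCluster hI hH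
  · have hA1 : A.1 = univ := congrArg Subtype.val hA
    rw [if_pos hA, if_pos hA, zero_add, add_left_comm, h3, hA1, clusterSlope_univ σ hΔ,
      add_neg_cancel]
  · rw [if_neg hA, if_neg hA, zero_add, add_assoc, h3, edgeSlope_parent Δ σ hA, neg_add_cancel]

/-- The curve with the tree of the hierarchy `H`, with root vertex at `x`, in which the edge above
the cluster `X` has length `l X`. -/
def curveOf {Δ : E → N} (hΔ : ∑ e, Δ e = 0) (σ : Option I ≃ E) (hI : 2 ≤ Fintype.card I)
    (hH : IsHierarchy H univ) (l : Finset I → ℝ) (hl : ∀ X ∈ H, X ≠ univ → 0 < l X)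
    (x : ℝ ⊗[ℤ] N) : TropicalCurve Δ where
  toRatTree := treeOf σ hI hH
  length := Sym2.lift ⟨fun A B : {A // A ∈ H} => l (A.1 ∩ B.1),
    fun _ _ => congrArg l (Finset.inter_comm _ _)⟩
  length_pos _ _ h := length_pos_of_adj hl h
  pos A := clusterPos Δ σ H l x A.1
  slope := edgeSlope Δ σ hI hH
  pos_eq _ _ h := clusterPos_of_adj Δ σ l x h
  balanced A := sum_star_edgeSlope hΔ σ hI hH A

end Curve

end

/-! ### The hierarchy of a tree -/

section

section Below

variable {V : Type*} {par : V → V}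

/-- The vertex `w` lies on the way from `v` to the root. -/
def Below (par : V → V) (v w : V) : Prop := ∃ k, par^[k] v = w

theorem Below.refl (v : V) : Below par v v := ⟨0, rfl⟩

theorem Below.trans {u v w : V} (h : Below par u v) (h' : Below par v w) : Below par u w := by
  obtain ⟨k, rfl⟩ := h
  obtain ⟨m, rfl⟩ := h'
  exact ⟨m + k, Function.iterate_add_apply _ _ _ _⟩

theorem below_par (v : V) : Below par v (par v) := ⟨1, rfl⟩

theorem Below.par_of_ne {v w : V} (h : Below par v w) (hne : v ≠ w) : Below par (par v) w := by
  obtain ⟨k, rfl⟩ := h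
  cases k with
  | zero => exact absurd rfl hne
  | succ k => exact ⟨k, rfl⟩

theorem Below.total {v w w' : V} (h : Below par v w) (h' : Below par v w') :
    Below par w w' ∨ Below par w' w := by
  obtain ⟨k, rfl⟩ := h
  obtain ⟨m, rfl⟩ := h'
  rcases le_total k m with hkm | hkm
  · exact Or.inl ⟨m - k, by rw [← Function.iterate_add_apply, Nat.sub_add_cancel hkm]⟩
  · exact Or.inr ⟨k - m, by rw [← Function.iterate_add_apply, Nat.sub_add_cancel hkm]⟩

variable {G : SimpleGraph V} {r : V} {rk : V → ℕ}

theorem IsParentMap.below_root (h : IsParentMap G r par rk) (v : V) : Below par v r := by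
  induction hn : rk v using Nat.strong_induction_on generalizing v with
  | _ n ih =>
    subst hn
    by_cases hv : v = r
    · rw [hv]
      exact Below.refl r
    · exact (below_par v).trans (ih _ (h.rk_lt v hv) _ rfl)

theorem IsParentMap.rk_par_le (h : IsParentMap G r par rk) (v : V) : rk (par v) ≤ rk v := by
  by_cases hv : v = r
  · rw [hv, h.par_root]
  · exact (h.rk_lt v hv).le

theorem IsParentMap.rk_le (h : IsParentMap G r par rk) {v w : V} (hvw : Below par v w) :
    rk w ≤ rk v := by
  obtain ⟨k, rfl⟩ := hvw
  induction k with
  | zero => exact le_rfl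
  | succ k ih =>
    rw [Function.iterate_succ_apply']
    exact (h.rk_par_le _).trans ih

theorem IsParentMap.eq_root_of_below (h : IsParentMap G r par rk) {w : V} (hw : Below par r w) :
    w = r := by
  obtain ⟨k, rfl⟩ := hw
  exact Function.iterate_fixed h.par_root k

end Below

section Clusters

variable {I : Type} [DecidableEq I] [Fintype I] {V : Type*} {par : V → V}
  {G : SimpleGraph V} {r : V} {rk : V → ℕ} {f : I → V} {v w : V}

open Classical in
/-- The labels of the ends beyond the vertex `v`, where `f i` is the vertex at the end `i`. -/
def clusterAt (par : V → V) (f : I → V) (v : V) : Finset I :=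
  univ.filter fun i => Below par (f i) v

theorem mem_clusterAt {i : I} : i ∈ clusterAt par f v ↔ Below par (f i) v := by
  simp [clusterAt]

theorem clusterAt_mono (h : Below par v w) : clusterAt par f v ⊆ clusterAt par f w :=
  fun _ hi => mem_clusterAt.2 ((mem_clusterAt.1 hi).trans h)

theorem clusterAt_root (h : IsParentMap G r par rk) : clusterAt par f r = univ :=
  Finset.eq_univ_of_forall fun _ => mem_clusterAt.2 (h.below_root _)

theorem below_total_of_mem {i : I} (hv : i ∈ clusterAt par f v) (hw : i ∈ clusterAt par f w) :
    Below par v w ∨ Below par w v :=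
  (mem_clusterAt.1 hv).total (mem_clusterAt.1 hw)

/-- The valency condition: every vertex has at least two edges which do not lead to the root. -/
def IsStable [Fintype V] [DecidableEq V] (r : V) (par : V → V) (f : I → V) : Prop :=
  ∀ v, 2 ≤ #{w | w ≠ r ∧ par w = v} + #{i | f i = v}

variable [Fintype V] [DecidableEq V]

theorem clusterAt_nonempty (h : IsParentMap G r par rk) (hf : IsStable r par f) (v : V) :
    (clusterAt par f v).Nonempty := by
  by_contra hv
  obtain ⟨v, hv, hmax⟩ := Finset.exists_max_image
    (univ.filter fun v => ¬ (clusterAt par f v).Nonempty) rk ⟨v, by simpa using hv⟩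
  have hv := (Finset.mem_filter.1 hv).2
  have hpos : 0 < #{w | w ≠ r ∧ par w = v} ∨ 0 < #{i | f i = v} := by
    have := hf v
    omega
  rcases hpos with hpos | hpos
  · obtain ⟨w, hw⟩ := Finset.card_pos.1 hpos
    obtain ⟨hwr, rfl⟩ := (Finset.mem_filter.1 hw).2
    have h1 : ¬ (clusterAt par f w).Nonempty := fun h' =>
      hv (h'.mono (clusterAt_mono (below_par w)))
    exact absurd (hmax w (by simpa using h1)) (not_le.2 (h.rk_lt w hwr))
  · obtain ⟨i, hi⟩ := Finset.card_pos.1 hpos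
    exact hv ⟨i, mem_clusterAt.2 ((Finset.mem_filter.1 hi).2 ▸ Below.refl _)⟩

theorem clusterAt_ssubset_par (h : IsParentMap G r par rk) (hf : IsStable r par f) {w : V}
    (hw : w ≠ r) : clusterAt par f w ⊂ clusterAt par f (par w) := by
  refine (clusterAt_mono (below_par w)).ssubset_of_ne fun heq => ?_
  have hlt := h.rk_lt w hw
  -- besides `w`, another vertex or an end hangs from `par w`
  by_cases hpos : 0 < #{i | f i = par w}
  · obtain ⟨i, hi⟩ := Finset.card_pos.1 hpos
    have hi := (Finset.mem_filter.1 hi).2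
    have h1 : i ∈ clusterAt par f w := heq ▸ mem_clusterAt.2 (hi ▸ Below.refl _)
    have := h.rk_le (mem_clusterAt.1 h1)
    rw [hi] at this
    omega
  · have h2 : 1 < #{u | u ≠ r ∧ par u = par w} := by
      have := hf (par w)
      omega
    obtain ⟨u, hu, hne⟩ := Finset.exists_mem_ne h2 w
    obtain ⟨hur, hu⟩ := (Finset.mem_filter.1 hu).2
    obtain ⟨i, hi⟩ := clusterAt_nonempty h hf u
    have hiw : i ∈ clusterAt par f w := by
      rw [heq, ← hu]
      exact clusterAt_mono (below_par u) hi
    have hlt' := h.rk_lt u hur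
    rcases below_total_of_mem hi hiw with hb | hb
    · have := h.rk_le (hb.par_of_ne hne)
      rw [hu] at this
      omega
    · have := h.rk_le (hb.par_of_ne hne.symm)
      rw [← hu] at this
      omega

theorem clusterAt_ssubset (h : IsParentMap G r par rk) (hf : IsStable r par f)
    (hvw : Below par v w) (hne : v ≠ w) : clusterAt par f v ⊂ clusterAt par f w := by
  have hv : v ≠ r := fun hv => hne ((h.eq_root_of_below (hv ▸ hvw)).trans hv.symm).symm
  exact (clusterAt_ssubset_par h hf hv).trans_subset (clusterAt_mono (hvw.par_of_ne hne))

theorem clusterAt_subset_iff (h : IsParentMap G r par rk) (hf : IsStable r par f) :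
    clusterAt par f v ⊆ clusterAt par f w ↔ Below par v w := by
  refine ⟨fun hsub => ?_, clusterAt_mono⟩
  obtain ⟨i, hi⟩ := clusterAt_nonempty h hf v
  rcases below_total_of_mem hi (hsub hi) with hb | hb
  · exact hb
  · by_cases hvw : v = w
    · rw [hvw]
      exact Below.refl w
    · exact absurd hsub (clusterAt_ssubset h hf hb (Ne.symm hvw)).2

theorem clusterAt_injective (h : IsParentMap G r par rk) (hf : IsStable r par f) :
    Function.Injective (clusterAt par f) := by
  intro v w hvw
  by_contra hne
  exact (clusterAt_ssubset h hf ((clusterAt_subset_iff h hf).1 hvw.subset) hne).ne hvw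

theorem two_le_card_clusterAt (h : IsParentMap G r par rk) (hf : IsStable r par f) (v : V) :
    2 ≤ #(clusterAt par f v) := by
  by_cases hpos : 0 < #{w | w ≠ r ∧ par w = v}
  · obtain ⟨w, hw⟩ := Finset.card_pos.1 hpos
    obtain ⟨hwr, rfl⟩ := (Finset.mem_filter.1 hw).2
    have h1 := (clusterAt_nonempty h hf w).card_pos
    have h2 := Finset.card_lt_card (clusterAt_ssubset_par h hf hwr)
    omega
  · have h1 : 2 ≤ #{i | f i = v} := by
      have := hf v
      omega
    refine h1.trans (Finset.card_le_card fun i hi => mem_clusterAt.2 ?_)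
    rw [(Finset.mem_filter.1 hi).2]
    exact Below.refl v

/-- The hierarchy of a tree. -/
def hierarchyOf (par : V → V) (f : I → V) : Finset (Finset I) := univ.image (clusterAt par f)

theorem mem_hierarchyOf {X : Finset I} :
    X ∈ hierarchyOf par f ↔ ∃ v, clusterAt par f v = X := by
  simp [hierarchyOf]

theorem isHierarchy_hierarchyOf (h : IsParentMap G r par rk) (hf : IsStable r par f) :
    IsHierarchy (hierarchyOf par f) univ where
  subset _ _ := Finset.subset_univ _
  two_le_card X hX := by
    obtain ⟨v, rfl⟩ := mem_hierarchyOf.1 hX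
    exact two_le_card_clusterAt h hf v
  top_mem _ := mem_hierarchyOf.2 ⟨r, clusterAt_root h⟩
  laminar X hX Y hY := by
    obtain ⟨v, rfl⟩ := mem_hierarchyOf.1 hX
    obtain ⟨w, rfl⟩ := mem_hierarchyOf.1 hY
    by_cases hdis : Disjoint (clusterAt par f v) (clusterAt par f w)
    · exact Or.inr (Or.inr hdis)
    · obtain ⟨i, hi, hi'⟩ := Finset.not_disjoint_iff.1 hdis
      rcases below_total_of_mem hi hi' with hb | hb
      · exact Or.inl (clusterAt_mono hb)
      · exact Or.inr (Or.inl (clusterAt_mono hb))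

theorem up_clusterAt (h : IsParentMap G r par rk) (hf : IsStable r par f) (v : V) :
    up (hierarchyOf par f) (clusterAt par f v) = clusterAt par f (par v) := by
  by_cases hv : v = r
  · rw [hv, h.par_root, clusterAt_root h, up_univ]
  refine up_eq (mem_hierarchyOf.2 ⟨_, rfl⟩) (clusterAt_ssubset_par h hf hv) fun Y hY hvY => ?_
  obtain ⟨w, rfl⟩ := mem_hierarchyOf.1 hY
  exact clusterAt_mono (((clusterAt_subset_iff h hf).1 hvY.1).par_of_ne
    fun hvw => hvY.ne (hvw ▸ rfl))

theorem up_singleton (h : IsParentMap G r par rk) (hf : IsStable r par f) (i : I) :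
    up (hierarchyOf par f) {i} = clusterAt par f (f i) := by
  have hi : {i} ⊆ clusterAt par f (f i) :=
    Finset.singleton_subset_iff.2 (mem_clusterAt.2 (Below.refl _))
  refine up_eq (mem_hierarchyOf.2 ⟨_, rfl⟩) (hi.ssubset_of_ne fun heq => ?_) fun Y hY hiY => ?_
  · have := two_le_card_clusterAt h hf (f i)
    rw [← heq, Finset.card_singleton] at this
    omega
  · obtain ⟨w, rfl⟩ := mem_hierarchyOf.1 hY
    exact clusterAt_mono (mem_clusterAt.1 (Finset.singleton_subset_iff.1 hiY.1))

/-- The vertices of a tree are the clusters of its hierarchy. -/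
def clusterEquiv (h : IsParentMap G r par rk) (hf : IsStable r par f) :
    V ≃ {A // A ∈ hierarchyOf par f} :=
  Equiv.ofBijective (fun v => ⟨clusterAt par f v, mem_hierarchyOf.2 ⟨v, rfl⟩⟩)
    ⟨fun _ _ hvw => clusterAt_injective h hf (congrArg Subtype.val hvw), fun ⟨X, hX⟩ => by
      obtain ⟨v, rfl⟩ := mem_hierarchyOf.1 hX
      exact ⟨v, rfl⟩⟩

theorem clusterEquiv_coe (h : IsParentMap G r par rk) (hf : IsStable r par f) (v : V) :
    (clusterEquiv h hf v).1 = clusterAt par f v := rfl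

theorem clusterEquiv_root (h : IsParentMap G r par rk) (hf : IsStable r par f)
    (hI : 2 ≤ Fintype.card I) :
    clusterEquiv h hf r = rootCluster hI (isHierarchy_hierarchyOf h hf) :=
  Subtype.ext (clusterAt_root h)

theorem parent_clusterEquiv (h : IsParentMap G r par rk) (hf : IsStable r par f)
    (hI : 2 ≤ Fintype.card I) (v : V) :
    parent hI (isHierarchy_hierarchyOf h hf) (clusterEquiv h hf v) = clusterEquiv h hf (par v) :=
  Subtype.ext (up_clusterAt h hf v)

theorem clusterGraph_adj_clusterEquiv (h : IsParentMap G r par rk) (hf : IsStable r par f)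
    (hI : 2 ≤ Fintype.card I) (v w : V) :
    (clusterGraph hI (isHierarchy_hierarchyOf h hf)).Adj (clusterEquiv h hf v)
      (clusterEquiv h hf w) ↔ G.Adj v w := by
  simp only [clusterGraph_adj, h.adj_iff, parent_clusterEquiv, ne_eq, ← clusterEquiv_root h hf hI,
    (clusterEquiv h hf).apply_eq_iff_eq]

/-- The edges at a vertex away from the root lead to the children of its cluster. -/
theorem sum_children_clusterAt {M : Type*} [AddCommMonoid M] (h : IsParentMap G r par rk)
    (hf : IsStable r par f) (hI : 2 ≤ Fintype.card I) (v : V) (F : Finset I → M) :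
    ∑ w with w ≠ r ∧ par w = v, F (clusterAt par f w) + ∑ i with f i = v, F {i} =
      ∑ X ∈ children (hierarchyOf par f) (clusterAt par f v), F X := by
  rw [← clusterEquiv_coe h hf v, sum_children_eq hI (isHierarchy_hierarchyOf h hf)]
  congr 1
  · refine Finset.sum_equiv (clusterEquiv h hf) (fun w => ?_) fun w _ => rfl
    simp only [Finset.mem_filter, Finset.mem_univ, true_and, parent_clusterEquiv, ne_eq,
      ← clusterEquiv_root h hf hI, (clusterEquiv h hf).apply_eq_iff_eq]
  · refine Finset.sum_congr (Finset.filter_congr fun i _ => ?_) fun _ _ => rfl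
    rw [up_singleton h hf, clusterEquiv_coe, (clusterAt_injective h hf).eq_iff]

end Clusters

section NormalForm

variable {I : Type} [DecidableEq I] [Fintype I] {E : Type*} [Fintype E]

theorem isStable_of_ratTree (T : RatTree E) [DecidableEq T.V] (σ : Option I ≃ E)
    {par : T.V → T.V} {rk : T.V → ℕ} (h : IsParentMap T.graph (T.root (σ none)) par rk) :
    IsStable (T.root (σ none)) par (fun i => T.root (σ (some i))) := by
  intro v
  have h1 := T.three_le_valence v
  rw [card_star h, Finset.card_eq_sum_ones {e | T.root e = v}, sum_ends σ T.root rfl] at h1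
  rw [Finset.card_eq_sum_ones {i | T.root (σ (some i)) = v}]
  split_ifs at h1 <;> omega

theorem isIso_clusterEquiv (T : RatTree E) [DecidableEq T.V] (σ : Option I ≃ E)
    (hI : 2 ≤ Fintype.card I) {par : T.V → T.V} {rk : T.V → ℕ}
    (h : IsParentMap T.graph (T.root (σ none)) par rk)
    (hf : IsStable (T.root (σ none)) par (fun i => T.root (σ (some i)))) :
    RatTree.IsIso T (treeOf σ hI (isHierarchy_hierarchyOf h hf)) (clusterEquiv h hf) := by
  refine ⟨clusterGraph_adj_clusterEquiv h hf hI, fun e => ?_⟩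
  obtain ⟨o, rfl⟩ := σ.surjective e
  cases o with
  | none => exact (endCluster_none σ hI _).trans (clusterEquiv_root h hf hI).symm
  | some i =>
    exact (endCluster_eq_iff σ hI _ i _).2 (up_singleton h hf i)

/-- Every tree is the tree of a hierarchy. -/
theorem exists_isIso_treeOf (T : RatTree E) (σ : Option I ≃ E) (hI : 2 ≤ Fintype.card I) :
    ∃ (H : Finset (Finset I)) (hH : IsHierarchy H univ) (φ : _),
      RatTree.IsIso T (treeOf σ hI hH) φ := by
  classical
  obtain ⟨par, h⟩ := exists_isParentMap T.isTree (T.root (σ none))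
  have hf := isStable_of_ratTree T σ h
  exact ⟨_, isHierarchy_hierarchyOf h hf, _, isIso_clusterEquiv T σ hI h hf⟩

/-- A cluster consists of the ends beyond it. -/
theorem mem_iff_below {H : Finset (Finset I)} (hI : 2 ≤ Fintype.card I) (hH : IsHierarchy H univ)
    (A : {A // A ∈ H}) (i : I) :
    i ∈ A.1 ↔ Below (parent hI hH) ⟨up H {i}, up_mem hI hH ⟨i, by simp⟩⟩ A := by
  constructor
  · induction hn : #A.1 using Nat.strong_induction_on generalizing A with
    | _ n ih =>
      subst hn
      intro hi
      obtain ⟨X, hX, hiX⟩ := exists_mem_children hI hH A.2 hi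
      have hlt := Finset.card_lt_card (ssubset_of_mem_children hI hH hX)
      obtain ⟨hXn, hXu, hup⟩ := mem_children.1 hX
      rcases hXn with hXH | hXc
      · have h1 : parent hI hH ⟨X, hXH⟩ = A := Subtype.ext hup
        exact (ih _ hlt ⟨X, hXH⟩ rfl hiX).trans (h1 ▸ below_par _)
      · obtain ⟨j, rfl⟩ := Finset.card_eq_one.1 hXc
        obtain rfl := Finset.mem_singleton.1 hiX
        have h1 : (⟨up H {i}, up_mem hI hH ⟨i, by simp⟩⟩ : {A // A ∈ H}) = A := Subtype.ext hup
        rw [h1]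
        exact Below.refl A
  · rintro ⟨k, rfl⟩
    induction k with
    | zero => exact (up_spec hI hH (by simp) (singleton_ne_univ hI i)).2.1.1 (by simp)
    | succ k ih =>
      rw [Function.iterate_succ_apply']
      generalize (parent hI hH)^[k] _ = B at ih
      by_cases hB : B.1 = univ
      · change i ∈ up H B.1
        rw [hB, up_univ]
        exact Finset.mem_univ i
      · exact (up_spec hI hH (nonempty_of_mem hH B.2) hB).2.1.1 ih

/-- The only isomorphisms between trees of hierarchies are the identities. -/
theorem coe_eq_of_isIso {σ : Option I ≃ E} {hI : 2 ≤ Fintype.card I} {H H' : Finset (Finset I)}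
    {hH : IsHierarchy H univ} {hH' : IsHierarchy H' univ} {φ : {A // A ∈ H} ≃ {A // A ∈ H'}}
    (hφ : RatTree.IsIso (treeOf σ hI hH) (treeOf σ hI hH') φ) (A : {A // A ∈ H}) :
    (φ A).1 = A.1 := by
  have hroot : rootCluster hI hH' = φ (rootCluster hI hH) := by
    rw [← endCluster_none σ hI hH, ← endCluster_none σ hI hH']
    exact hφ.2 _
  have hP : IsParentMap (clusterGraph hI hH) (rootCluster hI hH)
      (fun A => φ.symm (parent hI hH' (φ A))) (fun A => Fintype.card I - #(φ A).1) := by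
    have h' := isParentMap_parent hI hH'
    refine ⟨fun v w => ?_, fun v hv => ?_, ?_⟩
    · rw [← hφ.1]
      refine (h'.adj_iff _ _).trans ?_
      simp only [hroot, ne_eq, φ.apply_eq_iff_eq, Equiv.symm_apply_eq]
    · simp only [Equiv.apply_symm_apply]
      exact h'.rk_lt (φ v) (by rwa [hroot, ne_eq, φ.apply_eq_iff_eq])
    · rw [← hroot, h'.par_root, hroot, Equiv.symm_apply_apply]
  have hpar : ∀ A, φ (parent hI hH A) = parent hI hH' (φ A) := fun A => by
    rw [(isParentMap_parent hI hH).par_eq hP, Equiv.apply_symm_apply]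
  have hiter : ∀ k A, φ ((parent hI hH)^[k] A) = (parent hI hH')^[k] (φ A) := fun k =>
    Function.Semiconj.iterate_right (f := φ) hpar k
  have hend : ∀ i : I, φ ⟨up H {i}, up_mem hI hH ⟨i, by simp⟩⟩ =
      ⟨up H' {i}, up_mem hI hH' ⟨i, by simp⟩⟩ := by
    intro i
    have h1 : endCluster σ hI hH (σ (some i)) = ⟨up H {i}, up_mem hI hH ⟨i, by simp⟩⟩ :=
      Subtype.ext (endCluster_some σ hI hH i)
    rw [← h1]
    exact (hφ.2 _).symm.trans (Subtype.ext (endCluster_some σ hI hH' i))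
  ext i
  rw [mem_iff_below hI hH', mem_iff_below hI hH, ← hend]
  simp only [Below, ← hiter, φ.apply_eq_iff_eq]

theorem eq_of_isIso {σ : Option I ≃ E} {hI : 2 ≤ Fintype.card I} {H H' : Finset (Finset I)}
    {hH : IsHierarchy H univ} {hH' : IsHierarchy H' univ} {φ : {A // A ∈ H} ≃ {A // A ∈ H'}}
    (hφ : RatTree.IsIso (treeOf σ hI hH) (treeOf σ hI hH') φ) : H = H' := by
  ext A
  refine ⟨fun hA => ?_, fun hA => ?_⟩
  · have := (φ ⟨A, hA⟩).2
    rwa [coe_eq_of_isIso hφ] at this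
  · have := (φ.symm ⟨A, hA⟩).2
    rwa [← coe_eq_of_isIso hφ, Equiv.apply_symm_apply] at this

end NormalForm

end

/-! ### The hierarchy of a curve -/

section

section CurveNormalForm

variable {N : Type*} [AddCommGroup N]

theorem realExt_tmul (φ : N →ₗ[ℤ] ℤ) (c : ℝ) (n : N) : realExt φ (c ⊗ₜ[ℤ] n) = c * (φ n : ℤ) := by
  simp [realExt, mul_comm]

theorem one_tmul_eq_zero [Module.Free ℤ N] {n : N} (h : (1 : ℝ) ⊗ₜ[ℤ] n = 0) : n = 0 := by
  rw [← Module.forall_dual_apply_eq_zero_iff ℤ]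
  intro φ
  have := congrArg (realExt φ) h
  rw [realExt_tmul, map_zero, one_mul] at this
  exact_mod_cast this

variable {I : Type} [DecidableEq I] [Fintype I] {E : Type*} [Fintype E]

theorem slope_symm [Module.Free ℤ N] {Δ : E → N} (C : TropicalCurve Δ) {v w : C.V}
    (h : C.graph.Adj v w) : C.slope w v = -C.slope v w := by
  have h1 := C.pos_eq v w h
  have h2 := C.pos_eq w v h.symm
  have hpos := C.length_pos v w h
  rw [Sym2.eq_swap, h1, add_assoc, ← smul_add, ← TensorProduct.tmul_add] at h2
  have h3 := (smul_eq_zero.1 (left_eq_add.1 h2)).resolve_left hpos.ne'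
  exact eq_neg_of_add_eq_zero_right (one_tmul_eq_zero h3)

/-- By balancing, the slope of the edge above a vertex is the sum of the slopes of the ends beyond
it. -/
theorem slope_par [Module.Free ℤ N] {Δ : E → N} (C : TropicalCurve Δ) [DecidableEq C.V]
    (σ : Option I ≃ E) (hI : 2 ≤ Fintype.card I) {par : C.V → C.V} {rk : C.V → ℕ}
    (h : IsParentMap C.graph (C.root (σ none)) par rk) (v : C.V) (hv : v ≠ C.root (σ none)) :
    C.slope (par v) v =
      clusterSlope Δ σ (clusterAt par (fun i => C.root (σ (some i))) v) := by
  have hf := isStable_of_ratTree C.toRatTree σ h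
  have : DecidableEq N := Classical.decEq N
  by_contra hne
  obtain ⟨v, hmem, hmax⟩ := Finset.exists_max_image
    (univ.filter fun v => v ≠ C.root (σ none) ∧ C.slope (par v) v ≠
      clusterSlope Δ σ (clusterAt par (fun i => C.root (σ (some i))) v)) rk
    ⟨v, by simp [hv, hne]⟩
  obtain ⟨hv, hne⟩ := (Finset.mem_filter.1 hmem).2
  have hbal := (sum_star C.toRatTree h v (C.slope v) Δ).symm.trans (C.balanced v)
  have h1 : ∑ w with w ≠ C.root (σ none) ∧ par w = v, C.slope v w =
      ∑ w with w ≠ C.root (σ none) ∧ par w = v,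
        clusterSlope Δ σ (clusterAt par (fun i => C.root (σ (some i))) w) := by
    refine Finset.sum_congr rfl fun w hw => ?_
    obtain ⟨hwr, rfl⟩ := (Finset.mem_filter.1 hw).2
    by_contra hw'
    exact absurd (hmax w (by simp [hwr, hw'])) (not_le.2 (h.rk_lt w hwr))
  have h2 : ∑ e with C.root e = v, Δ e =
      ∑ i with C.root (σ (some i)) = v, clusterSlope Δ σ {i} := by
    rw [sum_ends σ C.root rfl, if_neg hv, zero_add]
    simp only [clusterSlope, Finset.sum_singleton]
  rw [h1, h2, if_neg hv, add_assoc, sum_children_clusterAt h hf hI v, slope_symm C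
    (h.adj_par hv).symm] at hbal
  refine hne ?_
  rw [neg_add_eq_zero.1 hbal]
  exact sum_children hI (isHierarchy_hierarchyOf h hf) (mem_hierarchyOf.2 ⟨v, rfl⟩)
    fun i => Δ (σ (some i))

/-- Every curve is the curve of a hierarchy. -/
theorem exists_isIso_curveOf [Module.Free ℤ N] {Δ : E → N} (hΔ : ∑ e, Δ e = 0)
    (σ : Option I ≃ E) (hI : 2 ≤ Fintype.card I) (C : TropicalCurve Δ) :
    ∃ (H : Finset (Finset I)) (hH : IsHierarchy H univ) (l : Finset I → ℝ)
      (hl : ∀ X ∈ H, X ≠ univ → 0 < l X) (x : ℝ ⊗[ℤ] N) (φ : _),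
      TropicalCurve.IsIso C (curveOf hΔ σ hI hH l hl x) φ := by
  classical
  obtain ⟨par, h⟩ := exists_isParentMap C.isTree (C.root (σ none))
  have hf := isStable_of_ratTree C.toRatTree σ h
  have hH := isHierarchy_hierarchyOf h hf
  have hiso := isIso_clusterEquiv C.toRatTree σ hI h hf
  set r := C.root (σ none)
  set f : I → C.V := fun i => C.root (σ (some i))
  obtain ⟨l, hlen⟩ : ∃ l : Finset I → ℝ, ∀ v, l (clusterAt par f v) = C.length s(v, par v) :=
    ⟨fun X => Function.extend (clusterAt par f) (fun v => C.length s(v, par v)) 0 X,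
      fun v => (clusterAt_injective h hf).extend_apply _ _ v⟩
  have hl : ∀ X ∈ hierarchyOf par f, X ≠ univ → 0 < l X := by
    intro X hX hXu
    obtain ⟨v, rfl⟩ := mem_hierarchyOf.1 hX
    rw [hlen]
    exact C.length_pos _ _ (h.adj_par fun hv => hXu (hv ▸ clusterAt_root h))
  have hpos : ∀ v, clusterPos Δ σ (hierarchyOf par f) l (C.pos r) (clusterAt par f v) =
      C.pos v := by
    intro v
    induction hn : C.graph.dist r v using Nat.strong_induction_on generalizing v with
    | _ n ih =>
      subst hn
      by_cases hv : v = r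
      · rw [hv, clusterAt_root h, clusterPos_univ]
      · have hne : clusterAt par f v ≠ univ := fun h' =>
          hv (clusterAt_injective h hf (h'.trans (clusterAt_root h).symm))
        rw [clusterPos_up Δ σ hI hH l _ (mem_hierarchyOf.2 ⟨v, rfl⟩) hne, up_clusterAt h hf,
          ih _ (h.rk_lt v hv) _ rfl, hlen, ← slope_par C σ hI h v hv, Sym2.eq_swap]
        exact (C.pos_eq _ _ (h.adj_par hv).symm).symm
  refine ⟨_, hH, l, hl, C.pos r, _, hiso, ?_, hpos, ?_⟩
  · have key : ∀ v, v ≠ r → l (clusterAt par f v ∩ clusterAt par f (par v)) =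
        C.length s(v, par v) := fun v hv => by
      rw [Finset.inter_eq_left.2 (clusterAt_mono (below_par v)), hlen]
    intro v w hvw
    rcases (h.adj_iff _ _).1 hvw with ⟨hv, rfl⟩ | ⟨hw, rfl⟩
    · exact key v hv
    · rw [Sym2.eq_swap, Sym2.eq_swap (a := par w)]
      exact key w hw
  · have hne : ∀ v, v ≠ r → clusterEquiv h hf v ≠ rootCluster hI hH := fun v hv h' =>
      hv ((clusterEquiv h hf).injective (h'.trans (clusterEquiv_root h hf hI).symm))
    intro v w hvw
    rcases (h.adj_iff _ _).1 hvw with ⟨hv, rfl⟩ | ⟨hw, rfl⟩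
    · rw [slope_symm C (h.adj_par hv).symm, slope_par C σ hI h v hv]
      change edgeSlope Δ σ hI hH (clusterEquiv h hf v) (clusterEquiv h hf (par v)) = _
      rw [← parent_clusterEquiv h hf hI]
      exact edgeSlope_parent Δ σ (hne v hv)
    · rw [slope_par C σ hI h w hw]
      exact edgeSlope_of_parent_eq Δ σ (hne w hw) (parent_clusterEquiv h hf hI w)

/-- The curve of a hierarchy with the given lengths, as a point of the moduli space. -/
def curveClass {Δ : E → N} (hΔ : ∑ e, Δ e = 0) (σ : Option I ≃ E) (hI : 2 ≤ Fintype.card I)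
    {H : Finset (Finset I)} (hH : IsHierarchy H univ) (l : Finset I → ℝ)
    (hl : ∀ X ∈ H, X ≠ univ → 0 < l X) (x : ℝ ⊗[ℤ] N) : ModuliSpace Δ :=
  Quotient.mk (TropicalCurve.isoSetoid Δ) (curveOf hΔ σ hI hH l hl x)

/-- The combinatorial type of a hierarchy. -/
def treeClass (σ : Option I ≃ E) (hI : 2 ≤ Fintype.card I)
    {H : Finset (Finset I)} (hH : IsHierarchy H univ) : CombType E :=
  Quotient.mk (combSetoid E) (treeOf σ hI hH)

theorem exists_eq_curveClass [Module.Free ℤ N] {Δ : E → N} (hΔ : ∑ e, Δ e = 0)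
    (σ : Option I ≃ E) (hI : 2 ≤ Fintype.card I) (Γ : ModuliSpace Δ) :
    ∃ (H : Finset (Finset I)) (hH : IsHierarchy H univ) (l : Finset I → ℝ)
      (hl : ∀ X ∈ H, X ≠ univ → 0 < l X) (x : ℝ ⊗[ℤ] N), Γ = curveClass hΔ σ hI hH l hl x := by
  induction Γ using Quotient.inductionOn with
  | _ C =>
    obtain ⟨H, hH, l, hl, x, φ, hφ⟩ := exists_isIso_curveOf hΔ σ hI C
    exact ⟨H, hH, l, hl, x, Quotient.sound ⟨φ, hφ⟩⟩

theorem exists_eq_treeClass (σ : Option I ≃ E) (hI : 2 ≤ Fintype.card I) (c : CombType E) :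
    ∃ (H : Finset (Finset I)) (hH : IsHierarchy H univ), c = treeClass σ hI hH := by
  induction c using Quotient.inductionOn with
  | _ T =>
    obtain ⟨H, hH, φ, hφ⟩ := exists_isIso_treeOf T σ hI
    exact ⟨H, hH, Quotient.sound ⟨φ, hφ⟩⟩

theorem eq_of_treeClass_eq {σ : Option I ≃ E} {hI : 2 ≤ Fintype.card I} {H H' : Finset (Finset I)}
    {hH : IsHierarchy H univ} {hH' : IsHierarchy H' univ}
    (h : treeClass σ hI hH = treeClass σ hI hH') : H = H' := by
  obtain ⟨φ, hφ⟩ := Quotient.exact h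
  exact eq_of_isIso hφ

theorem curveClass_congr {Δ : E → N} {hΔ : ∑ e, Δ e = 0} {σ : Option I ≃ E}
    {hI : 2 ≤ Fintype.card I} {H : Finset (Finset I)} {hH : IsHierarchy H univ}
    {l l' : Finset I → ℝ} {hl : ∀ X ∈ H, X ≠ univ → 0 < l X}
    {hl' : ∀ X ∈ H, X ≠ univ → 0 < l' X} {x x' : ℝ ⊗[ℤ] N}
    (hll : ∀ X ∈ H, X ≠ univ → l X = l' X) (hx : x = x') :
    curveClass hΔ σ hI hH l hl x = curveClass hΔ σ hI hH l' hl' x' := by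
  classical
  subst hx
  refine Quotient.sound ⟨Equiv.refl _, RatTree.IsIso.refl _, ?_, ?_, fun _ _ _ => rfl⟩
  · have key : ∀ A : {A // A ∈ H}, A ≠ rootCluster hI hH →
        l' (A.1 ∩ (parent hI hH A).1) = l (A.1 ∩ (parent hI hH A).1) := by
      intro A hA
      rw [inter_parent hA]
      exact (hll A.1 A.2 fun h' => hA (Subtype.ext h')).symm
    intro A B hAB
    change l' (A.1 ∩ B.1) = l (A.1 ∩ B.1)
    rcases clusterGraph_adj.1 hAB with ⟨hA, rfl⟩ | ⟨hB, rfl⟩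
    · exact key A hA
    · rw [Finset.inter_comm]
      exact key B hB
  · intro A
    refine congrArg (x + ·) (Finset.sum_congr rfl fun B hB => ?_)
    obtain ⟨h1, h2, -⟩ := Finset.mem_filter.1 hB
    rw [hll B h1 h2]

theorem isTrivalent_curveClass_iff {Δ : E → N} (hΔ : ∑ e, Δ e = 0) (σ : Option I ≃ E)
    (hI : 2 ≤ Fintype.card I) {H : Finset (Finset I)} (hH : IsHierarchy H univ)
    (l : Finset I → ℝ) (hl : ∀ X ∈ H, X ≠ univ → 0 < l X) (x : ℝ ⊗[ℤ] N) :
    (curveClass hΔ σ hI hH l hl x).IsTrivalent ↔ ∀ A ∈ H, #(children H A) = 2 := by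
  have h1 : (curveClass hΔ σ hI hH l hl x).IsTrivalent ↔
      ∀ A : {A // A ∈ H}, (treeOf σ hI hH).valence A = 3 := Iff.rfl
  simp only [h1, valence_treeOf, Nat.reduceEqDiff, Subtype.forall]

end CurveNormalForm

end

/-! ### Multiplicities -/

section

section Bivectors

variable {N : Type*} [AddCommGroup N]

theorem bivector_self (a : N) : bivector a a = 0 :=
  (exteriorPower.ιMulti ℤ 2).map_eq_zero_of_eq ![a, a] (i := 0) (j := 1) rfl (by simp)

theorem bivector_swap (a b : N) : bivector b a = -bivector a b := by
  have h := (exteriorPower.ιMulti ℤ 2 (M := N)).map_swap ![a, b] (i := 0) (j := 1) (by simp)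
  rw [bivector, bivector, ← h]
  congr 1
  ext i
  fin_cases i <;> rfl

theorem bivector_add_left (a b c : N) : bivector (a + b) c = bivector a c + bivector b c :=
  (exteriorPower.ιMulti ℤ 2).map_vecCons_add ![c] a b

theorem bivector_smul_left (k : ℤ) (a c : N) : bivector (k • a) c = k • bivector a c :=
  (exteriorPower.ιMulti ℤ 2).map_vecCons_smul ![c] k a

/-- The bivector `a ∧ b` as a bilinear map. -/
def wedge (N : Type*) [AddCommGroup N] : N →ₗ[ℤ] N →ₗ[ℤ] ⋀[ℤ]^2 N :=
  LinearMap.mk₂ ℤ bivector bivector_add_left bivector_smul_left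
    (fun a b c => by
      rw [bivector_swap, bivector_add_left, neg_add, ← bivector_swap, ← bivector_swap])
    (fun k a b => by
      rw [bivector_swap, bivector_smul_left, bivector_swap a b]
      exact neg_eq_iff_eq_neg.2 (smul_neg k _))

theorem wedge_apply (a b : N) : wedge N a b = bivector a b := rfl

theorem isAlt_wedge : (wedge N).IsAlt := bivector_self

variable {E : Type*} [Fintype E] (Δ : E → N) (ω : N →ₗ[ℤ] N →ₗ[ℤ] ℤ)

theorem qpow_add (x y : ⋀[ℤ]^2 N) : qpow Δ ω (x + y) = qpow Δ ω x * qpow Δ ω y := by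
  rw [qpow, qpow, qpow, AddMonoidAlgebra.single_mul_single, mul_one, Submodule.Quotient.mk_add]

theorem qpow_zero : qpow Δ ω 0 = 1 := rfl

theorem qpow_sum {ι : Type*} (s : Finset ι) (F : ι → ⋀[ℤ]^2 N) :
    qpow Δ ω (∑ i ∈ s, F i) = ∏ i ∈ s, qpow Δ ω (F i) := by
  classical
  induction s using Finset.induction_on with
  | empty => rw [Finset.sum_empty, Finset.prod_empty, qpow_zero]
  | insert i s hi ih => rw [Finset.sum_insert hi, Finset.prod_insert hi, qpow_add, ih]

theorem qpow_eq_one {x : ⋀[ℤ]^2 N} (hx : x ∈ Kω Δ ω) : qpow Δ ω x = 1 := by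
  rw [qpow, (Submodule.Quotient.mk_eq_zero _).2 hx]
  rfl

end Bivectors

section Pairs

variable {N P : Type*} [AddCommGroup N] [AddCommGroup P]

/-- Of three vectors with sum zero, any two have the same pairing, up to the sign. Two such pairings
change sign simultaneously. -/
theorem pairing_of_sum_eq_zero {S : Type*} [Fintype S] (hS : Fintype.card S = 3) {o : S → N}
    (ho : ∑ s, o s = 0) (β : N →ₗ[ℤ] N →ₗ[ℤ] P) (hβ : β.IsAlt) (ω : N →ₗ[ℤ] N →ₗ[ℤ] ℤ)
    (hω : ω.IsAlt) {f g f' g' : S} (hfg : f ≠ g) (hfg' : f' ≠ g') :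
    (ω (o f') (o g') = ω (o f) (o g) ∧ β (o f') (o g') = β (o f) (o g)) ∨
      (ω (o f') (o g') = -ω (o f) (o g) ∧ β (o f') (o g') = -β (o f) (o g)) := by
  classical
  obtain ⟨k, hk⟩ : ∃ k, k ∉ ({f, g} : Finset S) := by
    by_contra! h
    have h1 : (univ : Finset S) ⊆ {f, g} := fun x _ => h x
    have h2 := Finset.card_le_card h1
    rw [Finset.card_univ, hS, Finset.card_pair hfg] at h2
    omega
  simp only [Finset.mem_insert, Finset.mem_singleton, not_or] at hk
  obtain ⟨hkf, hkg⟩ := hk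
  have huniv : (univ : Finset S) = {f, g, k} := by
    refine (Finset.eq_of_subset_of_card_le (Finset.subset_univ _) ?_).symm
    rw [Finset.card_univ, hS, Finset.card_eq_three.2 ⟨f, g, k, hfg, Ne.symm hkf, Ne.symm hkg, rfl⟩]
  have hok : o k = -(o f + o g) := by
    rw [huniv, Finset.sum_insert (by simp [hfg, Ne.symm hkf]), Finset.sum_pair (Ne.symm hkg),
      ← add_assoc] at ho
    exact eq_neg_of_add_eq_zero_right ho
  have hmem : ∀ x : S, x = f ∨ x = g ∨ x = k := fun x => by
    have := Finset.mem_univ x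
    rw [huniv] at this
    simpa using this
  have h1 := hβ.neg (o f) (o g)
  have h2 := hω.neg (o f) (o g)
  rcases hmem f' with rfl | rfl | rfl <;> rcases hmem g' with rfl | rfl | rfl <;>
    first
    | exact absurd rfl hfg'
    | simp [hok, hβ.self_eq_zero, hω.self_eq_zero, ← h1, ← h2]

end Pairs

section Star

variable {I : Type} [DecidableEq I] [Fintype I] {E : Type*} [Fintype E] {N : Type*}
  [AddCommGroup N] {H : Finset (Finset I)} {Δ : E → N}

/-- A child of a cluster is an edge at the corresponding vertex. -/
theorem exists_star_of_mem_children (hΔ : ∑ e, Δ e = 0) (σ : Option I ≃ E)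
    (hI : 2 ≤ Fintype.card I) (hH : IsHierarchy H univ) (l : Finset I → ℝ)
    (hl : ∀ X ∈ H, X ≠ univ → 0 < l X) (x : ℝ ⊗[ℤ] N) (A : {A // A ∈ H}) {X : Finset I}
    (hX : X ∈ children H A.1) : ∃ s : (treeOf σ hI hH).Star A,
      (curveOf hΔ σ hI hH l hl x).out A s = clusterSlope Δ σ X ∧
        Sum.elim (fun w => w.1.1) (fun e => (σ.symm e.1).elim univ singleton) s = X := by
  obtain ⟨hXn, hXu, hup⟩ := mem_children.1 hX
  rcases hXn with hXH | hXc
  · have h1 : (⟨X, hXH⟩ : {A // A ∈ H}) ≠ rootCluster hI hH :=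
      fun h => hXu (congrArg Subtype.val h)
    have h2 : parent hI hH ⟨X, hXH⟩ = A := Subtype.ext hup
    exact ⟨Sum.inl ⟨⟨X, hXH⟩, Or.inr ⟨h1, h2⟩⟩, edgeSlope_of_parent_eq Δ σ h1 h2, rfl⟩
  · obtain ⟨i, rfl⟩ := Finset.card_eq_one.1 hXc
    refine ⟨Sum.inr ⟨σ (some i), (endCluster_eq_iff σ hI hH i A).2 hup⟩, ?_, ?_⟩
    · rw [clusterSlope, Finset.sum_singleton]
      rfl
    · simp

variable {A : {A // A ∈ H}} {B : Finset I}

/-- The outgoing slopes at a trivalent vertex. -/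
theorem exists_star_of_split (hΔ : ∑ e, Δ e = 0) (σ : Option I ≃ E)
    (hI : 2 ≤ Fintype.card I) (hH : IsHierarchy H univ) (l : Finset I → ℝ)
    (hl : ∀ X ∈ H, X ≠ univ → 0 < l X) (x : ℝ ⊗[ℤ] N) (hBA : B ∈ proper A.1)
    (hB : IsNode H B) (hC : IsNode H (A.1 \ B)) : ∃ f g : (treeOf σ hI hH).Star A, f ≠ g ∧
      (curveOf hΔ σ hI hH l hl x).out A f = clusterSlope Δ σ B ∧
      (curveOf hΔ σ hI hH l hl x).out A g = clusterSlope Δ σ (A.1 \ B) := by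
  have hch := children_eq_of_split hI hH A.2 hBA hB hC
  obtain ⟨f, hf, hfl⟩ := exists_star_of_mem_children hΔ σ hI hH l hl x A (X := B) (by simp [hch])
  obtain ⟨g, hg, hgl⟩ := exists_star_of_mem_children hΔ σ hI hH l hl x A (X := A.1 \ B)
    (by simp [hch])
  refine ⟨f, g, ?_, hf, hg⟩
  rintro rfl
  obtain ⟨b, hb⟩ := (mem_proper.1 hBA).2
  have hb' := hb
  rw [← hfl, hgl] at hb'
  exact (Finset.mem_sdiff.1 hb').2 hb

theorem valence_of_split (σ : Option I ≃ E) (hI : 2 ≤ Fintype.card I) (hH : IsHierarchy H univ)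
    (hBA : B ∈ proper A.1) (hB : IsNode H B) (hC : IsNode H (A.1 \ B)) :
    (treeOf σ hI hH).valence A = 3 := by
  rw [valence_treeOf, children_eq_of_split hI hH A.2 hBA hB hC, Finset.card_pair]
  intro h
  obtain ⟨b, hb⟩ := (mem_proper.1 hBA).2
  have hb' := hb
  rw [h] at hb'
  exact (Finset.mem_sdiff.1 hb').2 hb

theorem bivector_mem_Kω (hΔ : ∑ e, Δ e = 0) (σ : Option I ≃ E)
    (hI : 2 ≤ Fintype.card I) (hH : IsHierarchy H univ) {ω : N →ₗ[ℤ] N →ₗ[ℤ] ℤ}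
    (hBA : B ∈ proper A.1) (hB : IsNode H B) (hC : IsNode H (A.1 \ B))
    (h0 : ω (clusterSlope Δ σ B) (clusterSlope Δ σ (A.1 \ B)) = 0) :
    bivector (clusterSlope Δ σ B) (clusterSlope Δ σ (A.1 \ B)) ∈ Kω Δ ω := by
  obtain ⟨f, g, hfg, hf, hg⟩ := exists_star_of_split hΔ σ hI hH (fun _ => 1)
    (fun _ _ _ => one_pos) 0 hBA hB hC
  refine Submodule.subset_span ⟨curveOf hΔ σ hI hH (fun _ => 1) (fun _ _ _ => one_pos) 0, A, f, g,
    valence_of_split σ hI hH hBA hB hC, hfg, ?_, ?_⟩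
  · exact (congrArg₂ (fun a b => ω a b) hf hg).trans h0
  · exact (congrArg₂ bivector hf hg).symm

theorem vertexBivector_eq_or (hΔ : ∑ e, Δ e = 0) (σ : Option I ≃ E)
    (hI : 2 ≤ Fintype.card I) (hH : IsHierarchy H univ) {ω : N →ₗ[ℤ] N →ₗ[ℤ] ℤ} (hω : ω.IsAlt)
    (l : Finset I → ℝ) (hl : ∀ X ∈ H, X ≠ univ → 0 < l X) (x : ℝ ⊗[ℤ] N)
    (hBA : B ∈ proper A.1) (hB : IsNode H B) (hC : IsNode H (A.1 \ B)) :
    (0 ≤ ω (clusterSlope Δ σ B) (clusterSlope Δ σ (A.1 \ B)) ∧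
      (curveOf hΔ σ hI hH l hl x).vertexBivector ω A =
        bivector (clusterSlope Δ σ B) (clusterSlope Δ σ (A.1 \ B))) ∨
    (ω (clusterSlope Δ σ B) (clusterSlope Δ σ (A.1 \ B)) ≤ 0 ∧
      (curveOf hΔ σ hI hH l hl x).vertexBivector ω A =
        -bivector (clusterSlope Δ σ B) (clusterSlope Δ σ (A.1 \ B))) := by
  obtain ⟨f, g, hfg, hf, hg⟩ := exists_star_of_split hΔ σ hI hH l hl x hBA hB hC
  have hcard : Fintype.card ((treeOf σ hI hH).Star A) = 3 := by
    rw [← Nat.card_eq_fintype_card]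
    exact valence_of_split σ hI hH hBA hB hC
  have hex : ∃ ab, (curveOf hΔ σ hI hH l hl x).IsOrientedPair ω A ab := by
    rcases le_total 0 (ω (clusterSlope Δ σ B) (clusterSlope Δ σ (A.1 \ B))) with h0 | h0
    · exact ⟨_, f, g, hfg, rfl, by simpa only [hf, hg] using h0⟩
    · refine ⟨_, g, f, hfg.symm, rfl, ?_⟩
      simp only [hf, hg]
      rw [← hω.neg]
      exact neg_nonneg.2 h0
  obtain ⟨f', g', hfg', hab, h0⟩ := Classical.epsilon_spec hex
  have hsum : ∑ s : (treeOf σ hI hH).Star A, (curveOf hΔ σ hI hH l hl x).out A s = 0 :=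
    (curveOf hΔ σ hI hH l hl x).balanced A
  have hpair := pairing_of_sum_eq_zero hcard hsum (wedge N) isAlt_wedge ω hω hfg hfg'
  rw [hf, hg, wedge_apply, wedge_apply] at hpair
  rw [hab] at h0
  dsimp only at h0
  have hvb : (curveOf hΔ σ hI hH l hl x).vertexBivector ω A =
      bivector ((curveOf hΔ σ hI hH l hl x).out A f') ((curveOf hΔ σ hI hH l hl x).out A g') := by
    have : (curveOf hΔ σ hI hH l hl x).vertexBivector ω A =
        bivector (Classical.epsilon ((curveOf hΔ σ hI hH l hl x).IsOrientedPair ω A)).1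
          (Classical.epsilon ((curveOf hΔ σ hI hH l hl x).IsOrientedPair ω A)).2 := rfl
    rw [this, hab]
  rw [hvb]
  rcases hpair with ⟨h1, h2⟩ | ⟨h1, h2⟩
  · exact Or.inl ⟨h1 ▸ h0, h2⟩
  · exact Or.inr ⟨by rw [h1] at h0; exact neg_nonneg.1 h0, h2⟩

/-- The pairing of the slopes of the ends, over the reals. -/
def endPairing (Δ : E → N) (σ : Option I ≃ E) (ω : N →ₗ[ℤ] N →ₗ[ℤ] ℤ) (i j : I) : ℝ :=
  (ω (Δ (σ (some i))) (Δ (σ (some j))) : ℤ)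

/-- The monomials of the bivectors of pairs of ends. -/
def endMonomial (Δ : E → N) (σ : Option I ≃ E) (ω : N →ₗ[ℤ] N →ₗ[ℤ] ℤ) (i j : I) :
    RefinedRing Δ ω :=
  qpow Δ ω (bivector (Δ (σ (some i))) (Δ (σ (some j))))

theorem endPairing_swap (σ : Option I ≃ E) {ω : N →ₗ[ℤ] N →ₗ[ℤ] ℤ} (hω : ω.IsAlt) (i j : I) :
    endPairing Δ σ ω i j = -endPairing Δ σ ω j i := by
  rw [endPairing, endPairing, ← hω.neg]
  push_cast
  rfl

theorem flow_endPairing (σ : Option I ≃ E) (ω : N →ₗ[ℤ] N →ₗ[ℤ] ℤ) (C : Finset I) (i : I) :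
    flow (endPairing Δ σ ω) C i = (ω (Δ (σ (some i))) (clusterSlope Δ σ C) : ℤ) := by
  simp [flow, endPairing, clusterSlope]

theorem mass_flow_endPairing (σ : Option I ≃ E) (ω : N →ₗ[ℤ] N →ₗ[ℤ] ℤ) (B C : Finset I) :
    mass (flow (endPairing Δ σ ω) C) B = (ω (clusterSlope Δ σ B) (clusterSlope Δ σ C) : ℤ) := by
  simp only [mass, flow_endPairing, clusterSlope, map_sum, LinearMap.sum_apply, Int.cast_sum]
  rw [Finset.sum_comm]

theorem setPair_endMonomial (σ : Option I ≃ E) (ω : N →ₗ[ℤ] N →ₗ[ℤ] ℤ) (B C : Finset I) :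
    setPair (endMonomial Δ σ ω) B C =
      qpow Δ ω (bivector (clusterSlope Δ σ B) (clusterSlope Δ σ C)) := by
  simp only [setPair, endMonomial, ← qpow_sum, ← wedge_apply, clusterSlope, map_sum,
    LinearMap.sum_apply]
  rw [Finset.sum_comm]

theorem bracket_endMonomial (σ : Option I ≃ E) (ω : N →ₗ[ℤ] N →ₗ[ℤ] ℤ) (B C : Finset I) :
    bracket (endMonomial Δ σ ω) B C =
      qpow Δ ω (bivector (clusterSlope Δ σ B) (clusterSlope Δ σ C)) -
        qpow Δ ω (-bivector (clusterSlope Δ σ B) (clusterSlope Δ σ C)) := by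
  rw [bracket, setPair_endMonomial, setPair_endMonomial, ← bivector_swap]

/-- Two disjoint clusters with pairing zero meet at a vertex of some curve, so the bracket vanishes
modulo `Kω`. -/
theorem bracket_endMonomial_eq_zero (hΔ : ∑ e, Δ e = 0) (σ : Option I ≃ E)
    (hI : 2 ≤ Fintype.card I) (ω : N →ₗ[ℤ] N →ₗ[ℤ] ℤ) {B C : Finset I} (hB : B.Nonempty)
    (hC : C.Nonempty) (hBC : Disjoint B C) (h0 : mass (flow (endPairing Δ σ ω) C) B = 0) :
    bracket (endMonomial Δ σ ω) B C = 0 := by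
  classical
  rw [mass_flow_endPairing, Int.cast_eq_zero] at h0
  have hcard : 2 ≤ #(B ∪ C) := by
    have h1 := hB.card_pos
    have h2 := hC.card_pos
    rw [Finset.card_union_of_disjoint hBC]
    omega
  have hH : IsHierarchy (({univ, B ∪ C, B, C} : Finset (Finset I)).filter fun X => 2 ≤ #X)
      univ := by
    refine ⟨fun _ _ => Finset.subset_univ _, fun X hX => (Finset.mem_filter.1 hX).2,
      fun h => by simp only [Finset.mem_filter, Finset.mem_insert, true_or, true_and]; exact h,
      ?_⟩
    have hCB := hBC.symm
    have h1 : B ⊆ B ∪ C := Finset.subset_union_left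
    have h2 : C ⊆ B ∪ C := Finset.subset_union_right
    intro X hX Y hY
    simp only [Finset.mem_filter, Finset.mem_insert, Finset.mem_singleton] at hX hY
    obtain ⟨rfl | rfl | rfl | rfl, -⟩ := hX <;> obtain ⟨rfl | rfl | rfl | rfl, -⟩ := hY <;>
      simp [*]
  have hsub : (B ∪ C) \ B = C := by
    rw [Finset.union_sdiff_cancel_left hBC]
  have hnode : ∀ X ∈ ({univ, B ∪ C, B, C} : Finset (Finset I)), X.Nonempty →
      IsNode (({univ, B ∪ C, B, C} : Finset (Finset I)).filter fun X => 2 ≤ #X) X := by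
    intro X hX hne
    by_cases h : 2 ≤ #X
    · exact Or.inl (Finset.mem_filter.2 ⟨hX, h⟩)
    · have := hne.card_pos
      exact Or.inr (by omega)
  have hmem := bivector_mem_Kω hΔ σ hI hH (ω := ω) (B := B)
    (A := ⟨B ∪ C, Finset.mem_filter.2 ⟨by simp, hcard⟩⟩) (by
      refine mem_proper.2 ⟨Finset.subset_union_left.ssubset_of_ne fun h => ?_, hB⟩
      obtain ⟨c, hc⟩ := hC
      exact Finset.disjoint_left.1 hBC (h ▸ Finset.mem_union_right B hc) hc)
    (hnode B (by simp) hB)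
    (by
      dsimp only
      rw [hsub]
      exact hnode C (by simp) hC)
    (by
      dsimp only
      rwa [hsub])
  dsimp only at hmem
  rw [hsub] at hmem
  rw [bracket_endMonomial, qpow_eq_one Δ ω hmem, qpow_eq_one Δ ω (neg_mem hmem), sub_self]

/-- The multiplicity of a trivalent curve is the weight of its hierarchy. A vertex at which the
pairing vanishes has no split, and gives the factor zero in the weight. -/
theorem refinedMult_curveClass (hΔ : ∑ e, Δ e = 0) (σ : Option I ≃ E)
    (hI : 2 ≤ Fintype.card I) (hH : IsHierarchy H univ) {ω : N →ₗ[ℤ] N →ₗ[ℤ] ℤ} (hω : ω.IsAlt)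
    (l : Finset I → ℝ) (hl : ∀ X ∈ H, X ≠ univ → 0 < l X) (x : ℝ ⊗[ℤ] N)
    (h3 : ∀ A ∈ H, #(children H A) = 2) :
    (curveClass hΔ σ hI hH l hl x).refinedMult ω =
      treeWeight (endMonomial Δ σ ω) (endPairing Δ σ ω) H := by
  classical
  have hw := endPairing_swap (Δ := Δ) σ hω
  have h1 : (curveClass hΔ σ hI hH l hl x).refinedMult ω = ∏ A : {A // A ∈ H},
      (qpow Δ ω ((curveOf hΔ σ hI hH l hl x).vertexBivector ω A) -
        qpow Δ ω (-(curveOf hΔ σ hI hH l hl x).vertexBivector ω A)) := rfl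
  rw [h1, treeWeight, ← Finset.prod_coe_sort H]
  refine Finset.prod_congr rfl fun A _ => ?_
  obtain ⟨B, hBA, hB, hC⟩ := exists_split_of_card_children hI hH A.2 (h3 A.1 A.2)
  have hCA := sdiff_mem_proper hBA
  have hBB := sdiff_sdiff_of_mem_proper hBA
  have hsum : ∀ B, IsSplit (endPairing Δ σ ω) H A.1 B →
      ∑ D ∈ (proper A.1).filter (IsSplit (endPairing Δ σ ω) H A.1),
        bracket (endMonomial Δ σ ω) D (A.1 \ D) =
      bracket (endMonomial Δ σ ω) B (A.1 \ B) := by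
    intro B hB
    rw [Finset.sum_eq_single_of_mem B (Finset.mem_filter.2 ⟨hB.1, hB⟩)]
    intro D hD hne
    exact absurd ((Finset.mem_filter.1 hD).2.unique hw hH hB) hne.symm
  have hmass := mass_flow_endPairing (Δ := Δ) σ ω B (A.1 \ B)
  have hmass' := mass_flow_swap hw B (A.1 \ B)
  rcases lt_trichotomy (ω (clusterSlope Δ σ B) (clusterSlope Δ σ (A.1 \ B))) 0 with h | h | h
  · have hs : IsSplit (endPairing Δ σ ω) H A.1 (A.1 \ B) := by
      refine ⟨hCA, hC, by rwa [hBB], ?_⟩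
      rw [hBB, hmass', hmass]
      exact neg_pos.2 (by exact_mod_cast h)
    rw [hsum _ hs, bracket_endMonomial, hBB, bivector_swap (clusterSlope Δ σ B)]
    rcases vertexBivector_eq_or hΔ σ hI hH hω l hl x hBA hB hC with ⟨h0, -⟩ | ⟨-, h0⟩
    · omega
    · rw [h0]
  · have hK := bivector_mem_Kω hΔ σ hI hH hBA hB hC h
    rw [Finset.sum_eq_zero]
    · rcases vertexBivector_eq_or hΔ σ hI hH hω l hl x hBA hB hC with ⟨-, h0⟩ | ⟨-, h0⟩
      · rw [h0, qpow_eq_one Δ ω hK, qpow_eq_one Δ ω (neg_mem hK), sub_self]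
      · rw [h0, neg_neg, qpow_eq_one Δ ω hK, qpow_eq_one Δ ω (neg_mem hK), sub_self]
    · intro D hD
      exfalso
      obtain ⟨hDA, hDn, hDn', hD0⟩ := (Finset.mem_filter.1 hD).2
      have hD' : D ∈ children H A.1 := by
        rw [children_eq_of_split hI hH A.2 hDA hDn hDn']
        exact Finset.mem_insert_self _ _
      rw [children_eq_of_split hI hH A.2 hBA hB hC, Finset.mem_insert, Finset.mem_singleton] at hD'
      rcases hD' with rfl | rfl
      · rw [hmass, h] at hD0
        simp at hD0
      · rw [hBB, hmass', hmass, h] at hD0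
        simp at hD0
  · have hs : IsSplit (endPairing Δ σ ω) H A.1 B := by
      refine ⟨hBA, hB, hC, ?_⟩
      rw [hmass]
      exact_mod_cast h
    rw [hsum _ hs, bracket_endMonomial]
    rcases vertexBivector_eq_or hΔ σ hI hH hω l hl x hBA hB hC with ⟨-, h0⟩ | ⟨h0, -⟩
    · rw [h0]
    · omega

end Star

end

/-! ### Moments -/

section

section Dimension

variable {I : Type} [DecidableEq I] [Fintype I] {H : Finset (Finset I)}

theorem Solves.shift {w : I → I → ℝ} {l : Finset I → ℝ} {ν : I → ℝ} (huniv : univ ∈ H)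
    (h : Solves w univ H l ν) (c : ℝ) :
    Solves w univ H (Function.update l univ (l univ + c)) (ν + c • flow w univ) := by
  refine (solves_congr (fun X _ => ?_) fun _ _ => rfl).1 (h.add_smul (solves_flow_top huniv) c)
  by_cases hX : X = univ
  · rw [hX]
    simp
  · simp [hX]

/-- If the lengths of a hierarchy can be adapted to all moments, then the hierarchy is binary, and
the lengths are determined by the moments: compare dimensions. -/
theorem binary_of_forall_solves (hI : 2 ≤ Fintype.card I) (hH : IsHierarchy H univ)
    {w : I → I → ℝ} (hsolve : ∀ ν, mass ν univ = 0 → ∃ l, Solves w univ H l ν) :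
    (∀ A ∈ H, #(children H A) = 2) ∧ ∀ l l' ν, Solves w univ H l ν → Solves w univ H l' ν →
      ∀ X ∈ H, l X = l' X := by
  obtain ⟨i₀⟩ : Nonempty I := Fintype.card_pos_iff.1 (by omega)
  let L : ({X // X ∈ H} → ℝ) × ℝ →ₗ[ℝ] (I → ℝ) :=
    { toFun := fun p => (fun i => ∑ X : {X // X ∈ H}, if i ∈ X.1 then p.1 X * flow w X.1 i else 0) +
        p.2 • Pi.single i₀ 1
      map_add' := fun p q => by
        ext i
        have h1 : ∀ X : {X // X ∈ H}, (if i ∈ X.1 then (p + q).1 X * flow w X.1 i else 0) =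
            (if i ∈ X.1 then p.1 X * flow w X.1 i else 0) +
              if i ∈ X.1 then q.1 X * flow w X.1 i else 0 := fun X => by
          split_ifs
          · simp only [Prod.fst_add, Pi.add_apply, add_mul]
          · rw [add_zero]
        simp only [Pi.add_apply, h1, Finset.sum_add_distrib, Prod.snd_add, add_smul]
        ring
      map_smul' := fun c p => by
        ext i
        have h1 : ∀ X : {X // X ∈ H}, (if i ∈ X.1 then (c • p).1 X * flow w X.1 i else 0) =
            c * (if i ∈ X.1 then p.1 X * flow w X.1 i else 0) := fun X => by
          split_ifs
          · simp only [Prod.smul_fst, Pi.smul_apply, smul_eq_mul, mul_assoc]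
          · rw [mul_zero]
        simp only [Pi.add_apply, h1, ← Finset.mul_sum, Prod.smul_snd, Pi.smul_apply, smul_eq_mul,
          RingHom.id_apply]
        ring }
  have hL : ∀ (l : Finset I → ℝ) (ν : I → ℝ), Solves w univ H l ν →
      L (fun X => l X.1, 0) = ν := by
    intro l ν h
    ext i
    rw [h i (Finset.mem_univ i), ← Finset.sum_coe_sort H]
    simp [L]
  have hsurj : Function.Surjective L := by
    intro v
    have h0 : mass (v - mass v univ • Pi.single i₀ 1) univ = 0 := by
      simp only [mass, Pi.sub_apply, Pi.smul_apply, smul_eq_mul, Finset.sum_sub_distrib,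
        ← Finset.mul_sum, Finset.sum_pi_single', Finset.mem_univ, if_true, mul_one, sub_self]
    obtain ⟨l, hl⟩ := hsolve _ h0
    refine ⟨(fun X => l X.1, 0) + mass v univ • (0, 1), ?_⟩
    rw [map_add, hL l _ hl, map_smul]
    have : L (0, 1) = Pi.single i₀ 1 := by
      ext i
      simp [L]
    rw [this, sub_add_cancel]
  have hdim : Module.finrank ℝ (({X // X ∈ H} → ℝ) × ℝ) = #H + 1 := by
    simp
  have h1 := LinearMap.finrank_le_finrank_of_surjective hsurj
  have h2 := card_hierarchy_lt hI hH
  rw [hdim, Module.finrank_fintype_fun_eq_card] at h1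
  have h3 : #H + 1 = Fintype.card I := le_antisymm h2 h1
  refine ⟨(card_hierarchy_eq_iff hI hH).1 h3, fun l l' ν h h' X hX => ?_⟩
  have hinj : Function.Injective L := (LinearMap.injective_iff_surjective_of_finrank_eq_finrank
    (by rw [hdim, Module.finrank_fintype_fun_eq_card, h3])).2 hsurj
  have := hinj ((hL l ν h).trans (hL l' ν h').symm)
  exact congrFun (congrArg Prod.fst this) ⟨X, hX⟩

end Dimension

section Evaluation

variable {I : Type} [DecidableEq I] [Fintype I] {E : Type*} [Fintype E] {N : Type*}
  [AddCommGroup N] {H : Finset (Finset I)} {Δ : E → N}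

/-- The curve of the hierarchy `H`, with the position of its root vertex given by a point `y` of the
line spanned by the end `σ none` and by the distance `l univ` from `y`. -/
def curveAt (hΔ : ∑ e, Δ e = 0) (σ : Option I ≃ E) (hI : 2 ≤ Fintype.card I)
    (hH : IsHierarchy H univ) (l : Finset I → ℝ) (hl : ∀ X ∈ H, X ≠ univ → 0 < l X)
    (y : ℝ ⊗[ℤ] N) : ModuliSpace Δ :=
  curveClass hΔ σ hI hH l hl (y + l univ • ((1 : ℝ) ⊗ₜ[ℤ] clusterSlope Δ σ univ))

variable {hΔ : ∑ e, Δ e = 0} {σ : Option I ≃ E} {hI : 2 ≤ Fintype.card I}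
  {hH : IsHierarchy H univ} {l : Finset I → ℝ} {hl : ∀ X ∈ H, X ≠ univ → 0 < l X}
  {y : ℝ ⊗[ℤ] N}

theorem curveAt_congr {l' : Finset I → ℝ} {hl' : ∀ X ∈ H, X ≠ univ → 0 < l' X}
    (h : ∀ X ∈ H, l X = l' X) : curveAt hΔ σ hI hH l hl y = curveAt hΔ σ hI hH l' hl' y :=
  curveClass_congr (fun X hX _ => h X hX) (by rw [h _ (univ_mem_of_isHierarchy hI hH)])

theorem update_pos (hl : ∀ X ∈ H, X ≠ univ → 0 < l X) (c : ℝ) :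
    ∀ X ∈ H, X ≠ univ → 0 < Function.update l univ c X := fun X hX hXu => by
  rw [Function.update_of_ne hXu]
  exact hl X hX hXu

/-- Sliding the reference point along the end `σ none`. -/
theorem curveAt_add_smul (c : ℝ) :
    curveAt hΔ σ hI hH l hl (y + c • ((1 : ℝ) ⊗ₜ[ℤ] clusterSlope Δ σ univ)) =
      curveAt hΔ σ hI hH (Function.update l univ (l univ + c)) (update_pos hl _) y := by
  refine curveClass_congr (fun X _ hXu => (Function.update_of_ne hXu _ _).symm) ?_
  rw [Function.update_self, add_smul]
  abel

theorem exists_eq_curveAt [Module.Free ℤ N] (hΔ : ∑ e, Δ e = 0)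
    (σ : Option I ≃ E) (hI : 2 ≤ Fintype.card I) (Γ : ModuliSpace Δ) :
    ∃ (H : Finset (Finset I)) (hH : IsHierarchy H univ) (l : Finset I → ℝ)
      (hl : ∀ X ∈ H, X ≠ univ → 0 < l X) (y : ℝ ⊗[ℤ] N), Γ = curveAt hΔ σ hI hH l hl y := by
  obtain ⟨H, hH, l, hl, x, rfl⟩ := exists_eq_curveClass hΔ σ hI Γ
  refine ⟨H, hH, l, hl, x - l univ • ((1 : ℝ) ⊗ₜ[ℤ] clusterSlope Δ σ univ), ?_⟩
  exact curveClass_congr (fun _ _ _ => rfl) (sub_add_cancel _ _).symm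

theorem mom_curveAt_none {ω : N →ₗ[ℤ] N →ₗ[ℤ] ℤ} (hω : ω.IsAlt) :
    (curveAt hΔ σ hI hH l hl y).mom ω (σ none) = realExt (ω (Δ (σ none))) y := by
  have h1 : (curveAt hΔ σ hI hH l hl y).mom ω (σ none) = realExt (ω (Δ (σ none)))
      (clusterPos Δ σ H l (y + l univ • ((1 : ℝ) ⊗ₜ[ℤ] clusterSlope Δ σ univ))
        (endCluster σ hI hH (σ none)).1) := rfl
  rw [h1, endCluster_none]
  change realExt _ (clusterPos Δ σ H l _ univ) = _
  rw [clusterPos_univ, clusterSlope_univ σ hΔ, map_add, map_smul, realExt_tmul, map_neg,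
    hω.self_eq_zero]
  simp

theorem ev_curveAt_none : (curveAt hΔ σ hI hH l hl y).ev (σ none) = Submodule.Quotient.mk y := by
  have h1 : (curveAt hΔ σ hI hH l hl y).ev (σ none) = Submodule.Quotient.mk
      (clusterPos Δ σ H l (y + l univ • ((1 : ℝ) ⊗ₜ[ℤ] clusterSlope Δ σ univ))
        (endCluster σ hI hH (σ none)).1) := rfl
  rw [h1, endCluster_none]
  change Submodule.Quotient.mk (clusterPos Δ σ H l _ univ) = _
  rw [clusterPos_univ, clusterSlope_univ σ hΔ, Submodule.Quotient.eq, add_sub_cancel_left,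
    TensorProduct.tmul_neg, smul_neg]
  exact neg_mem (Submodule.smul_mem _ _ (Submodule.mem_span_singleton_self _))

/-- The part of the moments `m` of the ends `i : I` that is not accounted for by the position
`y`. -/
def residual (Δ : E → N) (σ : Option I ≃ E) (ω : N →ₗ[ℤ] N →ₗ[ℤ] ℤ) (m : E → ℝ)
    (y : ℝ ⊗[ℤ] N) (i : I) : ℝ :=
  m (σ (some i)) - realExt (ω (Δ (σ (some i)))) y

theorem residual_add_smul (ω : N →ₗ[ℤ] N →ₗ[ℤ] ℤ) (m m' : E → ℝ) (y y' : ℝ ⊗[ℤ] N) (c : ℝ) :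
    residual Δ σ ω (m + c • m') (y + c • y') = residual Δ σ ω m y + c • residual Δ σ ω m' y' := by
  ext i
  simp only [residual, map_add, map_smul, Pi.add_apply, Pi.smul_apply, smul_eq_mul]
  ring

theorem residual_shift (ω : N →ₗ[ℤ] N →ₗ[ℤ] ℤ) (m : E → ℝ) (y : ℝ ⊗[ℤ] N) (c : ℝ) :
    residual Δ σ ω m (y + c • ((1 : ℝ) ⊗ₜ[ℤ] clusterSlope Δ σ univ)) +
      c • flow (endPairing Δ σ ω) univ = residual Δ σ ω m y := by
  ext i
  simp only [residual, map_add, map_smul, Pi.add_apply, Pi.smul_apply, smul_eq_mul,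
    flow_endPairing, realExt_tmul]
  ring

theorem sum_realExt (ω : N →ₗ[ℤ] N →ₗ[ℤ] ℤ) (hΔ : ∑ e, Δ e = 0) (y : ℝ ⊗[ℤ] N) :
    ∑ e, realExt (ω (Δ e)) y = 0 := by
  induction y using TensorProduct.induction_on with
  | zero => simp
  | tmul c n =>
    simp only [realExt_tmul]
    rw [← Finset.mul_sum, ← Int.cast_sum, ← LinearMap.sum_apply, ← map_sum, hΔ]
    simp
  | add y y' h h' => simp only [map_add, Finset.sum_add_distrib, h, h', add_zero]

theorem mass_residual (ω : N →ₗ[ℤ] N →ₗ[ℤ] ℤ) (hΔ : ∑ e, Δ e = 0) (σ : Option I ≃ E)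
    (m : E → ℝ) (y : ℝ ⊗[ℤ] N) : mass (residual Δ σ ω m y) univ =
      ∑ e, m e - (m (σ none) - realExt (ω (Δ (σ none))) y) := by
  have h1 := sum_realExt ω hΔ y
  rw [← Equiv.sum_comp σ, Fintype.sum_option] at h1
  rw [← Equiv.sum_comp σ, Fintype.sum_option]
  simp only [mass, residual, Finset.sum_sub_distrib]
  linarith

theorem clusterPos_up_singleton (hI : 2 ≤ Fintype.card I) (hH : IsHierarchy H univ)
    (l : Finset I → ℝ) (y : ℝ ⊗[ℤ] N) (i : I) :
    clusterPos Δ σ H l (y + l univ • ((1 : ℝ) ⊗ₜ[ℤ] clusterSlope Δ σ univ)) (up H {i}) =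
      y + ∑ B ∈ H with i ∈ B, l B • ((1 : ℝ) ⊗ₜ[ℤ] clusterSlope Δ σ B) := by
  have huniv := univ_mem_of_isHierarchy hI hH
  obtain ⟨h1, h2, h3⟩ := up_spec hI hH (X := {i}) (by simp) (singleton_ne_univ hI i)
  have : (H.filter fun B => i ∈ B) = insert univ (H.filter fun B => B ≠ univ ∧ up H {i} ⊆ B) := by
    ext B
    simp only [Finset.mem_filter, Finset.mem_insert]
    constructor
    · rintro ⟨hB, hiB⟩
      by_cases hBu : B = univ
      · exact Or.inl hBu
      · refine Or.inr ⟨hB, hBu, h3 B hB ((Finset.singleton_subset_iff.2 hiB).ssubset_of_ne ?_)⟩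
        intro h
        have := hH.two_le_card B hB
        rw [← h, Finset.card_singleton] at this
        omega
    · rintro (rfl | ⟨hB, -, hiB⟩)
      · exact ⟨huniv, Finset.mem_univ i⟩
      · exact ⟨hB, hiB (h2.1 (Finset.mem_singleton_self i))⟩
  rw [this, Finset.sum_insert (by simp), clusterPos, add_assoc]

/-- The moments of a curve in terms of its lengths. -/
theorem mom_curveAt_some (ω : N →ₗ[ℤ] N →ₗ[ℤ] ℤ) (i : I) :
    (curveAt hΔ σ hI hH l hl y).mom ω (σ (some i)) = realExt (ω (Δ (σ (some i)))) y +
      ∑ X ∈ H, if i ∈ X then l X * flow (endPairing Δ σ ω) X i else 0 := by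
  have h1 : (curveAt hΔ σ hI hH l hl y).mom ω (σ (some i)) = realExt (ω (Δ (σ (some i))))
      (clusterPos Δ σ H l (y + l univ • ((1 : ℝ) ⊗ₜ[ℤ] clusterSlope Δ σ univ))
        (endCluster σ hI hH (σ (some i))).1) := rfl
  rw [h1, endCluster_some, clusterPos_up_singleton hI hH, map_add, map_sum, Finset.sum_filter]
  simp only [map_smul, realExt_tmul, flow_endPairing, smul_eq_mul, one_mul]

theorem mom_curveAt_eq_iff {ω : N →ₗ[ℤ] N →ₗ[ℤ] ℤ} (hω : ω.IsAlt) {m : E → ℝ} :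
    (curveAt hΔ σ hI hH l hl y).mom ω = m ↔ realExt (ω (Δ (σ none))) y = m (σ none) ∧
      Solves (endPairing Δ σ ω) univ H l (residual Δ σ ω m y) := by
  constructor
  · rintro rfl
    refine ⟨(mom_curveAt_none hω).symm, fun i _ => ?_⟩
    rw [residual, mom_curveAt_some, add_sub_cancel_left]
  · rintro ⟨h1, h2⟩
    ext e
    obtain ⟨o, rfl⟩ := σ.surjective e
    cases o with
    | none => rw [mom_curveAt_none hω, h1]
    | some i =>
      rw [mom_curveAt_some, ← h2 i (Finset.mem_univ i), residual]
      ring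

theorem sum_mom_eq_zero [Module.Free ℤ N] (hΔ : ∑ e, Δ e = 0) (σ : Option I ≃ E)
    (hI : 2 ≤ Fintype.card I) {ω : N →ₗ[ℤ] N →ₗ[ℤ] ℤ} (hω : ω.IsAlt) (Γ : ModuliSpace Δ) :
    ∑ e, Γ.mom ω e = 0 := by
  obtain ⟨H, hH, l, hl, y, rfl⟩ := exists_eq_curveAt hΔ σ hI Γ
  obtain ⟨h1, h2⟩ := (mom_curveAt_eq_iff (hΔ := hΔ) (σ := σ) (hI := hI) (hH := hH) (l := l)
    (hl := hl) (y := y) hω).1 rfl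
  have h3 := h2.mass_eq_zero (endPairing_swap σ hω) hH
  rwa [mass_residual ω hΔ, h1, sub_self, sub_zero] at h3

variable {δ : N}

/-- Two points which are equal modulo `δ` and the end `σ none`, and which give the same moment of
this end, only differ by a translation along the end. -/
theorem exists_eq_add_smul {ω : N →ₗ[ℤ] N →ₗ[ℤ] ℤ} (hω : ω.IsAlt) (hΔ : ∑ e, Δ e = 0)
    (σ : Option I ≃ E) (hδ : ω (Δ (σ none)) δ ≠ 0) {y y₀ : ℝ ⊗[ℤ] N}
    (h1 : (Submodule.Quotient.mk y - Submodule.Quotient.mk y₀ : NRmod (Δ (σ none))) ∈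
      Submodule.span ℝ {slopeIn (Δ (σ none)) δ})
    (h2 : realExt (ω (Δ (σ none))) y = realExt (ω (Δ (σ none))) y₀) :
    ∃ c : ℝ, y = y₀ + c • ((1 : ℝ) ⊗ₜ[ℤ] clusterSlope Δ σ univ) := by
  obtain ⟨s, hs⟩ := Submodule.mem_span_singleton.1 h1
  rw [slopeIn, ← Submodule.Quotient.mk_smul, ← Submodule.Quotient.mk_sub, eq_comm,
    Submodule.Quotient.eq] at hs
  obtain ⟨c, hc⟩ := Submodule.mem_span_singleton.1 hs
  have h3 := congrArg (realExt (ω (Δ (σ none)))) hc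
  rw [map_sub, map_sub, h2, sub_self, map_smul, map_smul, realExt_tmul, realExt_tmul,
    hω.self_eq_zero] at h3
  have hs0 : s = 0 := by
    have : (ω (Δ (σ none)) δ : ℝ) ≠ 0 := by exact_mod_cast hδ
    simpa [this] using h3
  refine ⟨-c, ?_⟩
  rw [hs0, zero_smul, sub_zero] at hc
  rw [clusterSlope_univ σ hΔ, TensorProduct.tmul_neg, smul_neg, neg_smul, neg_neg, hc]
  abel

end Evaluation

end

/-! ### Solutions, genericity and the count -/

section

variable {I : Type} [DecidableEq I] [Fintype I] {E : Type*} [Fintype E] {N : Type*}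
  [AddCommGroup N] {H : Finset (Finset I)} {Δ : E → N} {hΔ : ∑ e, Δ e = 0} {σ : Option I ≃ E}
  {hI : 2 ≤ Fintype.card I} {hH : IsHierarchy H univ} {ω : N →ₗ[ℤ] N →ₗ[ℤ] ℤ} {δ : N}
  {μ : momentSpace E} {p : NRmod (Δ (σ none))} {y₀ : ℝ ⊗[ℤ] N}

section Solutions

theorem mem_lineThrough {n q : N} {p p' : NRmod n} :
    p' ∈ lineThrough q p ↔ p' - p ∈ Submodule.span ℝ {slopeIn n q} :=
  AffineSubspace.mem_mk'

/-- The line `D` has a point with the prescribed moment of the end `σ none`. -/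
theorem exists_base_point (hδ : ω (Δ (σ none)) δ ≠ 0) (p : NRmod (Δ (σ none))) (m : ℝ) :
    ∃ y₀ : ℝ ⊗[ℤ] N, Submodule.Quotient.mk y₀ ∈ lineThrough δ p ∧
      realExt (ω (Δ (σ none))) y₀ = m := by
  obtain ⟨q, rfl⟩ := Submodule.Quotient.mk_surjective _ p
  have hδ' : (ω (Δ (σ none)) δ : ℝ) ≠ 0 := by exact_mod_cast hδ
  refine ⟨q + ((m - realExt (ω (Δ (σ none))) q) / ω (Δ (σ none)) δ) • ((1 : ℝ) ⊗ₜ[ℤ] δ), ?_, ?_⟩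
  · rw [mem_lineThrough, Submodule.Quotient.mk_add, add_sub_cancel_left,
      Submodule.Quotient.mk_smul]
    exact Submodule.smul_mem _ _ (Submodule.mem_span_singleton_self _)
  · rw [map_add, map_smul, realExt_tmul, one_mul, smul_eq_mul, div_mul_cancel₀ _ hδ',
      add_sub_cancel]

theorem curveAt_mem_omegaSolutions (hω : ω.IsAlt)
    (h1 : Submodule.Quotient.mk y₀ ∈ lineThrough δ p)
    (h2 : realExt (ω (Δ (σ none))) y₀ = μ.1 (σ none)) {l : Finset I → ℝ}
    {hl : ∀ X ∈ H, X ≠ univ → 0 < l X}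
    (h : Solves (endPairing Δ σ ω) univ H l (residual Δ σ ω μ.1 y₀)) :
    curveAt hΔ σ hI hH l hl y₀ ∈ omegaSolutions Δ ω (σ none) μ (lineThrough δ p) :=
  ⟨(mom_curveAt_eq_iff hω).2 ⟨h2, h⟩, by rwa [ev_curveAt_none]⟩

/-- The solutions are the curves of the hierarchies with lengths that realize the residual
moments at a point of the line. -/
theorem exists_of_mem_omegaSolutions [Module.Free ℤ N] (hΔ : ∑ e, Δ e = 0)
    (hI : 2 ≤ Fintype.card I) (hω : ω.IsAlt) (hδ : ω (Δ (σ none)) δ ≠ 0)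
    (h1 : Submodule.Quotient.mk y₀ ∈ lineThrough δ p)
    (h2 : realExt (ω (Δ (σ none))) y₀ = μ.1 (σ none)) {Γ : ModuliSpace Δ}
    (hΓ : Γ ∈ omegaSolutions Δ ω (σ none) μ (lineThrough δ p)) :
    ∃ (H : Finset (Finset I)) (hH : IsHierarchy H univ) (l : Finset I → ℝ)
      (hl : ∀ X ∈ H, X ≠ univ → 0 < l X), Γ = curveAt hΔ σ hI hH l hl y₀ ∧
        Solves (endPairing Δ σ ω) univ H l (residual Δ σ ω μ.1 y₀) := by
  obtain ⟨H, hH, l, hl, y, rfl⟩ := exists_eq_curveAt hΔ σ hI Γ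
  obtain ⟨hm, hev⟩ := hΓ
  obtain ⟨hm1, hm2⟩ := (mom_curveAt_eq_iff hω).1 hm
  rw [ev_curveAt_none, mem_lineThrough] at hev
  rw [mem_lineThrough] at h1
  obtain ⟨c, rfl⟩ := exists_eq_add_smul hω hΔ σ hδ (y := y) (y₀ := y₀)
    (by simpa using sub_mem hev h1) (hm1.trans h2.symm)
  refine ⟨H, hH, _, update_pos hl _, curveAt_add_smul c, ?_⟩
  have := hm2.shift (univ_mem_of_isHierarchy hI hH) c
  rwa [residual_shift] at this

theorem composedEv_eq_of_mem {e₀ : E} {p : NRmod (Δ e₀)} {Γ Γ' : ModuliSpace Δ}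
    (h : Γ ∈ omegaSolutions Δ ω e₀ μ (lineThrough δ p))
    (h' : Γ' ∈ omegaSolutions Δ ω e₀ μ (lineThrough δ p)) :
    Γ.composedEv ω e₀ δ = Γ'.composedEv ω e₀ δ := by
  refine Prod.ext ?_ ?_
  · refine (Submodule.Quotient.eq _).2 ?_
    have := sub_mem (mem_lineThrough.1 h.2) (mem_lineThrough.1 h'.2)
    rwa [sub_sub_sub_cancel_right] at this
  · funext e
    change Γ.mom ω e.1 = Γ'.mom ω e.1
    rw [h.1, h'.1]

/-- The composed evaluation map is injective on the cone of a hierarchy whose lengths are determined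
by the moments. -/
theorem injOn_composedEv [Module.Free ℤ N] (hΔ : ∑ e, Δ e = 0)
    (hI : 2 ≤ Fintype.card I) (hH : IsHierarchy H univ) (hω : ω.IsAlt)
    (hδ : ω (Δ (σ none)) δ ≠ 0)
    (huniq : ∀ l l' ν, Solves (endPairing Δ σ ω) univ H l ν →
      Solves (endPairing Δ σ ω) univ H l' ν → ∀ X ∈ H, l X = l' X) :
    Set.InjOn (ModuliSpace.composedEv ω (σ none) δ)
      (ModuliSpace.cone Δ (treeClass σ hI hH)) := by
  intro Γ₁ hΓ₁ Γ₂ hΓ₂ heq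
  obtain ⟨hev, hmom⟩ := Prod.ext_iff.1 heq
  have hm : Γ₁.mom ω = Γ₂.mom ω := by
    have hne : ∀ e, e ≠ σ none → Γ₁.mom ω e = Γ₂.mom ω e := fun e he => congrFun hmom ⟨e, he⟩
    have s1 := sum_mom_eq_zero hΔ σ hI hω Γ₁
    have s2 := sum_mom_eq_zero hΔ σ hI hω Γ₂
    ext e
    by_cases he : e = σ none
    · subst he
      rw [← Equiv.sum_comp σ, Fintype.sum_option] at s1 s2
      rw [Finset.sum_congr rfl fun i _ => hne (σ (some i)) (by simp)] at s1
      linarith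
    · exact hne e he
  have hev : Γ₁.ev (σ none) - Γ₂.ev (σ none) ∈ Submodule.span ℝ {slopeIn (Δ (σ none)) δ} :=
    (Submodule.Quotient.eq _).1 hev
  obtain ⟨H₁, hH₁, l₁, hl₁, y₁, rfl⟩ := exists_eq_curveAt hΔ σ hI Γ₁
  obtain ⟨H₂, hH₂, l₂, hl₂, y₂, rfl⟩ := exists_eq_curveAt hΔ σ hI Γ₂
  obtain rfl : H₁ = H := eq_of_treeClass_eq (σ := σ) (hI := hI) (hH := hH₁) (hH' := hH) hΓ₁
  obtain rfl : H₂ = H₁ := eq_of_treeClass_eq (σ := σ) (hI := hI) (hH := hH₂) (hH' := hH) hΓ₂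
  obtain ⟨h1, h1'⟩ := (mom_curveAt_eq_iff hω).1 hm
  obtain ⟨h2, h2'⟩ := (mom_curveAt_eq_iff (hΔ := hΔ) (σ := σ) (hI := hI) (hH := hH₂) (l := l₂)
    (hl := hl₂) (y := y₂) hω).1 rfl
  rw [ev_curveAt_none, ev_curveAt_none] at hev
  obtain ⟨c, rfl⟩ := exists_eq_add_smul hω hΔ σ hδ hev (h1.trans h2.symm)
  have h3 := h1'.shift (univ_mem_of_isHierarchy hI hH) c
  rw [residual_shift] at h3
  rw [curveAt_add_smul]
  exact curveAt_congr (huniq _ _ _ h3 h2')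

/-- For generic constraints, each combinatorial type carries at most one solution. -/
theorem finite_omegaSolutions {e₀ : E} {p : NRmod (Δ e₀)} (σ : Option I ≃ E)
    (hI : 2 ≤ Fintype.card I) (hgen : IsGenericConstraint Δ ω e₀ δ μ p) :
    (omegaSolutions Δ ω e₀ μ (lineThrough δ p)).Finite := by
  have hfin : (Set.univ : Set (CombType E)).Finite := by
    have h := Set.finite_range fun H : {H : Finset (Finset I) // IsHierarchy H univ} =>
      treeClass σ hI H.2
    refine h.subset fun c _ => ?_
    obtain ⟨H, hH, rfl⟩ := exists_eq_treeClass σ hI c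
    exact ⟨⟨H, hH⟩, rfl⟩
  refine Set.Finite.of_injOn (f := ModuliSpace.comb) (Set.mapsTo_univ _ _) ?_ hfin
  intro Γ hΓ Γ' hΓ' h
  exact (hgen Γ' hΓ').2 h rfl (composedEv_eq_of_mem hΓ hΓ')

end Solutions

section Genericity

/-- The constraints met by curves of the type of `H` with arbitrary, possibly negative, lengths. -/
def constraintSpace (Δ : E → N) (σ : Option I ≃ E) (ω : N →ₗ[ℤ] N →ₗ[ℤ] ℤ) (δ : N)
    (H : Finset (Finset I)) : Submodule ℝ (momentSpace E × NRmod (Δ (σ none))) :=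
  have key : ∀ x x' : momentSpace E × NRmod (Δ (σ none)), ∀ c : ℝ,
      (∃ l y, (Submodule.Quotient.mk y - x.2 : NRmod (Δ (σ none))) ∈
        Submodule.span ℝ {slopeIn (Δ (σ none)) δ} ∧ realExt (ω (Δ (σ none))) y = x.1.1 (σ none) ∧
          Solves (endPairing Δ σ ω) univ H l (residual Δ σ ω x.1.1 y)) →
      (∃ l y, (Submodule.Quotient.mk y - x'.2 : NRmod (Δ (σ none))) ∈
        Submodule.span ℝ {slopeIn (Δ (σ none)) δ} ∧ realExt (ω (Δ (σ none))) y = x'.1.1 (σ none) ∧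
          Solves (endPairing Δ σ ω) univ H l (residual Δ σ ω x'.1.1 y)) →
      ∃ l y, (Submodule.Quotient.mk y - (x + c • x').2 : NRmod (Δ (σ none))) ∈
        Submodule.span ℝ {slopeIn (Δ (σ none)) δ} ∧
          realExt (ω (Δ (σ none))) y = (x + c • x').1.1 (σ none) ∧
          Solves (endPairing Δ σ ω) univ H l (residual Δ σ ω (x + c • x').1.1 y) := by
    rintro x x' c ⟨l, y, h1, h2, h3⟩ ⟨l', y', h1', h2', h3'⟩
    refine ⟨l + c • l', y + c • y', ?_, ?_, ?_⟩
    · have := add_mem h1 (Submodule.smul_mem _ c h1')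
      convert this using 1
      rw [Submodule.Quotient.mk_add, Submodule.Quotient.mk_smul, Prod.snd_add, Prod.smul_snd,
        smul_sub]
      abel
    · rw [map_add, map_smul, h2, h2']
      rfl
    · have := h3.add_smul h3' c
      rwa [← residual_add_smul] at this
  have zero : ∃ l y, (Submodule.Quotient.mk y - 0 : NRmod (Δ (σ none))) ∈
        Submodule.span ℝ {slopeIn (Δ (σ none)) δ} ∧ realExt (ω (Δ (σ none))) y = 0 ∧
          Solves (endPairing Δ σ ω) univ H l (residual Δ σ ω 0 y) :=
    ⟨0, 0, by simp, by simp, fun i _ => by simp [residual]⟩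
  { carrier := {x | ∃ l y, (Submodule.Quotient.mk y - x.2 : NRmod (Δ (σ none))) ∈
        Submodule.span ℝ {slopeIn (Δ (σ none)) δ} ∧ realExt (ω (Δ (σ none))) y = x.1.1 (σ none) ∧
          Solves (endPairing Δ σ ω) univ H l (residual Δ σ ω x.1.1 y)}
    add_mem' := fun {x x'} hx hx' => by
      have := key x x' 1 hx hx'
      rwa [one_smul] at this
    zero_mem' := zero
    smul_mem' := fun c x hx => by
      have := key 0 x c zero hx
      rwa [zero_add] at this }

theorem mem_constraintSpace {H : Finset (Finset I)} {x : momentSpace E × NRmod (Δ (σ none))} :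
    x ∈ constraintSpace Δ σ ω δ H ↔ ∃ l y, (Submodule.Quotient.mk y - x.2 : NRmod (Δ (σ none))) ∈
        Submodule.span ℝ {slopeIn (Δ (σ none)) δ} ∧ realExt (ω (Δ (σ none))) y = x.1.1 (σ none) ∧
          Solves (endPairing Δ σ ω) univ H l (residual Δ σ ω x.1.1 y) := Iff.rfl

theorem exists_solves_of_constraintSpace_eq_top (hΔ : ∑ e, Δ e = 0) (hω : ω.IsAlt)
    (hδ : ω (Δ (σ none)) δ ≠ 0) (huniv : univ ∈ H) (htop : constraintSpace Δ σ ω δ H = ⊤)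
    {ν : I → ℝ} (hν : mass ν univ = 0) : ∃ l, Solves (endPairing Δ σ ω) univ H l ν := by
  have hmem : (fun e => (σ.symm e).elim 0 ν) ∈ momentSpace E := by
    change ∑ e, (σ.symm e).elim 0 ν = 0
    rw [← Equiv.sum_comp σ, Fintype.sum_option]
    simpa [mass] using hν
  have h : ((⟨_, hmem⟩, 0) : momentSpace E × NRmod (Δ (σ none))) ∈ constraintSpace Δ σ ω δ H :=
    htop ▸ Submodule.mem_top
  obtain ⟨l, y, h1, h2, h3⟩ := mem_constraintSpace.1 h
  obtain ⟨c, rfl⟩ := exists_eq_add_smul hω hΔ σ hδ (y := y) (y₀ := 0) h1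
    (by rw [h2, map_zero]; simp)
  have h4 := h3.shift huniv c
  rw [residual_shift] at h4
  refine ⟨_, (solves_congr (fun _ _ => rfl) fun i _ => ?_).1 h4⟩
  simp [residual]

/-- Constraints outside the proper ones among the spaces `constraintSpace` are generic. -/
theorem exists_finite_forall_isGenericConstraint [Module.Free ℤ N] (hΔ : ∑ e, Δ e = 0)
    (σ : Option I ≃ E) (hI : 2 ≤ Fintype.card I) (hω : ω.IsAlt) (hδ : ω (Δ (σ none)) δ ≠ 0) :
    ∃ S : Set (Submodule ℝ (momentSpace E × NRmod (Δ (σ none)))), S.Finite ∧ (∀ W ∈ S, W ≠ ⊤) ∧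
      ∀ (μ : momentSpace E) (p : NRmod (Δ (σ none))), (∀ W ∈ S, (μ, p) ∉ W) →
        IsGenericConstraint Δ ω (σ none) δ μ p := by
  refine ⟨Set.range (constraintSpace Δ σ ω δ) \ {⊤}, (Set.finite_range _).sdiff, fun W hW => hW.2,
    fun μ p hμp Γ hΓ => ?_⟩
  obtain ⟨y₀, hy₀, hy₀'⟩ := exists_base_point (σ := σ) hδ p (μ.1 (σ none))
  obtain ⟨H, hH, l, hl, rfl, hsol⟩ := exists_of_mem_omegaSolutions hΔ hI hω hδ hy₀ hy₀' hΓ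
  have htop : constraintSpace Δ σ ω δ H = ⊤ := by
    by_contra hne
    exact hμp _ ⟨⟨H, rfl⟩, hne⟩ (mem_constraintSpace.2 ⟨l, y₀, mem_lineThrough.1 hy₀, hy₀', hsol⟩)
  obtain ⟨h3, huniq⟩ := binary_of_forall_solves hI hH (w := endPairing Δ σ ω) fun ν hν =>
    exists_solves_of_constraintSpace_eq_top hΔ hω hδ (univ_mem_of_isHierarchy hI hH) htop hν
  exact ⟨(isTrivalent_curveClass_iff hΔ σ hI hH l hl _).2 h3,
    injOn_composedEv hΔ hI hH hω hδ huniq⟩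

end Genericity

section Count

/-- Contracting the edges of length zero. -/
theorem isHierarchy_filter (hI : 2 ≤ Fintype.card I) (hH : IsHierarchy H univ)
    (P : Finset I → Prop) [DecidablePred P] (hP : P univ) : IsHierarchy (H.filter P) univ where
  subset _ _ := Finset.subset_univ _
  two_le_card X hX := hH.two_le_card X (Finset.mem_filter.1 hX).1
  top_mem _ := Finset.mem_filter.2 ⟨univ_mem_of_isHierarchy hI hH, hP⟩
  laminar X hX Y hY := hH.laminar X (Finset.mem_filter.1 hX).1 Y (Finset.mem_filter.1 hY).1

theorem card_children_of_mem_binaryHierarchies {w : I → I → ℝ} (hI : 2 ≤ Fintype.card I)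
    (h : H ∈ binaryHierarchies w univ) : ∀ A ∈ H, #(children H A) = 2 := by
  intro A hA
  obtain ⟨hH, hsplit⟩ := mem_binaryHierarchies.1 h
  obtain ⟨B, hBA, hB, hC, -⟩ := hsplit A hA
  rw [children_eq_of_split hI hH hA hBA hB hC, Finset.card_pair]
  intro h
  obtain ⟨b, hb⟩ := (mem_proper.1 hBA).2
  have hb' := hb
  rw [h] at hb'
  exact (Finset.mem_sdiff.1 hb').2 hb

theorem mem_binaryHierarchies_of_treeWeight_ne_zero {R : Type*} [CommRing R] {t : I → I → R}
    {w : I → I → ℝ} (hH : IsHierarchy H univ) (h : treeWeight t w H ≠ 0) :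
    H ∈ binaryHierarchies w univ := by
  classical
  refine mem_binaryHierarchies.2 ⟨hH, fun X hX => ?_⟩
  by_contra hex
  refine h (Finset.prod_eq_zero hX (Finset.sum_eq_zero fun B hB => ?_))
  exact absurd ⟨B, (Finset.mem_filter.1 hB).2⟩ hex

/-- For generic constraints, no degeneration of a binary hierarchy solves them: contracting the
edges of length zero would give a solution which is not trivalent. -/
theorem pos_of_nonneg_of_isGenericConstraint (hΔ : ∑ e, Δ e = 0) (hI : 2 ≤ Fintype.card I)
    (hω : ω.IsAlt) (h1 : Submodule.Quotient.mk y₀ ∈ lineThrough δ p)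
    (h2 : realExt (ω (Δ (σ none))) y₀ = μ.1 (σ none))
    (hgen : IsGenericConstraint Δ ω (σ none) δ μ p)
    (hH : H ∈ binaryHierarchies (endPairing Δ σ ω) univ) {l : Finset I → ℝ}
    (hsol : Solves (endPairing Δ σ ω) univ H l (residual Δ σ ω μ.1 y₀))
    (hl : ∀ X ∈ H, X ≠ univ → 0 ≤ l X) : ∀ X ∈ H, X ≠ univ → 0 < l X := by
  classical
  have h3 := card_children_of_mem_binaryHierarchies hI hH
  have hH := (mem_binaryHierarchies.1 hH).1
  have hH' := isHierarchy_filter hI hH (fun X => X = univ ∨ l X ≠ 0) (Or.inl rfl)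
  have hl' : ∀ X ∈ H.filter (fun X => X = univ ∨ l X ≠ 0), X ≠ univ → 0 < l X := by
    intro X hX hXu
    obtain ⟨hX, hX'⟩ := Finset.mem_filter.1 hX
    exact (hl X hX hXu).lt_of_ne (hX'.resolve_left hXu).symm
  have hsol' : Solves (endPairing Δ σ ω) univ (H.filter (fun X => X = univ ∨ l X ≠ 0)) l
      (residual Δ σ ω μ.1 y₀) := by
    intro i hi
    rw [hsol i hi]
    refine (Finset.sum_filter_of_ne fun X _ hne => ?_).symm
    by_contra hX
    push Not at hX
    exact hne (by rw [hX.2, zero_mul, ite_self])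
  have htri := (hgen _ (curveAt_mem_omegaSolutions (hΔ := hΔ) (hI := hI) (hH := hH') (hl := hl')
    hω h1 h2 hsol')).1
  have hcard := (card_hierarchy_eq_iff hI hH').2
    ((isTrivalent_curveClass_iff hΔ σ hI hH' l hl' _).1 htri)
  have hcard' := (card_hierarchy_eq_iff hI hH).2 h3
  have heq := Finset.eq_of_subset_of_card_le
    (Finset.filter_subset (fun X => X = univ ∨ l X ≠ 0) H) (by omega)
  exact fun X hX hXu => hl' X (heq.symm ▸ hX) hXu

theorem isHierarchy_singleton_univ (hI : 2 ≤ Fintype.card I) :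
    IsHierarchy ({univ} : Finset (Finset I)) univ where
  subset _ _ := Finset.subset_univ _
  two_le_card X hX := by rwa [Finset.mem_singleton.1 hX, Finset.card_univ]
  top_mem _ := Finset.mem_singleton_self _
  laminar X hX Y hY := Or.inl (by rw [Finset.mem_singleton.1 hX, Finset.mem_singleton.1 hY])

open Classical in
/-- The count of the solutions as a sum over binary hierarchies. -/
theorem refinedCount_eq_sum [Module.Free ℤ N] (hΔ : ∑ e, Δ e = 0) (hI : 2 ≤ Fintype.card I)
    (hω : ω.IsAlt) (hδ : ω (Δ (σ none)) δ ≠ 0)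
    (h1 : Submodule.Quotient.mk y₀ ∈ lineThrough δ p)
    (h2 : realExt (ω (Δ (σ none))) y₀ = μ.1 (σ none))
    (hgen : IsGenericConstraint Δ ω (σ none) δ μ p) :
    refinedCount Δ ω (σ none) μ (lineThrough δ p) =
      ∑ H ∈ binaryHierarchies (endPairing Δ σ ω) univ,
        if RootRealizes (endPairing Δ σ ω) univ H (residual Δ σ ω μ.1 y₀) then
          treeWeight (endMonomial Δ σ ω) (endPairing Δ σ ω) H else 0 := by
  rw [← Finset.sum_filter]
  set T := (binaryHierarchies (endPairing Δ σ ω) univ).filter fun H =>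
    RootRealizes (endPairing Δ σ ω) univ H (residual Δ σ ω μ.1 y₀)
  have hex : ∀ H ∈ T, ∃ Γ ∈ omegaSolutions Δ ω (σ none) μ (lineThrough δ p),
      (∃ hH : IsHierarchy H univ, Γ.comb = treeClass σ hI hH) ∧
        Γ.refinedMult ω = treeWeight (endMonomial Δ σ ω) (endPairing Δ σ ω) H := by
    intro H hHT
    obtain ⟨hHb, l, hsol, hl⟩ := Finset.mem_filter.1 hHT
    have hH := (mem_binaryHierarchies.1 hHb).1
    exact ⟨curveAt hΔ σ hI hH l hl y₀, curveAt_mem_omegaSolutions hω h1 h2 hsol, ⟨hH, rfl⟩,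
      refinedMult_curveClass hΔ σ hI hH hω l hl _ (card_children_of_mem_binaryHierarchies hI hHb)⟩
  have : Nonempty (ModuliSpace Δ) :=
    ⟨curveAt hΔ σ hI (isHierarchy_singleton_univ hI) (fun _ => 1) (fun _ _ _ => one_pos) 0⟩
  choose! c hc hcomb hmult using hex
  have hinj : Set.InjOn c (T : Set (Finset (Finset I))) := by
    intro H hH H' hH' heq
    obtain ⟨h, hc1⟩ := hcomb H hH
    obtain ⟨h', hc2⟩ := hcomb H' hH'
    rw [heq, hc2] at hc1
    exact (eq_of_treeClass_eq hc1).symm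
  rw [← Finset.sum_congr rfl hmult, ← finsum_mem_coe_finset, ← finsum_mem_image hinj,
    refinedCount]
  refine finsum_mem_inter_support_eq _ _ _ (subset_antisymm ?_ ?_)
  · rintro Γ ⟨hΓ, hne⟩
    refine ⟨?_, hne⟩
    obtain ⟨H, hH, l, hl, rfl, hsol⟩ := exists_of_mem_omegaSolutions hΔ hI hω hδ h1 h2 hΓ
    have htri := (isTrivalent_curveClass_iff hΔ σ hI hH l hl _).1 (hgen _ hΓ).1
    have hne' : treeWeight (endMonomial Δ σ ω) (endPairing Δ σ ω) H ≠ 0 := by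
      rw [← refinedMult_curveClass hΔ σ hI hH hω l hl _ htri]
      exact hne
    have hHT : H ∈ T := Finset.mem_filter.2
      ⟨mem_binaryHierarchies_of_treeWeight_ne_zero hH hne', l, hsol, hl⟩
    obtain ⟨_, hcH⟩ := hcomb H hHT
    exact ⟨H, hHT, (hgen _ hΓ).2 hcH rfl (composedEv_eq_of_mem (hc H hHT) hΓ)⟩
  · rintro _ ⟨⟨H, hH, rfl⟩, hne⟩
    exact ⟨hc H hH, hne⟩

theorem exists_forall_refinedCount_eq [Module.Free ℤ N] (hΔ : ∑ e, Δ e = 0) (σ : Option I ≃ E)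
    (hI : 2 ≤ Fintype.card I) (hω : ω.IsAlt) :
    ∃ B : RefinedRing Δ ω, ∀ δ : N, ω (Δ (σ none)) δ ≠ 0 →
      ∀ (μ : momentSpace E) (p : NRmod (Δ (σ none))), IsGenericConstraint Δ ω (σ none) δ μ p →
        refinedCount Δ ω (σ none) μ (lineThrough δ p) = B := by
  obtain ⟨G, hG⟩ := exists_sum_treeWeight_eq (endMonomial Δ σ ω) (endPairing_swap (Δ := Δ) σ hω)
    (fun B C hB hC hBC h0 => bracket_endMonomial_eq_zero hΔ σ hI ω hB hC hBC h0)
    (A := univ) (by rwa [Finset.card_univ])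
  refine ⟨G, fun δ hδ μ p hgen => ?_⟩
  obtain ⟨y₀, h1, h2⟩ := exists_base_point (σ := σ) hδ p (μ.1 (σ none))
  rw [refinedCount_eq_sum hΔ hI hω hδ h1 h2 hgen]
  refine hG _ ?_ fun H hH l hsol hl =>
    pos_of_nonneg_of_isGenericConstraint hΔ hI hω h1 h2 hgen hH hsol hl
  rw [mass_residual ω hΔ, h2, sub_self, sub_zero]
  exact μ.2

end Count

end

end FlowTree

end

theorem theorem3p6 {N E : Type*} [AddCommGroup N] [Module.Free ℤ N] [Module.Finite ℤ N]
    (hN : 2 ≤ Module.finrank ℤ N) [Fintype E] (hE : 3 ≤ Fintype.card E)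
    (Δ : E → N) (hΔ : ∑ e, Δ e = 0)
    (ω : N →ₗ[ℤ] N →ₗ[ℤ] ℤ) (hω : ω.IsAlt) (hωΔ : ∀ e, ω (Δ e) ≠ 0) (e₀ : E) :
    -- for every slope, the constraints outside finitely many proper subspaces are generic
    (∀ δ : N, ω (Δ e₀) δ ≠ 0 →
      ∃ S : Set (Submodule ℝ (momentSpace E × NRmod (Δ e₀))), S.Finite ∧ (∀ W ∈ S, W ≠ ⊤) ∧
        ∀ (μ : momentSpace E) (p : NRmod (Δ e₀)), (∀ W ∈ S, (μ, p) ∉ W) →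
          IsGenericConstraint Δ ω e₀ δ μ p) ∧
    -- for generic constraints there are finitely many solutions
    (∀ δ : N, ω (Δ e₀) δ ≠ 0 → ∀ (μ : momentSpace E) (p : NRmod (Δ e₀)),
      IsGenericConstraint Δ ω e₀ δ μ p →
        (omegaSolutions Δ ω e₀ μ (lineThrough δ p)).Finite) ∧
    -- the refined count is the same for all generic constraints and all slopes
    (∃! B : RefinedRing Δ ω, ∀ δ : N, ω (Δ e₀) δ ≠ 0 →
      ∀ (μ : momentSpace E) (p : NRmod (Δ e₀)), IsGenericConstraint Δ ω e₀ δ μ p →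
        refinedCount Δ ω e₀ μ (lineThrough δ p) = B) := by
  classical
  -- the other ends are labelled by `Fin m`
  obtain ⟨m, hm⟩ : ∃ m, Fintype.card {e : E // e ≠ e₀} = m := ⟨_, rfl⟩
  have hm2 : 2 ≤ m := by
    have := Fintype.card_subtype_compl (fun e : E => e = e₀)
    rw [Fintype.card_subtype_eq] at this
    rw [← hm]
    change Fintype.card {e : E // ¬ e = e₀} ≥ 2
    omega
  obtain ⟨σ, rfl⟩ : ∃ σ : Option (Fin m) ≃ E, σ none = e₀ :=
    ⟨(Equiv.optionCongr (Fintype.equivFinOfCardEq hm).symm).trans (Equiv.optionSubtypeNe e₀),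
      rfl⟩
  have hI : 2 ≤ Fintype.card (Fin m) := by rwa [Fintype.card_fin]
  have hgen := fun δ (hδ : ω (Δ (σ none)) δ ≠ 0) =>
    FlowTree.exists_finite_forall_isGenericConstraint hΔ σ hI hω hδ
  refine ⟨hgen, fun δ _ μ p h => FlowTree.finite_omegaSolutions σ hI h, ?_⟩
  obtain ⟨B, hB⟩ := FlowTree.exists_forall_refinedCount_eq hΔ σ hI hω
  refine ⟨B, hB, fun B' hB' => ?_⟩
  -- uniqueness holds because there are generic constraints
  obtain ⟨δ, hδ⟩ : ∃ δ, ω (Δ (σ none)) δ ≠ 0 := by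
    by_contra! h
    exact hωΔ (σ none) (LinearMap.ext h)
  obtain ⟨S, hS, hS', hgenS⟩ := hgen δ hδ
  obtain ⟨⟨μ, p⟩, -, hμp⟩ := FlowTree.exists_mem_forall_notMem hS ⊤ fun W hW h =>
    hS' W hW (top_le_iff.1 h)
  have h := hgenS μ p hμp
  rw [← hB δ hδ μ p h, ← hB' δ hδ μ p h]
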